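/- **Conventions.** A sequence $A \xrightarrow{f} B \xrightarrow{g} C$ of commutative monoids is *exact* if $f$ is injective, $g$ is surjective, and for all $z,w\in B$ one has $g(z)=g(w)$ if and only if $f(x)z=f(y)w$ for some $x,y\in A$; a sequence of sheaves of commutative monoids is exact if it is exact on all stalks. For a scheme $X$: * $\mathrm{Pic}(X)$ is the set of isomorphism classes of invertible $\mathscr O_X$-modules, a commutative monoid under $\otimes$. * A *quadratic $\mathscr O_X$-algebra* is a sheaf of $\mathscr O_X$-algebras that is locally free of rank $2$ as an $\mathscr O_X$-module. $\mathrm{Quad}(X)$ is the set of isomorphism classes of quadratic $\mathscr O_X$-algebras, and $\mathrm{Quad}(X;\mathscr O_X)\subseteq\mathrm{Quad}(X)$ is the subset of the classes of $\mathscr S$ with $\bigwedge^2\mathscr S\simeq\mathscr O_X$. The product $\mathscr S*\mathscr T$ is given locally as follows: where $\mathscr S$ and $\mathscr T$ have bases $1,x$ and $1,y$ with $x^2=tx-n$ and $y^2=sy-m$, the algebra $\mathscr S*\mathscr T$ has a basis $1,w$, $w=w(x,y)$, with $w^2=(st)w-(mt^2+ns^2-4nm)$; these are glued along $w(x,y)=uv\,w(x',y')+(qt+rs-2qr)$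 for $x=ux'+r$, $y=vy'+q$. The identity is the class of $\mathscr O_X\times\mathscr O_X$. * A *discriminant* over $X$ is a pair $(d,\mathscr L)$ with $\mathscr L$ an invertible $\mathscr O_X$-module and $d$ a global section of $(\mathscr L^\vee)^{\otimes 2}$ for which there is a global section $\bar t$ of $\mathscr L^\vee/2\mathscr L^\vee$ with $\bar t\otimes\bar t\equiv d \pmod 4$. An isomorphism $(d,\mathscr L)\simeq(d',\mathscr L')$ is an isomorphism $f:\mathscr L\to\mathscr L'$ with $(f^\vee)^{\otimes 2}(d')=d$. $\mathrm{Disc}(X)$ is the set of isomorphism classes of discriminants, a commutative monoid under $(d,\mathscr L)*(d',\mathscr L')=(d\otimes d',\mathscr L\otimes\mathscr L')$ with identity the class of $(1,\mathscr O_X)$, and $\mathrm{Disc}(X;\mathscr O_X)\subseteq\mathrm{Disc}(X)$ is the subset of classes with $\mathscr L\simeq\mathscr O_X$. * The discriminant of a quadratic $\mathscr O_X$-algebra $\mathscr S$ with standard involution $\sigma$ is $\mathrm{disc}(\mathscr S)=(d(\mathscr S),\bigwedge^2\mathscr S)$, where $d(\mathscr S)\big((x\wedge y)\otimes(z\wedge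 v)\big)=(x\sigma(y)-\sigma(x)y)(z\sigma(v)-\sigma(z)v)$. **Theorem B.** For every scheme $X$ the operations above are well defined on isomorphism classes and make $\mathrm{Pic}(X)$, $\mathrm{Disc}(X)$ and $\mathrm{Quad}(X)$ into commutative monoids, functorial in $X$ under pullback, and $\mathrm{Quad}(X;\mathscr O_X)$ and $\mathrm{Disc}(X;\mathscr O_X)$ are submonoids stable under pullback. There is a diagram of commutative monoids $$\begin{array}{ccccc} \mathrm{Quad}(X;\mathscr O_X) & \longrightarrow & \mathrm{Quad}(X) & \xrightarrow{\ \wedge^2\ } & \mathrm{Pic}(X)\\ \downarrow{\scriptstyle\mathrm{disc}} & & \downarrow{\scriptstyle\mathrm{disc}} & & \| \\ \mathrm{Disc}(X;\mathscr O_X) & \longrightarrow & \mathrm{Disc}(X) & \longrightarrow & \mathrm{Pic}(X) \end{array}$$ in which the left horizontal maps are the inclusions and the lower right map is $(d,\mathscr L)\mapsto\mathscr L$. All maps are monoid homomorphisms, the diagram commutes and is functorial in $X$, and its rows are exact. There is an affine open cover $(U_k)$ of $X$ such that the columns of the diagram of each $U_k$ are surjective. Moreover, the diagram of sheaves of commutative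 monoids on $X$ associated with the presheaves $U\mapsto\mathrm{Quad}(U;\mathscr O_U)$, $\mathrm{Quad}(U)$, $\mathrm{Pic}(U)$, $\mathrm{Disc}(U;\mathscr O_U)$, $\mathrm{Disc}(U)$ commutes, is functorial in $X$, and has exact rows and surjective columns. -/

import Mathlib

open CategoryTheory AlgebraicGeometry TopologicalSpace Opposite Limits

universe u

noncomputable section

namespace QuadDisc

/-! ### Sections, local bases, pairings of sheaves of modules -/

/-- Restriction of sections of an `O_X`-module. -/
def res {X : Scheme.{u}} {M : X.Modules} {U V : X.Opens} (h : V ≤ U) (s : Γ(M, U)) : Γ(M, V) :=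
  M.presheaf.map (homOfLE h).op s

/-- Restriction of sections of `O_X`. -/
def resO {X : Scheme.{u}} {U V : X.Opens} (h : V ≤ U) (a : Γ(X, U)) : Γ(X, V) :=
  X.presheaf.map (homOfLE h).op a

/-- The structure sheaf `O_X`, as a sheaf of modules over itself. -/
def structureModule (X : Scheme.{u}) : X.Modules :=
  SheafOfModules.unit X.ringCatSheaf

/-- The sections `b` over `U` form a basis of `M|_U`: the map `O_U ^ n ⟶ M|_U` that they define is
an isomorphism of sheaves. -/
def IsBasisOn {X : Scheme.{u}} {M : X.Modules} {n : ℕ} (U : X.Opens)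
    (b : Fin n → Γ(M, U)) : Prop :=
  ∀ (V : X.Opens) (h : V ≤ U) (s : Γ(M, V)),
    ∃! c : Fin n → Γ(X, V), s = ∑ i, c i • res h (b i)

/-- `M` is locally free of rank `n`. -/
def IsLocallyFreeOfRank {X : Scheme.{u}} (M : X.Modules) (n : ℕ) : Prop :=
  ∀ x : X, ∃ U : X.Opens, x ∈ U ∧ ∃ b : Fin n → Γ(M, U), IsBasisOn U b

/-- An `O_X`-bilinear map of sheaves `M × N ⟶ K`. -/
structure Pairing {X : Scheme.{u}} (M N K : X.Modules) where
  app : ∀ U : X.Opens, Γ(M, U) →ₗ[Γ(X, U)] Γ(N, U) →ₗ[Γ(X, U)] Γ(K, U)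
  map_res : ∀ {U V : X.Opens} (h : V ≤ U) (x : Γ(M, U)) (y : Γ(N, U)),
    res h (app U x y) = app V (res h x) (res h y)

/-- The pairing `β : L × M ⟶ N` exhibits `N` as the tensor product of the `O_X`-modules `L`
and `M`. -/
def Pairing.IsTensor {X : Scheme.{u}} {L M N : X.Modules} (β : Pairing L M N) : Prop :=
  ∀ (K : X.Modules) (γ : Pairing L M K), ∃! φ : N ⟶ K,
    ∀ (U : X.Opens) (x : Γ(L, U)) (y : Γ(M, U)), φ.app U (β.app U x y) = γ.app U x y

/-- The pairing `w : M × M ⟶ L` is alternating. -/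
def Pairing.IsAlternating {X : Scheme.{u}} {M L : X.Modules} (w : Pairing M M L) : Prop :=
  ∀ (U : X.Opens) (x : Γ(M, U)), w.app U x x = 0

/-- The pairing `w : M × M ⟶ L`, `(x, y) ↦ x ∧ y`, exhibits `L` as the exterior square of `M`. -/
def Pairing.IsExteriorSquare {X : Scheme.{u}} {M L : X.Modules} (w : Pairing M M L) : Prop :=
  w.IsAlternating ∧
  ∀ (K : X.Modules) (γ : Pairing M M K), γ.IsAlternating → ∃! φ : L ⟶ K,
    ∀ (U : X.Opens) (x y : Γ(M, U)), φ.app U (w.app U x y) = γ.app U x y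

/-- The morphism `η : M ⟶ f_* M'` exhibits `M'` as the pullback `f^* M`. -/
def IsPullback {X Y : Scheme.{u}} (f : X ⟶ Y) {M : Y.Modules} {M' : X.Modules}
    (η : M ⟶ (Scheme.Modules.pushforward f).obj M') : Prop :=
  IsIso (((Scheme.Modules.pullbackPushforwardAdjunction f).homEquiv M M').symm η)

/-- The map on sections `Γ(M, V) → Γ(M', f⁻¹ V)` given by a morphism `η : M ⟶ f_* M'`. -/
def pullSection {X Y : Scheme.{u}} {f : X ⟶ Y} {M : Y.Modules} {M' : X.Modules}
    (η : M ⟶ (Scheme.Modules.pushforward f).obj M') {V : Y.Opens} (s : Γ(M, V)) :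
    Γ(M', f ⁻¹ᵁ V) :=
  η.app V s

/-! ### Invertible sheaves -/

/-- An invertible `O_X`-module. -/
structure InvertibleSheaf (X : Scheme.{u}) where
  mod : X.Modules
  rank_one : IsLocallyFreeOfRank mod 1

instance InvertibleSheaf.setoid (X : Scheme.{u}) : Setoid (InvertibleSheaf X) where
  r L M := Nonempty (L.mod ≅ M.mod)
  iseqv :=
    { refl := fun L => ⟨Iso.refl L.mod⟩
      symm := fun ⟨e⟩ => ⟨e.symm⟩
      trans := fun ⟨e⟩ ⟨e'⟩ => ⟨e ≪≫ e'⟩ }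

/-- `L ≅ O_X`. -/
def InvertibleSheaf.IsOne {X : Scheme.{u}} (L : InvertibleSheaf X) : Prop :=
  Nonempty (L.mod ≅ structureModule X)

/-- `N ≅ L ⊗ M`. -/
def InvertibleSheaf.IsMul {X : Scheme.{u}} (L M N : InvertibleSheaf X) : Prop :=
  ∃ β : Pairing L.mod M.mod N.mod, β.IsTensor

/-- `L' ≅ f^* L`. -/
def InvertibleSheaf.IsPull {X Y : Scheme.{u}} (f : X ⟶ Y) (L : InvertibleSheaf Y)
    (L' : InvertibleSheaf X) : Prop :=
  ∃ η : L.mod ⟶ (Scheme.Modules.pushforward f).obj L'.mod, IsPullback f η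

/-! ### Discriminants -/

/-- An `O_U`-linear form `L|_U ⟶ O_U`, that is, a section of the dual of `L` over `U`. -/
structure LocalForm {X : Scheme.{u}} (L : X.Modules) (U : X.Opens) where
  app : ∀ V : X.Opens, V ≤ U → (Γ(L, V) →ₗ[Γ(X, V)] Γ(X, V))
  map_res : ∀ {V W : X.Opens} (hV : V ≤ U) (h : W ≤ V) (x : Γ(L, V)),
    resO h (app V hV x) = app W (h.trans hV) (res h x)

/-- The section `a` of `O_X` over `V` lies in the ideal sheaf `n O_X`. -/
def LocallyDvd {X : Scheme.{u}} (n : ℕ) {V : X.Opens} (a : Γ(X, V)) : Prop :=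
  ∀ x ∈ V, ∃ (W : X.Opens) (h : W ≤ V), x ∈ W ∧ (n : Γ(X, W)) ∣ resO h a

/-- An `O_X`-bilinear form `L × L ⟶ O_X`, that is, an `O_X`-linear map `L ⊗ L ⟶ O_X`. For an
invertible `L` this is a global section of the tensor square of the dual of `L`. -/
structure BilinearForm {X : Scheme.{u}} (L : X.Modules) where
  app : ∀ U : X.Opens, Γ(L, U) →ₗ[Γ(X, U)] Γ(L, U) →ₗ[Γ(X, U)] Γ(X, U)
  map_res : ∀ {U V : X.Opens} (h : V ≤ U) (x y : Γ(L, U)),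
    resO h (app U x y) = app V (res h x) (res h y)

/-- `d` is a square modulo `4`: there is a global section of the quotient sheaf
`Lᵛ / 2 Lᵛ`, given by local sections `t i` of the dual `Lᵛ` on an open cover that agree modulo `2`
on overlaps, whose square is the class of `d` modulo `4`. -/
def BilinearForm.IsSquareModFour {X : Scheme.{u}} {L : X.Modules} (d : BilinearForm L) : Prop :=
  ∃ (ι : Type u) (U : ι → X.Opens) (t : ∀ i, LocalForm L (U i)),
    (⨆ i, U i) = ⊤ ∧
    (∀ (i j : ι) (V : X.Opens) (hi : V ≤ U i) (hj : V ≤ U j) (x : Γ(L, V)),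
      LocallyDvd 2 ((t i).app V hi x - (t j).app V hj x)) ∧
    (∀ (i : ι) (V : X.Opens) (hi : V ≤ U i) (x y : Γ(L, V)),
      LocallyDvd 4 (d.app V x y - (t i).app V hi x * (t i).app V hi y))

/-- A discriminant `(d, L)` over `X`. -/
structure Discriminant (X : Scheme.{u}) extends InvertibleSheaf X where
  form : BilinearForm mod
  isSquareModFour : form.IsSquareModFour

/-- An isomorphism of discriminants is an isometry of the underlying invertible modules. -/
instance Discriminant.setoid (X : Scheme.{u}) : Setoid (Discriminant X) where
  r D E := ∃ e : D.mod ≅ E.mod, ∀ (U : X.Opens) (x y : Γ(D.mod, U)),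
    E.form.app U (e.hom.app U x) (e.hom.app U y) = D.form.app U x y
  iseqv :=
    { refl := fun D => ⟨Iso.refl D.mod, fun U x y => rfl⟩
      symm := by
        rintro D E ⟨e, he⟩
        refine ⟨e.symm, fun U x y => ?_⟩
        have key : ∀ z : Γ(E.mod, U), e.hom.app U (e.inv.app U z) = z := fun z => by
          rw [← ConcreteCategory.comp_apply, ← Scheme.Modules.Hom.comp_app, e.inv_hom_id]
          rfl
        rw [Iso.symm_hom, ← he, key, key]
      trans := by
        rintro D E F ⟨e, he⟩ ⟨e', he'⟩
        refine ⟨e ≪≫ e', fun U x y => ?_⟩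
        rw [← he, ← he']
        rfl }

/-- `(d, L) ≅ (1, O_X)`. -/
def Discriminant.IsOne {X : Scheme.{u}} (D : Discriminant X) : Prop :=
  ∃ e : Γ(D.mod, ⊤), IsBasisOn ⊤ ![e] ∧ D.form.app ⊤ e e = 1

/-- `F ≅ D ⊗ E`. -/
def Discriminant.IsMul {X : Scheme.{u}} (D E F : Discriminant X) : Prop :=
  ∃ β : Pairing D.mod E.mod F.mod, β.IsTensor ∧
    ∀ (U : X.Opens) (x x' : Γ(D.mod, U)) (y y' : Γ(E.mod, U)),
      F.form.app U (β.app U x y) (β.app U x' y') = D.form.app U x x' * E.form.app U y y'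

/-- `D' ≅ f^* D`. -/
def Discriminant.IsPull {X Y : Scheme.{u}} (f : X ⟶ Y) (D : Discriminant Y)
    (D' : Discriminant X) : Prop :=
  ∃ η : D.mod ⟶ (Scheme.Modules.pushforward f).obj D'.mod, IsPullback f η ∧
    ∀ (V : Y.Opens) (x y : Γ(D.mod, V)),
      D'.form.app (f ⁻¹ᵁ V) (pullSection η x) (pullSection η y) = f.app V (D.form.app V x y)

/-! ### Quadratic algebras -/

/-- A sheaf of (associative, unital) `O_X`-algebras. -/
structure AlgebraSheaf (X : Scheme.{u}) where
  mod : X.Modules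
  mul : Pairing mod mod mod
  one : ∀ U : X.Opens, Γ(mod, U)
  one_res : ∀ {U V : X.Opens} (h : V ≤ U), res h (one U) = one V
  one_mul : ∀ (U : X.Opens) (x : Γ(mod, U)), mul.app U (one U) x = x
  mul_one : ∀ (U : X.Opens) (x : Γ(mod, U)), mul.app U x (one U) = x
  mul_assoc : ∀ (U : X.Opens) (x y z : Γ(mod, U)),
    mul.app U (mul.app U x y) z = mul.app U x (mul.app U y z)

/-- A quadratic `O_X`-algebra. -/
structure QuadraticAlgebra (X : Scheme.{u}) extends AlgebraSheaf X where
  rank_two : IsLocallyFreeOfRank mod 2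

/-- Isomorphism of quadratic `O_X`-algebras. -/
instance QuadraticAlgebra.setoid (X : Scheme.{u}) : Setoid (QuadraticAlgebra X) where
  r S T := ∃ e : S.mod ≅ T.mod, ∀ U : X.Opens, e.hom.app U (S.one U) = T.one U ∧
    ∀ x y : Γ(S.mod, U),
      e.hom.app U (S.mul.app U x y) = T.mul.app U (e.hom.app U x) (e.hom.app U y)
  iseqv :=
    { refl := fun S => ⟨Iso.refl S.mod, fun U => ⟨rfl, fun x y => rfl⟩⟩
      symm := by
        rintro S T ⟨e, he⟩
        refine ⟨e.symm, fun U => ?_⟩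
        have key : ∀ z : Γ(T.mod, U), e.hom.app U (e.inv.app U z) = z := fun z => by
          rw [← ConcreteCategory.comp_apply, ← Scheme.Modules.Hom.comp_app, e.inv_hom_id]
          rfl
        have key' : ∀ z : Γ(S.mod, U), e.inv.app U (e.hom.app U z) = z := fun z => by
          rw [← ConcreteCategory.comp_apply, ← Scheme.Modules.Hom.comp_app, e.hom_inv_id]
          rfl
        refine ⟨?_, fun x y => ?_⟩
        · rw [Iso.symm_hom, ← (he U).1, key']
        · rw [Iso.symm_hom, ← key' (S.mul.app U _ _), (he U).2, key, key]
      trans := by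
        rintro S T R ⟨e, he⟩ ⟨e', he'⟩
        refine ⟨e ≪≫ e', fun U => ⟨?_, fun x y => ?_⟩⟩
        · rw [← (he' U).1, ← (he U).1]
          rfl
        · exact (congrArg (fun z => e'.hom.app U z) ((he U).2 x y)).trans ((he' U).2 _ _) }

/-- `S ≅ O_X × O_X` as algebras: `S` is free on a pair of complementary idempotents. -/
def QuadraticAlgebra.IsOne {X : Scheme.{u}} (S : QuadraticAlgebra X) : Prop :=
  ∃ e : Γ(S.mod, ⊤), S.mul.app ⊤ e e = e ∧ IsBasisOn ⊤ ![e, S.one ⊤ - e]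

/-- `1, x` is a basis of `S` over `U`. -/
def QuadraticAlgebra.IsGen {X : Scheme.{u}} (S : QuadraticAlgebra X) {U : X.Opens}
    (x : Γ(S.mod, U)) : Prop :=
  IsBasisOn U ![S.one U, x]

/-- `x² = t x - n`. -/
def QuadraticAlgebra.HasEquation {X : Scheme.{u}} (S : QuadraticAlgebra X) {U : X.Opens}
    (x : Γ(S.mod, U)) (t n : Γ(X, U)) : Prop :=
  S.mul.app U x x = t • x - n • S.one U

/-- `P ≅ S * T`. If `1, x` and `1, y` are bases of `S` and `T` over `U`, with `x² = t x - n` and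
`y² = s y - m`, then `P` has over `U` a basis `1, w` with `w = w(x, y)` satisfying
`w² = (s t) w - (m t² + n s² - 4 n m)`. The `w(x, y)` are compatible with restriction, and `P` is
glued by means of the canonical isomorphisms
`w(x, y) = u v w(x', y') + (q t + r s - 2 q r)` for `x = u x' + r` and `y = v y' + q`. -/
def QuadraticAlgebra.IsMul {X : Scheme.{u}} (S T P : QuadraticAlgebra X) : Prop :=
  ∃ w : ∀ U : X.Opens, Γ(S.mod, U) → Γ(T.mod, U) → Γ(P.mod, U),
    (∀ (U : X.Opens) (x : Γ(S.mod, U)) (y : Γ(T.mod, U)), S.IsGen x → T.IsGen y →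
      P.IsGen (w U x y) ∧
      (∀ (V : X.Opens) (h : V ≤ U), res h (w U x y) = w V (res h x) (res h y)) ∧
      ∀ t n s m : Γ(X, U), S.HasEquation x t n → T.HasEquation y s m →
        P.HasEquation (w U x y) (s * t) (m * t ^ 2 + n * s ^ 2 - 4 * n * m)) ∧
    (∀ (U : X.Opens) (x x' : Γ(S.mod, U)) (y y' : Γ(T.mod, U)),
      S.IsGen x → S.IsGen x' → T.IsGen y → T.IsGen y' →
      ∀ t n s m u r v q : Γ(X, U), S.HasEquation x t n → T.HasEquation y s m →
        x = u • x' + r • S.one U → y = v • y' + q • T.one U →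
        w U x y = (u * v) • w U x' y' + (q * t + r * s - 2 * q * r) • P.one U)

/-- `S' ≅ f^* S`. -/
def QuadraticAlgebra.IsPull {X Y : Scheme.{u}} (f : X ⟶ Y) (S : QuadraticAlgebra Y)
    (S' : QuadraticAlgebra X) : Prop :=
  ∃ η : S.mod ⟶ (Scheme.Modules.pushforward f).obj S'.mod, IsPullback f η ∧
    ∀ V : Y.Opens, pullSection η (S.one V) = S'.one (f ⁻¹ᵁ V) ∧
      ∀ x y : Γ(S.mod, V), pullSection η (S.mul.app V x y) =
        S'.mul.app (f ⁻¹ᵁ V) (pullSection η x) (pullSection η y)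

/-- `⋀² S ≅ L`. -/
def QuadraticAlgebra.HasWedge {X : Scheme.{u}} (S : QuadraticAlgebra X) (L : X.Modules) : Prop :=
  ∃ w : Pairing S.mod S.mod L, w.IsExteriorSquare

/-- `σ` is a standard involution on `S`. -/
structure QuadraticAlgebra.IsStandardInvolution {X : Scheme.{u}} (S : QuadraticAlgebra X)
    (σ : S.mod ⟶ S.mod) : Prop where
  map_one : ∀ U : X.Opens, σ.app U (S.one U) = S.one U
  map_mul : ∀ (U : X.Opens) (x y : Γ(S.mod, U)),
    σ.app U (S.mul.app U x y) = S.mul.app U (σ.app U y) (σ.app U x)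
  involutive : ∀ (U : X.Opens) (x : Γ(S.mod, U)), σ.app U (σ.app U x) = x
  norm_mem : ∀ (U : X.Opens) (x : Γ(S.mod, U)), ∃ n : Γ(X, U),
    S.mul.app U x (σ.app U x) = n • S.one U

/-- `x σ(y) - σ(x) y`. -/
def QuadraticAlgebra.skew {X : Scheme.{u}} (S : QuadraticAlgebra X) (σ : S.mod ⟶ S.mod)
    {U : X.Opens} (x y : Γ(S.mod, U)) : Γ(S.mod, U) :=
  S.mul.app U x (σ.app U y) - S.mul.app U (σ.app U x) y

/-- `D ≅ disc(S) = (d(S), ⋀² S)`, where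
`d(S) ((x ∧ y) ⊗ (z ∧ v)) = (x σ(y) - σ(x) y) (z σ(v) - σ(z) v)` with `σ` the standard
involution of `S`. -/
def QuadraticAlgebra.HasDisc {X : Scheme.{u}} (S : QuadraticAlgebra X)
    (D : Discriminant X) : Prop :=
  ∃ (σ : S.mod ⟶ S.mod) (w : Pairing S.mod S.mod D.mod),
    S.IsStandardInvolution σ ∧ w.IsExteriorSquare ∧
    ∀ (U : X.Opens) (x y z v : Γ(S.mod, U)),
      D.form.app U (w.app U x y) (w.app U z v) • S.one U =
        S.mul.app U (S.skew σ x y) (S.skew σ z v)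

/-! ### Isomorphism classes and their monoid structures -/

/-- The set `Pic(X)`. -/
def Pic (X : Scheme.{u}) : Type (u + 1) := Quotient (InvertibleSheaf.setoid X)

/-- The set `Disc(X)`. -/
def Disc (X : Scheme.{u}) : Type (u + 1) := Quotient (Discriminant.setoid X)

/-- The set `Quad(X)`. -/
def Quad (X : Scheme.{u}) : Type (u + 1) := Quotient (QuadraticAlgebra.setoid X)

/-- The class of an invertible sheaf. -/
def Pic.mk {X : Scheme.{u}} (L : InvertibleSheaf X) : Pic X := Quotient.mk _ L

/-- The class of a discriminant. -/
def Disc.mk {X : Scheme.{u}} (D : Discriminant X) : Disc X := Quotient.mk _ D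

/-- The class of a quadratic algebra. -/
def Quad.mk {X : Scheme.{u}} (S : QuadraticAlgebra X) : Quad X := Quotient.mk _ S

/-- The subset `Disc(X; L)` of `Disc(X)`. -/
def DiscWith (X : Scheme.{u}) (L : X.Modules) : Set (Disc X) :=
  {c | ∃ D : Discriminant X, Disc.mk D = c ∧ Nonempty (D.mod ≅ L)}

/-- The subset `Quad(X; L)` of `Quad(X)`. -/
def QuadWith (X : Scheme.{u}) (L : X.Modules) : Set (Quad X) :=
  {c | ∃ S : QuadraticAlgebra X, Quad.mk S = c ∧ S.HasWedge L}

/-- For a family of sets of classes `C X`, one for each scheme `X`, with `mk` sending an object to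
its class: commutative monoid structures on all the `C X` and pullback homomorphisms, functorial
in `X`, which are computed on objects by the relations `IsOne` ("is isomorphic to the unit object"),
`IsMul` ("is isomorphic to the product of") and `IsPull` ("is isomorphic to the pullback of").
The equivalences say in particular that products, units and pullbacks of objects exist and that
they are unique up to isomorphism, so there is at most one such structure. -/
structure MonoidsOfClasses {Obj C : Scheme.{u} → Type (u + 1)} (mk : ∀ {X}, Obj X → C X)
    (IsOne : ∀ {X}, Obj X → Prop) (IsMul : ∀ {X}, Obj X → Obj X → Obj X → Prop)
    (IsPull : ∀ {X Y} (_ : X ⟶ Y), Obj Y → Obj X → Prop) where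
  [monoid : ∀ X, CommMonoid (C X)]
  pull : ∀ {X Y : Scheme.{u}} (_ : X ⟶ Y), C Y →* C X
  one_iff : ∀ {X} (a : Obj X), mk a = 1 ↔ IsOne a
  mul_iff : ∀ {X} (a b c : Obj X), mk a * mk b = mk c ↔ IsMul a b c
  pull_iff : ∀ {X Y} (f : X ⟶ Y) (a : Obj Y) (b : Obj X), pull f (mk a) = mk b ↔ IsPull f a b
  pull_id : ∀ X : Scheme.{u}, pull (𝟙 X) = MonoidHom.id (C X)
  pull_comp : ∀ {X Y Z : Scheme.{u}} (f : X ⟶ Y) (g : Y ⟶ Z),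
    pull (f ≫ g) = (pull f).comp (pull g)

/-- The contravariant functor from schemes to commutative monoids given by monoid structures on
sets of classes and their pullback maps. -/
def MonoidsOfClasses.functor {Obj C : Scheme.{u} → Type (u + 1)} {mk : ∀ {X}, Obj X → C X}
    {IsOne : ∀ {X}, Obj X → Prop} {IsMul : ∀ {X}, Obj X → Obj X → Obj X → Prop}
    {IsPull : ∀ {X Y} (_ : X ⟶ Y), Obj Y → Obj X → Prop}
    (A : MonoidsOfClasses mk IsOne IsMul IsPull) : Scheme.{u}ᵒᵖ ⥤ CommMonCat.{u + 1} :=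
  letI := A.monoid
  { obj := fun X => CommMonCat.of (C X.unop)
    map := fun f => CommMonCat.ofHom (A.pull f.unop)
    map_id := fun X => by
      ext1
      exact A.pull_id X.unop
    map_comp := fun f g => by
      ext1
      exact A.pull_comp g.unop f.unop }

/-- The monoid structure of `Pic(X)`, functorial in `X`. -/
abbrev PicMonoids : Type (u + 1) :=
  MonoidsOfClasses.{u} (fun {_} => Pic.mk) InvertibleSheaf.IsOne InvertibleSheaf.IsMul
    InvertibleSheaf.IsPull

/-- The monoid structure of `Disc(X)`, functorial in `X`. -/
abbrev DiscMonoids : Type (u + 1) :=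
  MonoidsOfClasses.{u} (fun {_} => Disc.mk) Discriminant.IsOne Discriminant.IsMul
    Discriminant.IsPull

/-- The monoid structure of `Quad(X)`, functorial in `X`. -/
abbrev QuadMonoids : Type (u + 1) :=
  MonoidsOfClasses.{u} (fun {_} => Quad.mk) QuadraticAlgebra.IsOne QuadraticAlgebra.IsMul
    QuadraticAlgebra.IsPull

/-! ### Exact sequences of commutative monoids and of sheaves of commutative monoids -/

/-- The sequence of commutative monoids `A ⟶ B ⟶ C` is exact. -/
def MonExact {A B C : CommMonCat.{u}} (f : A ⟶ B) (g : B ⟶ C) : Prop :=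
  Function.Injective f ∧ Function.Surjective g ∧
    ∀ z w : B, g z = g w ↔ ∃ x y : A, f x * z = f y * w

instance hasColimitsOfShape_commMonCat (J : Type u) [SmallCategory J] [IsFiltered J] :
    HasColimitsOfShape J CommMonCat.{u + 1} where
  has_colimit F :=
    ⟨⟨⟨CommMonCat.FilteredColimits.colimitCocone.{u, u + 1} F,
      CommMonCat.FilteredColimits.colimitCoconeIsColimit.{u, u + 1} F⟩⟩⟩

instance preservesColimitsOfShape_commMonCat (J : Type u) [SmallCategory J] [IsFiltered J] :
    PreservesColimitsOfShape J (forget CommMonCat.{u + 1}) :=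
  haveI : PreservesFilteredColimitsOfSize.{u, u} (forget CommMonCat.{u + 1}) :=
    preservesFilteredColimitsOfSize_shrink.{u, u + 1, u, u + 1} _
  inferInstance

/-- The presheaf `U ↦ G(U)` on `X` defined by a functor `G` on schemes. -/
def presheafOf (G : Scheme.{u}ᵒᵖ ⥤ CommMonCat.{u + 1}) (X : Scheme.{u}) :
    X.Opensᵒᵖ ⥤ CommMonCat.{u + 1} :=
  (X.restrictFunctor ⋙ Over.forget X).op ⋙ G

/-- The sheaf on `X` associated with the presheaf `U ↦ G(U)`. -/
def sheafOf (G : Scheme.{u}ᵒᵖ ⥤ CommMonCat.{u + 1}) (X : Scheme.{u}) :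
    TopCat.Sheaf CommMonCat.{u + 1} X.toTopCat :=
  (presheafToSheaf (Opens.grothendieckTopology X) CommMonCat.{u + 1}).obj (presheafOf G X)

/-- The map of associated sheaves on `X` given by a natural transformation. -/
def sheafMap {G H : Scheme.{u}ᵒᵖ ⥤ CommMonCat.{u + 1}} (α : G ⟶ H) (X : Scheme.{u}) :
    sheafOf G X ⟶ sheafOf H X :=
  (presheafToSheaf (Opens.grothendieckTopology X) CommMonCat.{u + 1}).map
    (Functor.whiskerLeft _ α)

/-- The stalk functor at `x` on presheaves of commutative monoids. -/
def stalkAt {X : Scheme.{u}} (x : X) :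
    (X.Opensᵒᵖ ⥤ CommMonCat.{u + 1}) ⥤ CommMonCat.{u + 1} :=
  (Functor.whiskeringLeft _ _ _).obj (OpenNhds.inclusion (X := X.toTopCat) x).op ⋙ colim

/-- The sequence of sheaves of commutative monoids `A ⟶ B ⟶ C` is exact: it is exact on all
stalks. -/
def SheafExact {X : Scheme.{u}} {A B C : TopCat.Sheaf CommMonCat.{u + 1} X.toTopCat}
    (f : A ⟶ B) (g : B ⟶ C) : Prop :=
  ∀ x : X, MonExact ((stalkAt x).map f.hom) ((stalkAt x).map g.hom)

/-- For `f : X ⟶ Y`, the map of presheaves `G(V) ⟶ G(f⁻¹ V)` on `Y`. -/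
def presheafPull (G : Scheme.{u}ᵒᵖ ⥤ CommMonCat.{u + 1}) {X Y : Scheme.{u}} (f : X ⟶ Y) :
    presheafOf G Y ⟶ (Opens.map f.base).op ⋙ presheafOf G X where
  app V := G.map (f ∣_ V.unop).op
  naturality V W i := by
    dsimp [presheafOf, Scheme.restrictFunctor]
    rw [← G.map_comp, ← G.map_comp, ← op_comp, ← op_comp]
    congr 2
    rw [← cancel_mono V.unop.ι]
    simp

/-- For `f : X ⟶ Y`, the map from the sheaf on `Y` associated with `V ↦ G(V)` to the direct image
of the sheaf on `X` associated with `U ↦ G(U)`. -/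
def sheafPull (G : Scheme.{u}ᵒᵖ ⥤ CommMonCat.{u + 1}) {X Y : Scheme.{u}} (f : X ⟶ Y) :
    sheafOf G Y ⟶ (TopCat.Sheaf.pushforward CommMonCat.{u + 1} f.base).obj (sheafOf G X) :=
  ⟨sheafifyLift (Opens.grothendieckTopology Y)
    (presheafPull G f ≫ Functor.whiskerLeft (Opens.map f.base).op
      (toSheafify (Opens.grothendieckTopology X) (presheafOf G X)))
    ((TopCat.Sheaf.pushforward CommMonCat.{u + 1} f.base).obj (sheafOf G X)).2⟩

/-- The maps of associated sheaves given by `α` are compatible with morphisms of schemes. -/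
def SheafFunctorial {G H : Scheme.{u}ᵒᵖ ⥤ CommMonCat.{u + 1}} (α : G ⟶ H) : Prop :=
  ∀ {X Y : Scheme.{u}} (f : X ⟶ Y),
    sheafMap α Y ≫ sheafPull H f =
      sheafPull G f ≫
        (TopCat.Sheaf.pushforward CommMonCat.{u + 1} f.base).map (sheafMap α X)

/-- A map of sheaves of commutative monoids is surjective. -/
abbrev SheafSurjective {X : Scheme.{u}} {A B : TopCat.Sheaf CommMonCat.{u + 1} X.toTopCat}
    (f : A ⟶ B) : Prop :=
  Sheaf.IsLocallySurjective f

end QuadDisc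

end

/-! Everything is expressed through local generators. An invertible module is a multiplicative
cocycle `v`, and a form on it is a family of values with `d i = v² d j`. Locally a quadratic algebra
has a basis `1, x` with `x² = t x - n`. A change `x = v x' + r` gives `t = v t' + 2 r` and `n = v t'
r + v² n' + r²`, and conversely such data glue (`exists_quadraticAlgebra`). The generator `1 ∧ x` of
the exterior square has transition function `v`, and the discriminant takes the value `t² - 4 n` on
it (`hasDisc_iff`); its square root modulo `4` is `t`.

The product formulas are those satisfied by `w = x ⊗ y + σ(x) ⊗ σ(y)`. Existence of products and
pullbacks, the monoid laws and the homomorphism properties thereby become polynomial identities in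
the local data. In particular `disc` is multiplicative because `(s t)² - 4 (m t² + n s² - 4 n m) =
(t² - 4 n) (s² - 4 m)`.

Exactness of the rows comes from absorbing elements. The algebra `O_X[e]` with `e² = 0` has `t = n =
0`, so its product with `S` has local equations `w² = 0` and transitions `w = v w'`: it remembers
only the exterior square of `S`. The discriminant `(0, O_X)` plays the same role. Surjectivity onto
`Pic` is given by the algebra `O_X ⊕ L` with `L² = 0` and by `(0, L)`. The monoids in the left
column are the kernels of the maps to `Pic`.

Over an affine scheme `disc` is surjective by two lifting steps, which are vanishing of `H¹` for
quasi-coherent sheaves in cocycle form (`exists_lift_of_isAffine`). The square root modulo `2` lifts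
to a linear form `t` on `L`. Then `t² - d` is divisible by `4`, with a quotient defined up to
`4`-torsion, which lifts to a form `n` with `t² - 4 n = d`. The algebra `O_X ⊕ L` with `x² = t(x) x
- n(x, x)` has discriminant `d`.

For the associated sheaves, exactness over every open set passes to the filtered colimits that are
the stalks, and sheafification is bijective on stalks. Surjectivity follows from the affine case
because affine opens form a basis. -/

noncomputable section

namespace QuadDisc

/-! ### Restriction and gluing of sections -/

section

variable {X Y : Scheme.{u}} {M N K : X.Modules} {U V W : X.Opens}

lemma res_add (h : V ≤ U) (s t : Γ(M, U)) : res h (s + t) = res h s + res h t :=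
  map_add (M.presheaf.map (homOfLE h).op).hom s t

lemma res_neg (h : V ≤ U) (s : Γ(M, U)) : res h (-s) = -res h s :=
  map_neg (M.presheaf.map (homOfLE h).op).hom s

lemma res_sub (h : V ≤ U) (s t : Γ(M, U)) : res h (s - t) = res h s - res h t :=
  map_sub (M.presheaf.map (homOfLE h).op).hom s t

lemma res_zero (h : V ≤ U) : res h (0 : Γ(M, U)) = 0 :=
  map_zero (M.presheaf.map (homOfLE h).op).hom

lemma res_sum {ι : Type*} (F : Finset ι) (h : V ≤ U) (s : ι → Γ(M, U)) :
    res h (∑ i ∈ F, s i) = ∑ i ∈ F, res h (s i) :=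
  map_sum (M.presheaf.map (homOfLE h).op).hom s F

lemma res_smul (h : V ≤ U) (a : Γ(X, U)) (s : Γ(M, U)) : res h (a • s) = resO h a • res h s :=
  Scheme.Modules.map_smul M (homOfLE h) a s

@[simp]
lemma res_res (h : V ≤ U) (h' : W ≤ V) (s : Γ(M, U)) : res h' (res h s) = res (h'.trans h) s := by
  simp only [res]
  rw [← ConcreteCategory.comp_apply, ← Functor.map_comp]
  rfl

@[simp]
lemma res_self (h : U ≤ U) (s : Γ(M, U)) : res h s = s := by
  have : (homOfLE h).op = 𝟙 (op U) := rfl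
  simp only [res, this, CategoryTheory.Functor.map_id]
  rfl

/-- Restriction of functions as a ring homomorphism. -/
def resHom (h : V ≤ U) : Γ(X, U) →+* Γ(X, V) := (X.presheaf.map (homOfLE h).op).hom

lemma resHom_apply (h : V ≤ U) (a : Γ(X, U)) : resHom h a = resO h a := rfl

lemma resO_add (h : V ≤ U) (a b : Γ(X, U)) : resO h (a + b) = resO h a + resO h b :=
  map_add (resHom h) a b
lemma resO_sub (h : V ≤ U) (a b : Γ(X, U)) : resO h (a - b) = resO h a - resO h b :=
  map_sub (resHom h) a b
lemma resO_neg (h : V ≤ U) (a : Γ(X, U)) : resO h (-a) = -resO h a :=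
  map_neg (resHom h) a
lemma resO_mul (h : V ≤ U) (a b : Γ(X, U)) : resO h (a * b) = resO h a * resO h b :=
  map_mul (resHom h) a b
lemma resO_pow (h : V ≤ U) (a : Γ(X, U)) (n : ℕ) : resO h (a ^ n) = resO h a ^ n :=
  map_pow (resHom h) a n
@[simp]
lemma resO_one (h : V ≤ U) : resO h (1 : Γ(X, U)) = 1 := map_one (resHom h)
@[simp]
lemma resO_zero (h : V ≤ U) : resO h (0 : Γ(X, U)) = 0 := map_zero (resHom h)
@[simp]
lemma resO_natCast (h : V ≤ U) (n : ℕ) : resO h (n : Γ(X, U)) = n := map_natCast (resHom h) n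
@[simp]
lemma resO_ofNat (h : V ≤ U) (n : ℕ) [n.AtLeastTwo] : resO h (ofNat(n) : Γ(X, U)) = ofNat(n) :=
  map_ofNat (resHom h) n
lemma resO_sum {ι : Type*} (F : Finset ι) (h : V ≤ U) (s : ι → Γ(X, U)) :
    resO h (∑ i ∈ F, s i) = ∑ i ∈ F, resO h (s i) :=
  map_sum (resHom h) s F

@[simp]
lemma resO_resO (h : V ≤ U) (h' : W ≤ V) (s : Γ(X, U)) :
    resO h' (resO h s) = resO (h'.trans h) s := by
  simp only [resO]
  rw [← ConcreteCategory.comp_apply, ← Functor.map_comp]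
  rfl

@[simp]
lemma resO_self (h : U ≤ U) (s : Γ(X, U)) : resO h s = s := by
  have : (homOfLE h).op = 𝟙 (op U) := rfl
  simp only [resO, this, CategoryTheory.Functor.map_id]
  rfl

lemma Hom.app_res (φ : M ⟶ N) (h : V ≤ U) (s : Γ(M, U)) :
    φ.app V (res h s) = res h (φ.app U s) :=
  ConcreteCategory.congr_hom (φ.mapPresheaf.naturality (homOfLE h).op) s

/-- Two sections that agree locally are equal. -/
lemma section_ext {s t : Γ(M, U)}
    (H : ∀ x ∈ U, ∃ (V : X.Opens) (h : V ≤ U), x ∈ V ∧ res h s = res h t) : s = t := by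
  choose V hV hx h using fun x : U => H x.1 x.2
  exact TopCat.Sheaf.eq_of_locally_eq' ⟨M.presheaf, M.isSheaf⟩ V U (fun x => homOfLE (hV x))
    (fun x hx' => Opens.mem_iSup.mpr ⟨⟨x, hx'⟩, hx _⟩) s t h

lemma sectionO_ext {s t : Γ(X, U)}
    (H : ∀ x ∈ U, ∃ (V : X.Opens) (h : V ≤ U), x ∈ V ∧ resO h s = resO h t) : s = t := by
  choose V hV hx h using fun x : U => H x.1 x.2
  exact TopCat.Sheaf.eq_of_locally_eq' X.sheaf V U (fun x => homOfLE (hV x))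
    (fun x hx' => Opens.mem_iSup.mpr ⟨⟨x, hx'⟩, hx _⟩) s t h

/-- Gluing of sections that are characterized by a relation with locally a unique solution. -/
lemma exists_section (R : ∀ V : X.Opens, V ≤ U → Γ(M, V) → Prop)
    (hex : ∀ x ∈ U, ∃ (V : X.Opens) (h : V ≤ U) (s : Γ(M, V)), x ∈ V ∧ R V h s)
    (hres : ∀ (V W : X.Opens) (h : V ≤ U) (h' : W ≤ V) (s : Γ(M, V)),
      R V h s → R W (h'.trans h) (res h' s))
    (huniq : ∀ (V : X.Opens) (h : V ≤ U) (s t : Γ(M, V)), R V h s → R V h t → s = t) :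
    ∃ s : Γ(M, U), ∀ (V : X.Opens) (h : V ≤ U) (t : Γ(M, V)), R V h t → res h s = t := by
  choose V hV s hx hR using fun x : U => hex x.1 x.2
  obtain ⟨g, hg, -⟩ := TopCat.Sheaf.existsUnique_gluing' ⟨M.presheaf, M.isSheaf⟩ V U
    (fun x => homOfLE (hV x)) (fun x hx' => Opens.mem_iSup.mpr ⟨⟨x, hx'⟩, hx _⟩) s
    -- Both restrictions solve the relation over the overlap, so uniqueness makes the chosen local
    -- solutions compatible.
    (fun i j => huniq (V i ⊓ V j) (inf_le_left.trans (hV i)) _ _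
      (hres _ _ _ inf_le_left _ (hR i)) (hres _ _ _ inf_le_right _ (hR j)))
  refine ⟨g, fun W h t ht => section_ext fun x hxW => ?_⟩
  have hgx : res (hV ⟨x, h hxW⟩) g = s ⟨x, h hxW⟩ := hg ⟨x, h hxW⟩
  refine ⟨W ⊓ V ⟨x, h hxW⟩, inf_le_left, ⟨hxW, hx _⟩, ?_⟩
  refine huniq _ (inf_le_left.trans h) _ _ ?_ (hres _ _ _ inf_le_left _ ht)
  rw [res_res, ← res_res (hV ⟨x, h hxW⟩) inf_le_right g, hgx]
  exact hres _ _ _ inf_le_right _ (hR _)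

/-- Sections of `structureModule X` are by definition functions, so the gluing statement for modules
applies verbatim. -/
lemma existsO_section (R : ∀ V : X.Opens, V ≤ U → Γ(X, V) → Prop)
    (hex : ∀ x ∈ U, ∃ (V : X.Opens) (h : V ≤ U) (s : Γ(X, V)), x ∈ V ∧ R V h s)
    (hres : ∀ (V W : X.Opens) (h : V ≤ U) (h' : W ≤ V) (s : Γ(X, V)),
      R V h s → R W (h'.trans h) (resO h' s))
    (huniq : ∀ (V : X.Opens) (h : V ≤ U) (s t : Γ(X, V)), R V h s → R V h t → s = t) :
    ∃ s : Γ(X, U), ∀ (V : X.Opens) (h : V ≤ U) (t : Γ(X, V)), R V h t → resO h s = t :=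
  exists_section (M := structureModule X) R hex hres huniq

end

/-! ### Local bases, and pairings prescribed on them -/

section

variable {X Y : Scheme.{u}} {M N K : X.Modules} {U V W : X.Opens} {m n : ℕ}

namespace IsBasisOn

variable {b : Fin n → Γ(M, U)}

lemma restrict (hb : IsBasisOn U b) (h : V ≤ U) : IsBasisOn V fun i => res h (b i) := by
  intro W hW s
  simpa using hb W (hW.trans h) s

lemma exists_coords (hb : IsBasisOn U b) (h : V ≤ U) (s : Γ(M, V)) :
    ∃ c : Fin n → Γ(X, V), s = ∑ i, c i • res h (b i) :=
  (hb V h s).exists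

lemma coords_ext (hb : IsBasisOn U b) (h : V ≤ U) {c d : Fin n → Γ(X, V)}
    (H : ∑ i, c i • res h (b i) = ∑ i, d i • res h (b i)) : c = d :=
  (hb V h _).unique rfl H

/-- The basis of the module of sections over a smaller open set. -/
def basis (hb : IsBasisOn U b) (h : V ≤ U) : Module.Basis (Fin n) Γ(X, V) Γ(M, V) :=
  Module.Basis.mk (v := fun i => res h (b i))
    (by
      rw [Fintype.linearIndependent_iff]
      intro c hc i
      exact congrFun (hb.coords_ext h (c := c) (d := 0) (by simpa using hc)) i)
    (by
      intro s _
      obtain ⟨c, rfl⟩ := hb.exists_coords h s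
      exact Submodule.sum_mem _ fun i _ =>
        Submodule.smul_mem _ _ (Submodule.subset_span ⟨i, rfl⟩))

@[simp]
lemma basis_apply (hb : IsBasisOn U b) (h : V ≤ U) (i : Fin n) : hb.basis h i = res h (b i) := by
  simp [basis]

end IsBasisOn

lemma bilin_sum_sum {R A B C : Type*} [CommRing R] [AddCommGroup A] [AddCommGroup B]
    [AddCommGroup C] [Module R A] [Module R B] [Module R C] (f : A →ₗ[R] B →ₗ[R] C)
    (p : Fin m → R) (q : Fin n → R) (x : Fin m → A) (y : Fin n → B) :
    f (∑ a, p a • x a) (∑ a, q a • y a) = ∑ a, ∑ a', p a • q a' • f (x a) (y a') := by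
  rw [map_sum f, LinearMap.sum_apply]
  refine Finset.sum_congr rfl fun a _ => ?_
  rw [map_smul, LinearMap.smul_apply, map_sum, Finset.smul_sum]
  exact Finset.sum_congr rfl fun a' _ => by rw [map_smul]

section Pairings

variable {ι : Type*} {D : ι → X.Opens} {b : ∀ i, Fin m → Γ(M, D i)} {c : ∀ i, Fin n → Γ(N, D i)}

lemma Pairing.app_sum_sum (β : Pairing M N K) (p : Fin m → Γ(X, U)) (q : Fin n → Γ(X, U))
    (x : Fin m → Γ(M, U)) (y : Fin n → Γ(N, U)) :
    β.app U (∑ a, p a • x a) (∑ a, q a • y a) =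
      ∑ a, ∑ a', p a • q a' • β.app U (x a) (y a') :=
  bilin_sum_sum _ _ _ _ _

/-- Pairings that agree on local bases are equal. -/
lemma Pairing.ext_of_frames {β γ : Pairing M N K} (hD : ∀ x, ∃ i, x ∈ D i)
    (hb : ∀ i, IsBasisOn (D i) (b i)) (hc : ∀ i, IsBasisOn (D i) (c i))
    (H : ∀ i a a', β.app _ (b i a) (c i a') = γ.app _ (b i a) (c i a'))
    (U : X.Opens) (x : Γ(M, U)) (y : Γ(N, U)) : β.app U x y = γ.app U x y := by
  refine section_ext fun z hz => ?_
  obtain ⟨i, hi⟩ := hD z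
  refine ⟨U ⊓ D i, inf_le_left, ⟨hz, hi⟩, ?_⟩
  obtain ⟨p, hp⟩ := (hb i).exists_coords (inf_le_right : U ⊓ D i ≤ D i) (res inf_le_left x)
  obtain ⟨q, hq⟩ := (hc i).exists_coords (inf_le_right : U ⊓ D i ≤ D i) (res inf_le_left y)
  rw [β.map_res, γ.map_res, hp, hq, β.app_sum_sum, γ.app_sum_sum]
  simp only [← β.map_res, ← γ.map_res, H]

/-- A pairing of sheaves is determined by compatible prescribed values on local bases. -/
theorem exists_pairing (hD : ∀ x, ∃ i, x ∈ D i)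
    (hb : ∀ i, IsBasisOn (D i) (b i)) (hc : ∀ i, IsBasisOn (D i) (c i))
    (k : ∀ i, Fin m → Fin n → Γ(K, D i))
    (hk : ∀ i j, ∃ (A : Fin m → Fin m → Γ(X, D i ⊓ D j)) (B : Fin n → Fin n → Γ(X, D i ⊓ D j)),
      (∀ a, res inf_le_left (b i a) = ∑ e, A a e • res inf_le_right (b j e)) ∧
      (∀ a, res inf_le_left (c i a) = ∑ e, B a e • res inf_le_right (c j e)) ∧
      ∀ a a', res inf_le_left (k i a a') =
        ∑ e, ∑ e', A a e • B a' e' • res inf_le_right (k j e e')) :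
    ∃ β : Pairing M N K, ∀ i a a', β.app (D i) (b i a) (c i a') = k i a a' := by
  -- Over an open set inside a single `D i` the pairing is forced: it is the bilinear map with the
  -- prescribed values on the basis.
  let κ (i : ι) (W : X.Opens) (h : W ≤ D i) : Γ(M, W) →ₗ[Γ(X, W)] Γ(N, W) →ₗ[Γ(X, W)] Γ(K, W) :=
    ((hb i).basis h).constr Γ(X, W) fun a =>
      ((hc i).basis h).constr Γ(X, W) fun a' => res h (k i a a')
  have κ_basis : ∀ i W (h : W ≤ D i) a a',
      κ i W h (res h (b i a)) (res h (c i a')) = res h (k i a a') := by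
    intro i W h a a'
    simp only [κ]
    rw [← (hb i).basis_apply h, ← (hc i).basis_apply h, Module.Basis.constr_basis,
      Module.Basis.constr_basis]
  have κ_sum : ∀ i W (h : W ≤ D i) (p : Fin m → Γ(X, W)) (q : Fin n → Γ(X, W)),
      κ i W h (∑ a, p a • res h (b i a)) (∑ a, q a • res h (c i a)) =
        ∑ a, ∑ a', p a • q a' • res h (k i a a') := by
    intro i W h p q
    simp only [bilin_sum_sum, κ_basis]
  have κ_res : ∀ i W W' (h : W ≤ D i) (h' : W' ≤ W) x y,
      res h' (κ i W h x y) = κ i W' (h'.trans h) (res h' x) (res h' y) := by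
    intro i W W' h h' x y
    obtain ⟨p, rfl⟩ := (hb i).exists_coords h x
    obtain ⟨q, rfl⟩ := (hc i).exists_coords h y
    simp only [κ_sum, res_sum, res_smul, res_res]
  -- The compatibility `hk` enters here: the local bilinear map does not depend on the frame used to
  -- define it.
  have κ_eq : ∀ i j W (hi : W ≤ D i) (hj : W ≤ D j), κ i W hi = κ j W hj := by
    intro i j W hi hj
    refine ((hb i).basis hi).ext fun a => ((hc i).basis hi).ext fun a' => ?_
    obtain ⟨A, B, hA, hB, hAB⟩ := hk i j
    rw [IsBasisOn.basis_apply, IsBasisOn.basis_apply, κ_basis]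
    have h1 : res hi (b i a) = ∑ e, resO (le_inf hi hj) (A a e) • res hj (b j e) := by
      simpa [res_sum, res_smul] using congrArg (res (le_inf hi hj)) (hA a)
    have h2 : res hi (c i a') = ∑ e, resO (le_inf hi hj) (B a' e) • res hj (c j e) := by
      simpa [res_sum, res_smul] using congrArg (res (le_inf hi hj)) (hB a')
    rw [h1, h2, κ_sum]
    simpa [res_sum, res_smul] using congrArg (res (le_inf hi hj)) (hAB a a')
  -- The value at `(x, y)` over a general open set is glued from the values of `κ`, which are unique
  -- by `κ_eq`.
  have ex : ∀ U (x : Γ(M, U)) (y : Γ(N, U)), ∃ s : Γ(K, U), ∀ i W (hU : W ≤ U) (hi : W ≤ D i),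
      res hU s = κ i W hi (res hU x) (res hU y) := by
    intro U x y
    refine Exists.imp (fun s hs i W hU hi => hs W hU _ ⟨i, hi, rfl⟩)
      (exists_section (M := K) (U := U)
        (fun W hU t => ∃ i hi, t = κ i W hi (res hU x) (res hU y)) ?_ ?_ ?_)
    · intro z hz
      obtain ⟨i, hi⟩ := hD z
      exact ⟨U ⊓ D i, inf_le_left, _, ⟨hz, hi⟩, i, inf_le_right, rfl⟩
    · rintro W W' h h' _ ⟨i, hi, rfl⟩
      exact ⟨i, h'.trans hi, by rw [κ_res, res_res, res_res]⟩
    · rintro W h _ _ ⟨i, hi, rfl⟩ ⟨j, hj, rfl⟩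
      rw [κ_eq]
  choose β hβ using ex
  -- Bilinearity, naturality and the prescribed values can all be tested on open sets contained in
  -- some `D i`, where the glued map is `κ`.
  have loc : ∀ {U : X.Opens} {s t : Γ(K, U)},
      (∀ i W (hU : W ≤ U) (_ : W ≤ D i), res hU s = res hU t) → s = t := by
    intro U s t h
    refine section_ext fun z hz => ?_
    obtain ⟨i, hi⟩ := hD z
    exact ⟨U ⊓ D i, inf_le_left, ⟨hz, hi⟩, h i _ _ inf_le_right⟩
  refine ⟨⟨fun U => LinearMap.mk₂ _ (β U) ?_ ?_ ?_ ?_, ?_⟩, ?_⟩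
  · intro x x' y
    exact loc fun i W hU hi => by
      simp only [res_add, hβ _ _ _ i W hU hi, map_add, LinearMap.add_apply]
  · intro r x y
    exact loc fun i W hU hi => by
      simp only [res_smul, hβ _ _ _ i W hU hi, map_smul, LinearMap.smul_apply]
  · intro x y y'
    exact loc fun i W hU hi => by
      simp only [res_add, hβ _ _ _ i W hU hi, map_add]
  · intro r x y
    exact loc fun i W hU hi => by
      simp only [res_smul, hβ _ _ _ i W hU hi, map_smul]
  · intro U V h x y
    refine loc fun i W hV hi => ?_
    rw [LinearMap.mk₂_apply, LinearMap.mk₂_apply, res_res, hβ _ _ _ i W _ hi, hβ _ _ _ i W _ hi,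
      res_res, res_res]
  · intro i a a'
    refine loc fun j W hU hj => ?_
    rw [LinearMap.mk₂_apply, hβ _ _ _ i W hU hU, κ_basis]

end Pairings

end

/-! ### Locally free sheaves glued from cocycles -/

section

variable {X Y : Scheme.{u}} {M N K : X.Modules} {U V W : X.Opens} {m n : ℕ}

/-- Transition matrices for a locally free sheaf of rank `n`. -/
structure Cocycle (X : Scheme.{u}) (n : ℕ) where
  ι : Type u
  D : ι → X.Opens
  cover : ∀ x, ∃ i, x ∈ D i
  g : ∀ i j, Fin n → Fin n → Γ(X, D i ⊓ D j)
  g_self : ∀ i a b, g i i a b = if a = b then 1 else 0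
  g_mul : ∀ i j k a b, ∑ e,
    resO (inf_le_left : D i ⊓ D j ⊓ D k ≤ D i ⊓ D j) (g i j a e) *
      resO (inf_le_inf_right _ inf_le_right : D i ⊓ D j ⊓ D k ≤ D j ⊓ D k) (g j k e b) =
    resO (inf_le_inf_right _ inf_le_left : D i ⊓ D j ⊓ D k ≤ D i ⊓ D k) (g i k a b)

namespace Cocycle

variable (c : Cocycle X n)

/-- Stated over any open set inside the three pairwise intersections, so that different bracketings
of triple intersections never have to be compared. -/
lemma g_mul' {i j k : c.ι} {W : X.Opens} (hij : W ≤ c.D i ⊓ c.D j) (hjk : W ≤ c.D j ⊓ c.D k)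
    (hik : W ≤ c.D i ⊓ c.D k) (a b : Fin n) :
    ∑ e, resO hij (c.g i j a e) * resO hjk (c.g j k e b) = resO hik (c.g i k a b) := by
  simpa [resO_sum, resO_mul] using
    congrArg (resO (le_inf hij (hik.trans inf_le_right))) (c.g_mul i j k a b)

/-- The sections over `V` of the sheaf defined by a cocycle. -/
def sec (V : X.Opens) : AddSubgroup (∀ i, Fin n → Γ(X, V ⊓ c.D i)) where
  -- `m i` is the row of coordinates of a section in the frame `i`. Frames change by `e i = g i j *
  -- e j`, hence coordinates by `m j = m i * g i j`.
  carrier := {m | ∀ i j a,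
    resO (inf_le_inf_left V inf_le_right : V ⊓ (c.D i ⊓ c.D j) ≤ V ⊓ c.D j) (m j a) =
      ∑ e, resO (inf_le_inf_left V inf_le_left : V ⊓ (c.D i ⊓ c.D j) ≤ V ⊓ c.D i) (m i e) *
        resO inf_le_right (c.g i j e a)}
  zero_mem' i j a := by simp
  add_mem' {m m'} hm hm' i j a := by
    simp only [Pi.add_apply, resO_add, add_mul, Finset.sum_add_distrib]
    rw [hm i j a, hm' i j a]
  neg_mem' {m} hm i j a := by
    simp only [Pi.neg_apply, resO_neg, neg_mul, Finset.sum_neg_distrib]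
    rw [hm i j a]

lemma sec_compat {V W : X.Opens} (m : c.sec V) (i j : c.ι) (hi : W ≤ V ⊓ c.D i)
    (hj : W ≤ V ⊓ c.D j) (hij : W ≤ c.D i ⊓ c.D j) (a : Fin n) :
    resO hj (m.1 j a) = ∑ e, resO hi (m.1 i e) * resO hij (c.g i j e a) := by
  simpa [resO_sum, resO_mul] using
    congrArg (resO (le_inf (hi.trans inf_le_left) hij)) (m.2 i j a)

instance (V : X.Opens) : SMul Γ(X, V) (c.sec V) where
  smul r m := ⟨fun i a => resO inf_le_left r * m.1 i a, fun i j a => by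
    simp only [resO_mul, resO_resO, m.2 i j a, Finset.mul_sum, mul_assoc]⟩

lemma smul_val {V : X.Opens} (r : Γ(X, V)) (m : c.sec V) (i : c.ι) (a : Fin n) :
    (r • m).1 i a = resO inf_le_left r * m.1 i a := rfl

@[ext]
lemma sec_ext {V : X.Opens} {m m' : c.sec V} (h : ∀ i a, m.1 i a = m'.1 i a) : m = m' :=
  Subtype.ext (funext fun i => funext fun a => h i a)

instance (V : X.Opens) : Module Γ(X, V) (c.sec V) where
  one_smul m := by ext i a; simp [smul_val]
  mul_smul r s m := by ext i a; simp [smul_val, resO_mul, mul_assoc]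
  smul_zero r := by ext i a; simp [smul_val]
  smul_add r m m' := by ext i a; simp [smul_val, mul_add]
  add_smul r s m := by ext i a; simp [smul_val, resO_add, add_mul]
  zero_smul m := by ext i a; simp [smul_val]

/-- Restriction of sections. -/
def secRes {V V' : X.Opens} (h : V' ≤ V) : c.sec V →+ c.sec V' where
  toFun m := ⟨fun i a => resO (inf_le_inf_right _ h) (m.1 i a), fun i j a => by
    simp only [resO_resO]
    exact c.sec_compat m i j _ _ _ a⟩
  map_zero' := by ext i a; simp
  map_add' m m' := by ext i a; simp [resO_add]

lemma secRes_val {V V' : X.Opens} (h : V' ≤ V) (m : c.sec V) (i : c.ι) (a : Fin n) :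
    (c.secRes h m).1 i a = resO (inf_le_inf_right _ h) (m.1 i a) := rfl

lemma secRes_secRes {V V' V'' : X.Opens} (h : V' ≤ V) (h' : V'' ≤ V') (m : c.sec V) :
    c.secRes h' (c.secRes h m) = c.secRes (h'.trans h) m := by
  ext i a
  simp [secRes_val]

/-- The presheaf of abelian groups defined by a cocycle. -/
def presheaf : X.Opensᵒᵖ ⥤ Ab.{u} where
  obj V := AddCommGrpCat.of (c.sec V.unop)
  map f := AddCommGrpCat.ofHom (c.secRes (leOfHom f.unop))
  map_id V := by
    ext m : 2
    exact c.sec_ext fun i a => resO_self _ _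
  map_comp f g := by
    ext m : 2
    exact c.sec_ext fun i a => (resO_resO _ _ _).symm

/-- Each coordinate is a section of the sheaf `O_X` over `V ⊓ D i`, so coordinates glue one by one;
the transition relations between them are local and survive gluing. -/
lemma isSheaf_presheaf : TopCat.Presheaf.IsSheaf c.presheaf := by
  rw [TopCat.Presheaf.isSheaf_iff_isSheafUniqueGluing]
  intro κ V s hs
  have hs' : ∀ k l W (hk : W ≤ V k) (hl : W ≤ V l), c.secRes hk (s k) = c.secRes hl (s l) := by
    intro k l W hk hl
    have : c.secRes (le_inf hk hl) (c.secRes inf_le_left (s k)) =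
        c.secRes (le_inf hk hl) (c.secRes inf_le_right (s l)) :=
      congrArg (c.secRes (le_inf hk hl)) (hs k l)
    exact (c.secRes_secRes _ _ _).symm.trans (this.trans (c.secRes_secRes _ _ _))
  have hval : ∀ k l W i a (hk : W ≤ V k ⊓ c.D i) (hl : W ≤ V l ⊓ c.D i),
      resO hk ((s k).1 i a) = resO hl ((s l).1 i a) := by
    intro k l W i a hk hl
    have := congrArg (fun m : c.sec W => resO (le_inf le_rfl (hk.trans inf_le_right)) (m.1 i a))
      (hs' k l W (hk.trans inf_le_left) (hl.trans inf_le_left))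
    change resO _ (resO _ _) = resO _ (resO _ _) at this
    rwa [resO_resO, resO_resO] at this
  have ex : ∀ i a, ∃ t : Γ(X, iSup V ⊓ c.D i), ∀ k W (h : W ≤ iSup V ⊓ c.D i)
      (hk : W ≤ V k ⊓ c.D i), resO h t = resO hk ((s k).1 i a) := by
    intro i a
    refine Exists.imp (fun t ht k W h hk => ht W h _ ⟨k, hk, rfl⟩)
      (existsO_section (U := iSup V ⊓ c.D i)
        (fun W h t => ∃ k hk, t = resO hk ((s k).1 i a)) ?_ ?_ ?_)
    · rintro x ⟨hx, hxi⟩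
      obtain ⟨k, hk⟩ := Opens.mem_iSup.mp hx
      exact ⟨V k ⊓ c.D i, inf_le_inf_right _ (le_iSup V k), _, ⟨hk, hxi⟩, k, le_rfl, rfl⟩
    · rintro W W' h h' _ ⟨k, hk, rfl⟩
      exact ⟨k, h'.trans hk, by simp⟩
    · rintro W h _ _ ⟨k, hk, rfl⟩ ⟨l, hl, rfl⟩
      exact hval k l W i a hk hl
  choose t ht using ex
  have htmem : t ∈ c.sec (iSup V) := by
    intro i j a
    refine sectionO_ext fun x hx => ?_
    obtain ⟨k, hk⟩ := Opens.mem_iSup.mp hx.1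
    refine ⟨V k ⊓ (c.D i ⊓ c.D j), inf_le_inf_right _ (le_iSup V k), ⟨hk, hx.2⟩, ?_⟩
    simp only [resO_sum, resO_mul, resO_resO]
    rw [ht j a k _ _ (inf_le_inf_left _ inf_le_right)]
    simp only [ht i _ k _ _ (inf_le_inf_left _ inf_le_left)]
    exact c.sec_compat (s k) i j _ _ _ a
  refine ⟨(⟨t, htmem⟩ : c.sec (iSup V)), fun k => ?_, fun m hm => ?_⟩
  · refine c.sec_ext fun i a => ?_
    exact (ht i a k (V k ⊓ c.D i) (inf_le_inf_right _ (le_iSup V k)) le_rfl).trans (resO_self _ _)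
  · refine c.sec_ext fun i a => sectionO_ext fun x hx => ?_
    obtain ⟨k, hk⟩ := Opens.mem_iSup.mp hx.1
    refine ⟨V k ⊓ c.D i, inf_le_inf_right _ (le_iSup V k), ⟨hk, hx.2⟩, ?_⟩
    refine Eq.trans ?_ (ht i a k _ _ le_rfl).symm
    rw [resO_self]
    exact congrArg (fun m : c.sec (V k) => m.1 i a) (hm k)

/-- The sheaf of modules defined by a cocycle. -/
def modules : X.Modules where
  val :=
    letI : ∀ V : X.Opensᵒᵖ, Module (X.ringCatSheaf.obj.obj V) (c.presheaf.obj V) :=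
      fun V => inferInstanceAs (Module Γ(X, V.unop) (c.sec V.unop))
    PresheafOfModules.ofPresheaf (R := X.ringCatSheaf.obj) c.presheaf (fun V W f r m =>
      c.sec_ext fun i a => by
        refine (resO_mul _ _ _).trans ?_
        refine congrArg (· * _) ?_
        exact (resO_resO _ _ _).trans (resO_resO (leOfHom f.unop) _ r).symm)
  isSheaf := c.isSheaf_presheaf

/-- The local basis of the sheaf defined by a cocycle. -/
def frame (i : c.ι) (a : Fin n) : Γ(c.modules, c.D i) :=
  -- The vector `a` of the frame `i` has, in the frame `j`, the row `a` of `g i j` as coordinates;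
  -- the cocycle identity makes this a section.
  (⟨fun j e => c.g i j a e, fun _ _ e => (c.g_mul' _ _ _ a e).symm⟩ : c.sec (c.D i))

lemma sum_smul_frame_val {W : X.Opens} (i : c.ι) (h : W ≤ c.D i) (r : Fin n → Γ(X, W)) (j : c.ι)
    (e : Fin n) :
    (show c.sec W from ∑ a, r a • res h (c.frame i a)).1 j e =
      ∑ a, resO inf_le_left (r a) * resO (inf_le_inf_right _ h) (c.g i j a e) := by
  let f : c.sec W →+ Γ(X, W ⊓ c.D j) :=
    { toFun := fun m => m.1 j e, map_zero' := rfl, map_add' := fun _ _ => rfl }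
  exact map_sum f (fun a => (r a • res h (c.frame i a) : Γ(c.modules, W))) Finset.univ

/-- The coefficients of a section in the frame `i` are its own coordinates at the index `i`. The
transition relation recovers all other coordinates from these, and `g i i = 1` gives uniqueness. -/
lemma isBasisOn_frame (i : c.ι) : IsBasisOn (c.D i) (c.frame i) := by
  intro V h s
  refine ⟨fun a => resO (le_inf le_rfl h) ((show c.sec V from s).1 i a), ?_, fun r hr => ?_⟩
  · refine c.sec_ext fun j e => ?_
    refine Eq.trans ?_ (c.sum_smul_frame_val i h _ j e).symm
    simp only [resO_resO]
    refine Eq.trans ?_ (c.sec_compat (W := V ⊓ c.D j) (show c.sec V from s) i j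
      (inf_le_left.trans (le_inf le_rfl h)) le_rfl (inf_le_inf_right _ h) e)
    rw [resO_self]
  · funext e
    have hr' : s = ∑ a, r a • res h (c.frame i a) := hr
    subst hr'
    refine Eq.trans ?_ (congrArg (resO _) (c.sum_smul_frame_val i h r i e)).symm
    rw [resO_sum]
    simp [c.g_self, apply_ite]

lemma frame_eq (i j : c.ι) (a : Fin n) :
    res inf_le_left (c.frame i a) = ∑ e, c.g i j a e • res inf_le_right (c.frame j e) := by
  refine c.sec_ext fun k f => ?_
  refine Eq.trans ?_ (c.sum_smul_frame_val j inf_le_right _ k f).symm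
  exact (c.g_mul' _ _ _ _ _).symm

end Cocycle

end

/-! ### Morphisms from local data; tensor products and exterior squares -/

section

variable {X Y : Scheme.{u}} {M N K L : X.Modules} {U V W : X.Opens} {m n : ℕ}

/-- A morphism of sheaves of modules from compatible linear maps on sections. -/
def homMk (f : ∀ U : X.Opens, Γ(M, U) →ₗ[Γ(X, U)] Γ(N, U))
    (hf : ∀ (U V : X.Opens) (h : V ≤ U) (s : Γ(M, U)), f V (res h s) = res h (f U s)) : M ⟶ N :=
  ⟨PresheafOfModules.homMk (M₁ := M.val) (M₂ := N.val)
    { app := fun U => AddCommGrpCat.ofHom (f U.unop).toAddMonoidHom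
      naturality := fun U V g => by
        ext s
        exact hf U.unop V.unop (leOfHom g.unop) s }
    fun U r s => (f U.unop).map_smul r s⟩

lemma Iso.hom_inv_app (e : M ≅ N) (s : Γ(M, U)) : e.inv.app U (e.hom.app U s) = s := by
  rw [← ConcreteCategory.comp_apply, ← Scheme.Modules.Hom.comp_app, e.hom_inv_id]
  rfl

lemma Iso.inv_hom_app (e : M ≅ N) (s : Γ(N, U)) : e.hom.app U (e.inv.app U s) = s :=
  Iso.hom_inv_app e.symm s

lemma IsBasisOn.map_iso {b : Fin n → Γ(M, U)} (hb : IsBasisOn U b) (e : M ≅ N) :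
    IsBasisOn U fun i => e.hom.app U (b i) := by
  intro V h s
  have key : ∀ c : Fin n → Γ(X, V), (s = ∑ i, c i • res h (e.hom.app U (b i))) ↔
      e.inv.app V s = ∑ i, c i • res h (b i) := by
    intro c
    have : ∑ i, c i • res h (e.hom.app U (b i)) = e.hom.app V (∑ i, c i • res h (b i)) := by
      simp [Hom.app_res]
    rw [this]
    exact ⟨fun hs => by rw [hs, Iso.hom_inv_app], fun hs => by rw [← hs, Iso.inv_hom_app]⟩
  simpa only [key] using hb V h (e.inv.app V s)

section One

variable {e : Γ(M, U)}

lemma IsBasisOn.coord_one (he : IsBasisOn U ![e]) (h : V ≤ U) (s : Γ(M, V)) :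
    ∃ c : Γ(X, V), s = c • res h e := by
  obtain ⟨c, hc⟩ := he.exists_coords h s
  exact ⟨c 0, by simpa using hc⟩

lemma IsBasisOn.cancel_one (he : IsBasisOn U ![e]) (h : V ≤ U) {c d : Γ(X, V)}
    (H : c • res h e = d • res h e) : c = d :=
  congrFun (he.coords_ext h (c := fun _ => c) (d := fun _ => d) (by simpa using H)) 0

lemma isBasisOn_one_of (hex : ∀ (V : X.Opens) (h : V ≤ U) (s : Γ(M, V)),
      ∃ c : Γ(X, V), s = c • res h e)
    (hinj : ∀ (V : X.Opens) (h : V ≤ U) (c d : Γ(X, V)), c • res h e = d • res h e → c = d) :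
    IsBasisOn U ![e] := by
  intro V h s
  obtain ⟨c, hc⟩ := hex V h s
  refine ⟨fun _ => c, by simpa using hc, fun d hd => funext fun i => ?_⟩
  obtain rfl := Subsingleton.elim i 0
  refine hinj V h _ _ ?_
  rw [← hc, hd]
  simp

lemma IsBasisOn.restrict_one (he : IsBasisOn U ![e]) (h : V ≤ U) : IsBasisOn V ![res h e] := by
  have := he.restrict h
  convert this using 1
  ext i
  fin_cases i
  rfl

lemma IsBasisOn.map_iso_one (he : IsBasisOn U ![e]) (φ : M ≅ N) :
    IsBasisOn U ![φ.hom.app U e] := by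
  have := he.map_iso φ
  convert this using 1
  ext i
  fin_cases i
  rfl

/-- The section `1` of the structure sheaf. -/
def unitSection (U : X.Opens) : Γ(structureModule X, U) := (1 : Γ(X, U))

lemma res_unitSection (h : V ≤ U) : res h (unitSection U) = unitSection V := resO_one h

lemma isBasisOn_structureModule : IsBasisOn U ![unitSection U] := by
  refine isBasisOn_one_of (M := structureModule X) (fun V h s => ⟨s, ?_⟩) fun V h c d H => ?_
  · change s = (show Γ(X, V) from s) * resO h (1 : Γ(X, U))
    rw [resO_one, mul_one]
  · change c * resO h (1 : Γ(X, U)) = d * resO h (1 : Γ(X, U)) at H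
    simpa using H

lemma exists_transition_one {U V : X.Opens} {e : Γ(M, U)} (f : Γ(M, V)) (he : IsBasisOn U ![e]) :
    ∃ v : Γ(X, V ⊓ U), res inf_le_left f = v • res inf_le_right e :=
  he.coord_one _ _

end One

section Homs

variable {ι : Type*} {D : ι → X.Opens} {b : ∀ i, Fin n → Γ(M, D i)}

lemma hom_ext_of_frames {φ ψ : M ⟶ N} (hD : ∀ x, ∃ i, x ∈ D i)
    (hb : ∀ i, IsBasisOn (D i) (b i)) (H : ∀ i a, φ.app _ (b i a) = ψ.app _ (b i a)) : φ = ψ := by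
  ext U s
  refine section_ext fun z hz => ?_
  obtain ⟨i, hi⟩ := hD z
  refine ⟨U ⊓ D i, inf_le_left, ⟨hz, hi⟩, ?_⟩
  obtain ⟨p, hp⟩ := (hb i).exists_coords (inf_le_right : U ⊓ D i ≤ D i) (res inf_le_left s)
  rw [← Hom.app_res, ← Hom.app_res, hp]
  simp [Hom.app_res, H]

/-- A morphism out of a locally free sheaf from compatible prescribed values on local bases. -/
theorem exists_hom (hD : ∀ x, ∃ i, x ∈ D i) (hb : ∀ i, IsBasisOn (D i) (b i))
    (k : ∀ i, Fin n → Γ(N, D i))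
    (hk : ∀ i j, ∃ A : Fin n → Fin n → Γ(X, D i ⊓ D j),
      (∀ a, res inf_le_left (b i a) = ∑ e, A a e • res inf_le_right (b j e)) ∧
      ∀ a, res inf_le_left (k i a) = ∑ e, A a e • res inf_le_right (k j e)) :
    ∃ φ : M ⟶ N, ∀ i a, φ.app (D i) (b i a) = k i a := by
  -- A morphism `φ` is encoded as the pairing `(a, s) ↦ a φ(s)` on `O_X × M`, so gluing of pairings
  -- applies; `φ` is recovered at `a = 1`.
  obtain ⟨β, hβ⟩ := exists_pairing (M := structureModule X) (N := M) (K := N) (m := 1) hD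
    (fun i => isBasisOn_structureModule) hb (fun i _ a => k i a) (fun i j => by
      obtain ⟨A, hA, hk⟩ := hk i j
      refine ⟨fun _ _ => 1, A, fun a => ?_, hA, fun a a' => ?_⟩
      · simp [res_unitSection]
      · simpa using hk a')
  refine ⟨homMk (fun U => β.app U (unitSection U)) fun U V h s => ?_, fun i a => ?_⟩
  · rw [β.map_res, res_unitSection]
  · exact hβ i 0 a

/-- Matching local bases define an isomorphism. -/
theorem exists_iso {c : ∀ i, Fin n → Γ(N, D i)} (hD : ∀ x, ∃ i, x ∈ D i)
    (hb : ∀ i, IsBasisOn (D i) (b i)) (hc : ∀ i, IsBasisOn (D i) (c i))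
    (hk : ∀ i j, ∃ A : Fin n → Fin n → Γ(X, D i ⊓ D j),
      (∀ a, res inf_le_left (b i a) = ∑ e, A a e • res inf_le_right (b j e)) ∧
      ∀ a, res inf_le_left (c i a) = ∑ e, A a e • res inf_le_right (c j e)) :
    ∃ φ : M ≅ N, ∀ i a, φ.hom.app (D i) (b i a) = c i a := by
  obtain ⟨φ, hφ⟩ := exists_hom hD hb c hk
  obtain ⟨ψ, hψ⟩ := exists_hom hD hc b fun i j => by
    obtain ⟨A, h1, h2⟩ := hk i j
    exact ⟨A, h2, h1⟩
  refine ⟨⟨φ, ψ, hom_ext_of_frames hD hb fun i a => ?_, hom_ext_of_frames hD hc fun i a => ?_⟩, hφ⟩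
  · exact (congrArg _ (hφ i a)).trans (hψ i a)
  · exact (congrArg _ (hψ i a)).trans (hφ i a)

lemma exists_hom_one {e : ∀ i, Γ(M, D i)} (hD : ∀ x, ∃ i, x ∈ D i)
    (he : ∀ i, IsBasisOn (D i) ![e i]) (k : ∀ i, Γ(N, D i))
    (hk : ∀ i j, ∃ v : Γ(X, D i ⊓ D j), res inf_le_left (e i) = v • res inf_le_right (e j) ∧
      res inf_le_left (k i) = v • res inf_le_right (k j)) :
    ∃ φ : M ⟶ N, ∀ i, φ.app (D i) (e i) = k i := by
  obtain ⟨φ, hφ⟩ := exists_hom hD he (fun i => ![k i]) fun i j => by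
    obtain ⟨v, h1, h2⟩ := hk i j
    exact ⟨fun _ _ => v, by simpa using h1, by simpa using h2⟩
  exact ⟨φ, fun i => hφ i 0⟩

lemma exists_iso_one {e : ∀ i, Γ(M, D i)} {k : ∀ i, Γ(N, D i)} (hD : ∀ x, ∃ i, x ∈ D i)
    (he : ∀ i, IsBasisOn (D i) ![e i]) (hk : ∀ i, IsBasisOn (D i) ![k i])
    (H : ∀ i j, ∃ v : Γ(X, D i ⊓ D j), res inf_le_left (e i) = v • res inf_le_right (e j) ∧
      res inf_le_left (k i) = v • res inf_le_right (k j)) :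
    ∃ φ : M ≅ N, ∀ i, φ.hom.app (D i) (e i) = k i := by
  obtain ⟨φ, hφ⟩ := exists_iso hD he hk fun i j => by
    obtain ⟨v, h1, h2⟩ := H i j
    exact ⟨fun _ _ => v, by simpa using h1, by simpa using h2⟩
  exact ⟨φ, fun i => hφ i 0⟩

lemma hom_ext_of_frames_one {e : ∀ i, Γ(M, D i)} {φ ψ : M ⟶ N} (hD : ∀ x, ∃ i, x ∈ D i)
    (he : ∀ i, IsBasisOn (D i) ![e i]) (H : ∀ i, φ.app _ (e i) = ψ.app _ (e i)) : φ = ψ :=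
  hom_ext_of_frames hD he fun i a => by simpa using H i

lemma exists_pairing_one {e : ∀ i, Γ(M, D i)} {f : ∀ i, Γ(N, D i)} (hD : ∀ x, ∃ i, x ∈ D i)
    (he : ∀ i, IsBasisOn (D i) ![e i]) (hf : ∀ i, IsBasisOn (D i) ![f i]) (k : ∀ i, Γ(K, D i))
    (hk : ∀ i j, ∃ v w : Γ(X, D i ⊓ D j), res inf_le_left (e i) = v • res inf_le_right (e j) ∧
      res inf_le_left (f i) = w • res inf_le_right (f j) ∧
      res inf_le_left (k i) = (v * w) • res inf_le_right (k j)) :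
    ∃ β : Pairing M N K, ∀ i, β.app (D i) (e i) (f i) = k i := by
  obtain ⟨φ, hφ⟩ := exists_pairing hD he hf (fun i _ _ => k i) fun i j => by
    obtain ⟨v, w, h1, h2, h3⟩ := hk i j
    exact ⟨fun _ _ => v, fun _ _ => w, by simpa using h1, by simpa using h2,
      by simpa [mul_smul] using h3⟩
  exact ⟨φ, fun i => hφ i 0 0⟩

end Homs

/-- Composition of a pairing with a morphism. -/
def Pairing.comp (β : Pairing M N K) (φ : K ⟶ L) : Pairing M N L where
  app U := LinearMap.mk₂ _ (fun x y => φ.app U (β.app U x y)) (by simp) (by simp) (by simp)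
    (by simp)
  map_res h x y := by simp [← Hom.app_res, β.map_res]

lemma Pairing.comp_app (β : Pairing M N K) (φ : K ⟶ L) (x : Γ(M, U)) (y : Γ(N, U)) :
    (β.comp φ).app U x y = φ.app U (β.app U x y) := rfl

/-- The opposite pairing. -/
def Pairing.flip (β : Pairing M N K) : Pairing N M K where
  app U := (β.app U).flip
  map_res h x y := β.map_res h y x

lemma Pairing.flip_app (β : Pairing M N K) (x : Γ(M, U)) (y : Γ(N, U)) :
    β.flip.app U y x = β.app U x y := rfl

lemma Pairing.IsTensor.flip {β : Pairing M N K} (h : β.IsTensor) : β.flip.IsTensor := by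
  intro L γ
  obtain ⟨φ, h1, h2⟩ := h L γ.flip
  exact ⟨φ, fun U x y => h1 U y x, fun ψ hψ => h2 ψ fun U x y => hψ U y x⟩

lemma Pairing.IsTensor.comp_iso {β : Pairing M N K} (h : β.IsTensor) (e : K ≅ L) :
    (β.comp e.hom).IsTensor := by
  intro P γ
  obtain ⟨φ, h1, h2⟩ := h P γ
  refine ⟨e.inv ≫ φ, fun U x y => ?_, fun ψ hψ => ?_⟩
  · rw [β.comp_app, ← h1]
    exact congrArg _ (Iso.hom_inv_app e _)
  · rw [← h2 (e.hom ≫ ψ) fun U x y => hψ U x y]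
    simp

lemma Pairing.IsTensor.exists_iso {β : Pairing M N K} {γ : Pairing M N L} (h : β.IsTensor)
    (h' : γ.IsTensor) :
    ∃ e : K ≅ L, ∀ U x y, e.hom.app U (β.app U x y) = γ.app U x y := by
  obtain ⟨φ, hφ, -⟩ := h L γ
  obtain ⟨ψ, hψ, -⟩ := h' K β
  refine ⟨⟨φ, ψ, (h K β).unique (fun U x y => ?_) fun U x y => rfl,
    (h' L γ).unique (fun U x y => ?_) fun U x y => rfl⟩, hφ⟩
  · exact (congrArg _ (hφ U x y)).trans (hψ U x y)
  · exact (congrArg _ (hψ U x y)).trans (hφ U x y)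

lemma Pairing.IsExteriorSquare.comp_iso {w : Pairing M M K} (h : w.IsExteriorSquare) (e : K ≅ L) :
    (w.comp e.hom).IsExteriorSquare := by
  refine ⟨fun U x => by rw [w.comp_app, h.1, map_zero], fun P γ hγ => ?_⟩
  obtain ⟨φ, h1, h2⟩ := h.2 P γ hγ
  refine ⟨e.inv ≫ φ, fun U x y => ?_, fun ψ hψ => ?_⟩
  · rw [w.comp_app, ← h1]
    exact congrArg _ (Iso.hom_inv_app e _)
  · rw [← h2 (e.hom ≫ ψ) fun U x y => hψ U x y]
    simp

lemma Pairing.IsExteriorSquare.exists_iso {β : Pairing M M K} {γ : Pairing M M L}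
    (h : β.IsExteriorSquare) (h' : γ.IsExteriorSquare) :
    ∃ e : K ≅ L, ∀ U x y, e.hom.app U (β.app U x y) = γ.app U x y := by
  obtain ⟨φ, hφ, -⟩ := h.2 L γ h'.1
  obtain ⟨ψ, hψ, -⟩ := h'.2 K β h.1
  refine ⟨⟨φ, ψ, (h.2 K β h.1).unique (fun U x y => ?_) fun U x y => rfl,
    (h'.2 L γ h'.1).unique (fun U x y => ?_) fun U x y => rfl⟩, hφ⟩
  · exact (congrArg _ (hφ U x y)).trans (hψ U x y)
  · exact (congrArg _ (hψ U x y)).trans (hφ U x y)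

section

variable {ι : Type*} {D : ι → X.Opens}

/-- A factorization of `γ` must send `β(e, f)` to `γ(e, f)`. If the `β(e, f)` are generators, this
prescribes it on a frame, consistently because both sides have transition function `v * w`. -/
theorem isTensor_of_frames {e : ∀ i, Γ(M, D i)} {f : ∀ i, Γ(N, D i)} (hD : ∀ x, ∃ i, x ∈ D i)
    (he : ∀ i, IsBasisOn (D i) ![e i]) (hf : ∀ i, IsBasisOn (D i) ![f i]) (β : Pairing M N K)
    (hβ : ∀ i, IsBasisOn (D i) ![β.app _ (e i) (f i)]) : β.IsTensor := by
  intro L γ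
  obtain ⟨φ, hφ⟩ := exists_hom_one hD hβ (fun i => γ.app _ (e i) (f i)) fun i j => by
    obtain ⟨v, hv⟩ := exists_transition_one (e i) (he j)
    obtain ⟨w, hw⟩ := exists_transition_one (f i) (hf j)
    refine ⟨v * w, ?_, ?_⟩
    · rw [β.map_res, β.map_res, hv, hw]
      simp [mul_smul, smul_comm v w]
    · rw [γ.map_res, γ.map_res, hv, hw]
      simp [mul_smul, smul_comm v w]
  refine ⟨φ, ?_, fun ψ hψ => hom_ext_of_frames_one hD hβ fun i => (hψ _ _ _).trans (hφ i).symm⟩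
  exact Pairing.ext_of_frames (β := β.comp φ) hD he hf fun i a a' => by simpa [Pairing.comp_app] using hφ i

lemma Pairing.IsAlternating.antisymm {w : Pairing M M K} (h : w.IsAlternating) (x y : Γ(M, U)) :
    w.app U y x = - w.app U x y := by
  have := h U (x + y)
  simp only [map_add, LinearMap.add_apply, h U x, h U y, zero_add, add_zero] at this
  exact eq_neg_of_add_eq_zero_left this

lemma Pairing.IsAlternating.app_comb {w : Pairing M M K} (h : w.IsAlternating) (x y : Γ(M, U))
    (a b c d : Γ(X, U)) :
    w.app U (a • x + b • y) (c • x + d • y) = (a * d - b * c) • w.app U x y := by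
  simp only [map_add, LinearMap.add_apply, map_smul, LinearMap.smul_apply, h U x, h U y,
    h.antisymm x y]
  module

/-- In rank two an alternating pairing is determined by its value on a basis `p, q`, and a change of
basis multiplies this value by the determinant, for `w` and `γ` alike. -/
theorem isExteriorSquare_of_frames {p q : ∀ i, Γ(M, D i)} (hD : ∀ x, ∃ i, x ∈ D i)
    (hb : ∀ i, IsBasisOn (D i) ![p i, q i]) {w : Pairing M M K} (halt : w.IsAlternating)
    (hw : ∀ i, IsBasisOn (D i) ![w.app _ (p i) (q i)]) : w.IsExteriorSquare := by
  refine ⟨halt, fun L γ hγ => ?_⟩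
  obtain ⟨φ, hφ⟩ := exists_hom_one hD hw (fun i => γ.app _ (p i) (q i)) fun i j => by
    obtain ⟨c, hc⟩ := (hb j).exists_coords inf_le_right (res (inf_le_left : D i ⊓ D j ≤ _) (p i))
    obtain ⟨d, hd⟩ := (hb j).exists_coords inf_le_right (res (inf_le_left : D i ⊓ D j ≤ _) (q i))
    simp only [Fin.sum_univ_two, Matrix.cons_val_zero, Matrix.cons_val_one] at hc hd
    refine ⟨c 0 * d 1 - c 1 * d 0, ?_, ?_⟩
    · rw [w.map_res, w.map_res, hc, hd, halt.app_comb]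
    · rw [γ.map_res, γ.map_res, hc, hd, hγ.app_comb]
  refine ⟨φ, ?_, fun ψ hψ => hom_ext_of_frames_one hD hw fun i => (hψ _ _ _).trans (hφ i).symm⟩
  refine Pairing.ext_of_frames (β := w.comp φ) hD hb hb fun i a a' => ?_
  have h1 : φ.app _ (w.app _ (q i) (p i)) = γ.app _ (q i) (p i) := by
    rw [halt.antisymm, hγ.antisymm, map_neg, hφ]
  fin_cases a <;> fin_cases a' <;>
    simp [Pairing.comp_app, halt _ _, hγ _ _, hφ, h1]

end

end

/-! ### Pullback of modules -/

section

variable {X Y Z : Scheme.{u}} {f : X ⟶ Y} {n : ℕ}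

section

variable {M N : Y.Modules} {M' M'' : X.Modules}

/-- The pullback is characterized by its universal property. -/
lemma isPullback_iff (η : M ⟶ (Scheme.Modules.pushforward f).obj M') :
    IsPullback f η ↔ ∀ K : X.Modules, Function.Bijective
      fun φ : M' ⟶ K => η ≫ (Scheme.Modules.pushforward f).map φ := by
  rw [IsPullback, isIso_iff_coyoneda_map_bijective]
  refine forall_congr' fun K => ?_
  rw [← (((Scheme.Modules.pullbackPushforwardAdjunction f).homEquiv M K).bijective).of_comp_iff']
  refine iff_of_eq (congrArg _ (funext fun φ => ?_))
  simp [Adjunction.homEquiv_naturality_right]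

variable {η : M ⟶ (Scheme.Modules.pushforward f).obj M'} {V W : Y.Opens}

lemma pullSection_res (h : W ≤ V) (s : Γ(M, V)) :
    pullSection η (res h s) = res (f.preimage_mono h) (pullSection η s) :=
  Hom.app_res η h s

lemma pullSection_add (s t : Γ(M, V)) :
    pullSection η (s + t) = pullSection η s + pullSection η t :=
  map_add (η.app V).hom s t

lemma pullSection_sub (s t : Γ(M, V)) :
    pullSection η (s - t) = pullSection η s - pullSection η t :=
  map_sub (η.app V).hom s t

lemma pullSection_sum {ι : Type*} (F : Finset ι) (s : ι → Γ(M, V)) :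
    pullSection η (∑ i ∈ F, s i) = ∑ i ∈ F, pullSection η (s i) :=
  map_sum (η.app V).hom s F

lemma pullSection_smul (r : Γ(Y, V)) (s : Γ(M, V)) :
    pullSection η (r • s) = f.app V r • pullSection η s :=
  Scheme.Modules.Hom.app_smul η r s

lemma app_resO (h : W ≤ V) (r : Γ(Y, V)) :
    f.app W (resO h r) = resO (f.preimage_mono h) (f.app V r) :=
  ConcreteCategory.congr_hom (f.naturality (homOfLE h).op) r

lemma preimage_cover {ι : Type*} {D : ι → Y.Opens} (hD : ∀ y, ∃ i, y ∈ D i) (x : X) :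
    ∃ i, x ∈ f ⁻¹ᵁ D i := hD (f x)

/-- Checks the universal property on frames. The pulled back frames change by the pulled back
matrices, and so do their images under any `M ⟶ f_* K`; hence the latter extends uniquely to `M' ⟶
K`. -/
theorem isPullback_of_frames {ι : Type*} {D : ι → Y.Opens} (hD : ∀ y, ∃ i, y ∈ D i)
    {b : ∀ i, Fin n → Γ(M, D i)} (hb : ∀ i, IsBasisOn (D i) (b i))
    (hη : ∀ i, IsBasisOn (f ⁻¹ᵁ D i) fun a => pullSection η (b i a)) : IsPullback f η := by
  rw [isPullback_iff]
  refine fun K => ⟨fun φ ψ h => ?_, fun ψ => ?_⟩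
  · refine hom_ext_of_frames (preimage_cover hD) hη fun i a => ?_
    exact congrArg (fun χ : M ⟶ (Scheme.Modules.pushforward f).obj K => χ.app (D i) (b i a)) h
  · obtain ⟨φ, hφ⟩ := exists_hom (N := K) (preimage_cover hD) hη
      (fun i a => pullSection ψ (b i a)) fun i j => by
        choose A hA using fun a => (hb j).exists_coords inf_le_right
          (res (inf_le_left : D i ⊓ D j ≤ _) (b i a))
        refine ⟨fun a e => f.app _ (A a e), fun a => ?_, fun a => ?_⟩
        · have := congrArg (pullSection η) (hA a)
          simp only [pullSection_sum, pullSection_smul, pullSection_res] at this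
          exact this
        · have := congrArg (pullSection ψ) (hA a)
          simp only [pullSection_sum, pullSection_smul, pullSection_res] at this
          exact this
    exact ⟨φ, hom_ext_of_frames hD hb hφ⟩

lemma IsPullback.exists_iso {η' : M ⟶ (Scheme.Modules.pushforward f).obj M''}
    (h : IsPullback f η) (h' : IsPullback f η') :
    ∃ e : M' ≅ M'', ∀ (V : Y.Opens) (s : Γ(M, V)),
      e.hom.app _ (pullSection η s) = pullSection η' s := by
  rw [isPullback_iff] at h h'
  obtain ⟨φ, hφ⟩ := (h M'').2 η'
  obtain ⟨ψ, hψ⟩ := (h' M').2 η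
  dsimp only at hφ hψ
  refine ⟨⟨φ, ψ, (h M').1 ?_, (h' M'').1 ?_⟩, fun V s => ?_⟩
  · simp [reassoc_of% hφ, hψ]
  · simp [reassoc_of% hψ, hφ]
  · exact congrArg (fun χ : M ⟶ (Scheme.Modules.pushforward f).obj M'' => χ.app V s) hφ

lemma IsPullback.comp_iso (h : IsPullback f η) (e : M' ≅ M'') :
    IsPullback f (η ≫ (Scheme.Modules.pushforward f).map e.hom) := by
  rw [isPullback_iff] at h ⊢
  intro K
  have : (fun φ : M'' ⟶ K => (η ≫ (Scheme.Modules.pushforward f).map e.hom) ≫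
      (Scheme.Modules.pushforward f).map φ) =
      (fun φ : M' ⟶ K => η ≫ (Scheme.Modules.pushforward f).map φ) ∘ fun φ => e.hom ≫ φ := by
    funext φ
    simp
  rw [this]
  refine (h K).comp ⟨fun a b hab => (cancel_epi e.hom).mp hab, fun b => ⟨e.inv ≫ b, by simp⟩⟩

lemma pullSection_comp_map (φ : M' ⟶ M'') (s : Γ(M, V)) :
    pullSection (η ≫ (Scheme.Modules.pushforward f).map φ) s = φ.app _ (pullSection η s) := rfl

end

end

/-! ### Local divisibility, bilinear forms and square roots modulo four -/

section

variable {X Y Z : Scheme.{u}} {M N K : X.Modules} {U V W : X.Opens}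

section LocallyDvd

variable {k : ℕ} {a b : Γ(X, U)}

lemma LocallyDvd.of_dvd (h : (k : Γ(X, U)) ∣ a) : LocallyDvd k a := fun x hx =>
  ⟨U, le_rfl, hx, by simpa using h⟩

lemma LocallyDvd.zero : LocallyDvd k (0 : Γ(X, U)) := .of_dvd (dvd_zero _)

lemma LocallyDvd.restrict (h : V ≤ U) (ha : LocallyDvd k a) : LocallyDvd k (resO h a) := by
  intro x hx
  obtain ⟨W, hW, hxW, hd⟩ := ha x (h hx)
  refine ⟨V ⊓ W, inf_le_left, ⟨hx, hxW⟩, ?_⟩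
  have := map_dvd (resHom (inf_le_right : V ⊓ W ≤ W)) hd
  simpa [resHom_apply] using this

lemma LocallyDvd.add (ha : LocallyDvd k a) (hb : LocallyDvd k b) : LocallyDvd k (a + b) := by
  intro x hx
  obtain ⟨W, hW, hxW, hd⟩ := ha x hx
  obtain ⟨W', hW', hxW', hd'⟩ := hb x hx
  refine ⟨W ⊓ W', inf_le_left.trans hW, ⟨hxW, hxW'⟩, ?_⟩
  have h1 := map_dvd (resHom (inf_le_left : W ⊓ W' ≤ W)) hd
  have h2 := map_dvd (resHom (inf_le_right : W ⊓ W' ≤ W')) hd'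
  simp only [resHom_apply, resO_natCast, resO_resO] at h1 h2
  rw [resO_add]
  exact dvd_add h1 h2

lemma LocallyDvd.mul_left (ha : LocallyDvd k a) (c : Γ(X, U)) : LocallyDvd k (c * a) := by
  intro x hx
  obtain ⟨W, hW, hxW, hd⟩ := ha x hx
  exact ⟨W, hW, hxW, by rw [resO_mul]; exact hd.mul_left _⟩

lemma LocallyDvd.app {f : Y ⟶ X} (ha : LocallyDvd k a) : LocallyDvd k (f.app U a) := by
  intro y hy
  obtain ⟨W, hW, hxW, hd⟩ := ha (f y) hy
  refine ⟨f ⁻¹ᵁ W, f.preimage_mono hW, hxW, ?_⟩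
  rw [← app_resO]
  simpa using map_dvd (f.app W).hom hd

end LocallyDvd

namespace BilinearForm

/-- A bilinear form as a pairing with values in the structure sheaf. -/
def toPairing (B : BilinearForm M) : Pairing M M (structureModule X) := ⟨B.app, B.map_res⟩

/-- A pairing with values in the structure sheaf as a bilinear form. -/
def ofPairing (B : Pairing M M (structureModule X)) : BilinearForm M := ⟨B.app, B.map_res⟩

/-- The inverse image of a bilinear form. -/
def comap (B : BilinearForm N) (φ : M ⟶ N) : BilinearForm M where
  app U := LinearMap.mk₂ _ (fun x y => B.app U (φ.app U x) (φ.app U y)) (by simp) (by simp)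
    (by simp) (by simp)
  map_res h x y := by simp [Hom.app_res, B.map_res]

lemma comap_app (B : BilinearForm N) (φ : M ⟶ N) (x y : Γ(M, U)) :
    (B.comap φ).app U x y = B.app U (φ.app U x) (φ.app U y) := rfl

variable {ι : Type*} {D : ι → X.Opens} {e : ∀ i, Γ(M, D i)}

lemma ext_of_frames {B C : BilinearForm M} (hD : ∀ x, ∃ i, x ∈ D i)
    (he : ∀ i, IsBasisOn (D i) ![e i])
    (H : ∀ i, B.app _ (e i) (e i) = C.app _ (e i) (e i)) (x y : Γ(M, U)) :
    B.app U x y = C.app U x y :=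
  Pairing.ext_of_frames (β := B.toPairing) (γ := C.toPairing) hD he he
    (fun i a a' => by fin_cases a; fin_cases a'; exact H i) U x y

lemma exists_of_frames (hD : ∀ x, ∃ i, x ∈ D i) (he : ∀ i, IsBasisOn (D i) ![e i])
    (d : ∀ i, Γ(X, D i))
    (hd : ∀ i j, ∃ v : Γ(X, D i ⊓ D j), res inf_le_left (e i) = v • res inf_le_right (e j) ∧
      resO inf_le_left (d i) = v ^ 2 * resO inf_le_right (d j)) :
    ∃ B : BilinearForm M, ∀ i, B.app _ (e i) (e i) = d i := by
  obtain ⟨β, hβ⟩ := exists_pairing_one (K := structureModule X) hD he he d fun i j => by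
    obtain ⟨v, h1, h2⟩ := hd i j
    exact ⟨v, v, h1, h1, h2.trans (by rw [sq]; rfl)⟩
  exact ⟨ofPairing β, hβ⟩

lemma app_smul_smul (B : BilinearForm M) (x y : Γ(M, U)) (a b : Γ(X, U)) :
    B.app U (a • x) (b • y) = a * b * B.app U x y := by
  simp only [map_smul, LinearMap.smul_apply, smul_eq_mul]
  ring

end BilinearForm

lemma IsBasisOn.coord_basis {e : Γ(M, U)} (he : IsBasisOn U ![e]) (h : V ≤ U) :
    (he.basis h).coord 0 (res h e) = 1 := by
  rw [show res h e = he.basis h 0 by simp, Module.Basis.coord_apply, Module.Basis.repr_self,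
    Finsupp.single_eq_same]

/-- The linear form with given value on a local generator. -/
def IsBasisOn.localForm {e : Γ(M, U)} (he : IsBasisOn U ![e]) (τ : Γ(X, U)) : LocalForm M U where
  app V h := resO h τ • (he.basis h).coord 0
  map_res {V W} hV h x := by
    obtain ⟨c, rfl⟩ := he.coord_one hV x
    simp only [LinearMap.smul_apply, map_smul, he.coord_basis, res_smul, res_res, smul_eq_mul, mul_one,
      resO_mul, resO_resO]

lemma IsBasisOn.localForm_apply {e : Γ(M, U)} (he : IsBasisOn U ![e]) (τ : Γ(X, U)) (h : V ≤ U)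
    (c : Γ(X, V)) : (he.localForm τ).app V h (c • res h e) = resO h τ * c := by
  simp only [localForm, LinearMap.smul_apply, map_smul, he.coord_basis, smul_eq_mul]
  ring

section SquareModFour

/-- A linear form on `M` over `D i` is its value `τ i` on the generator `e i`, and all other values
are multiples of this one. So both congruences need only be tested on generators. -/
theorem isSquareModFour_of_frames {B : BilinearForm M} {ι : Type u} {D : ι → X.Opens}
    {e : ∀ i, Γ(M, D i)} (hD : ∀ x, ∃ i, x ∈ D i) (he : ∀ i, IsBasisOn (D i) ![e i])
    (τ : ∀ i, Γ(X, D i)) (h4 : ∀ i, LocallyDvd 4 (B.app _ (e i) (e i) - τ i ^ 2))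
    (h2 : ∀ i j, ∃ v : Γ(X, D i ⊓ D j), res inf_le_left (e i) = v • res inf_le_right (e j) ∧
      LocallyDvd 2 (resO inf_le_left (τ i) - v * resO inf_le_right (τ j))) :
    B.IsSquareModFour := by
  refine ⟨ι, D, fun i => (he i).localForm (τ i), ?_, ?_, ?_⟩
  · rw [eq_top_iff]
    exact fun x _ => Opens.mem_iSup.mpr (hD x)
  · intro i j V hi hj x
    obtain ⟨v, hv, hd⟩ := h2 i j
    obtain ⟨c, rfl⟩ := (he i).coord_one hi x
    have h1 : res hi (e i) = resO (le_inf hi hj) v • res hj (e j) := by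
      simpa [res_smul] using congrArg (res (le_inf hi hj)) hv
    rw [IsBasisOn.localForm_apply, h1, smul_smul, IsBasisOn.localForm_apply]
    have := (hd.restrict (le_inf hi hj)).mul_left c
    simp only [resO_sub, resO_mul, resO_resO] at this
    convert this using 1
    ring
  · intro i V hi x y
    obtain ⟨c, rfl⟩ := (he i).coord_one hi x
    obtain ⟨d, rfl⟩ := (he i).coord_one hi y
    rw [IsBasisOn.localForm_apply, IsBasisOn.localForm_apply, B.app_smul_smul, ← B.map_res]
    have := ((h4 i).restrict hi).mul_left (c * d)
    simp only [resO_sub, resO_pow] at this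
    convert this using 1
    ring

/-- A discriminant has local square roots modulo `4` that agree modulo `2`. -/
theorem Discriminant.exists_roots (E : Discriminant X) :
    ∃ (D : X → X.Opens) (e : ∀ x, Γ(E.mod, D x)) (τ : ∀ x, Γ(X, D x)), (∀ x, x ∈ D x) ∧
      (∀ x, IsBasisOn (D x) ![e x]) ∧
      (∀ x, LocallyDvd 4 (E.form.app _ (e x) (e x) - τ x ^ 2)) ∧
      ∀ x y (v : Γ(X, D x ⊓ D y)), res inf_le_left (e x) = v • res inf_le_right (e y) →
        LocallyDvd 2 (resO inf_le_left (τ x) - v * resO inf_le_right (τ y)) := by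
  obtain ⟨ι, D, t, hD, h2, h4⟩ := E.isSquareModFour
  have hD' : ∀ x, ∃ i, x ∈ D i := fun x => by
    have : x ∈ ⨆ i, D i := hD ▸ trivial
    exact Opens.mem_iSup.mp this
  choose i hi using hD'
  choose U hU b hb using E.rank_one
  have hb' : ∀ x, IsBasisOn (U x) ![b x 0] := fun x => by
    have h := hb x
    convert h using 1
    ext a
    fin_cases a
    rfl
  refine ⟨fun x => D (i x) ⊓ U x, fun x => res inf_le_right (b x 0),
    fun x => (t (i x)).app _ inf_le_left (res inf_le_right (b x 0)), fun x => ⟨hi x, hU x⟩,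
    fun x => (hb' x).restrict_one _, fun x => ?_, fun x y v hv => ?_⟩
  · simpa [sq] using h4 (i x) (D (i x) ⊓ U x) inf_le_left (res inf_le_right (b x 0))
      (res inf_le_right (b x 0))
  -- By linearity `v` times the value at `e y` is the value at `v • e y`, which is `e x` on the
  -- overlap; what remains is the difference of two of the given linear forms at a single section.
  · rw [(t _).map_res, (t _).map_res, ← smul_eq_mul, ← map_smul, hv]
    exact h2 _ _ _ _ _ _

end SquareModFour

lemma InvertibleSheaf.exists_generator (L : InvertibleSheaf X) (x : X) :
    ∃ (U : X.Opens) (e : Γ(L.mod, U)), x ∈ U ∧ IsBasisOn U ![e] := by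
  obtain ⟨U, hU, b, hb⟩ := L.rank_one x
  refine ⟨U, b 0, hU, ?_⟩
  convert hb using 1
  ext a
  fin_cases a
  rfl

/-- Equal transition functions give an isomorphism of the modules, and a form in rank one is
determined by its value on a generator. All comparisons of discriminants go through this criterion.
-/
theorem Discriminant.equiv_of_frames {E F : Discriminant X} {ι : Type*} {D : ι → X.Opens}
    (hD : ∀ x, ∃ i, x ∈ D i) (e : ∀ i, Γ(E.mod, D i)) (k : ∀ i, Γ(F.mod, D i))
    (he : ∀ i, IsBasisOn (D i) ![e i]) (hk : ∀ i, IsBasisOn (D i) ![k i])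
    (H : ∀ i j, ∃ v : Γ(X, D i ⊓ D j), res inf_le_left (e i) = v • res inf_le_right (e j) ∧
      res inf_le_left (k i) = v • res inf_le_right (k j))
    (hd : ∀ i, E.form.app _ (e i) (e i) = F.form.app _ (k i) (k i)) : E ≈ F := by
  obtain ⟨φ, hφ⟩ := exists_iso_one hD he hk H
  refine ⟨φ, fun U x y => ?_⟩
  exact BilinearForm.ext_of_frames (B := F.form.comap φ.hom) (C := E.form) hD he
    (fun i => by rw [BilinearForm.comap_app, hφ, hd]) x y

/-! ### Gluing of invertible sheaves -/

theorem exists_invertibleSheaf {ι : Type u} (D : ι → X.Opens) (hD : ∀ x, ∃ i, x ∈ D i)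
    (g : ∀ i j, Γ(X, D i ⊓ D j)) (g_self : ∀ i, g i i = 1)
    (g_mul : ∀ i j k,
      resO (inf_le_left : D i ⊓ D j ⊓ D k ≤ D i ⊓ D j) (g i j) *
        resO (inf_le_inf_right _ inf_le_right : D i ⊓ D j ⊓ D k ≤ D j ⊓ D k) (g j k) =
      resO (inf_le_inf_right _ inf_le_left : D i ⊓ D j ⊓ D k ≤ D i ⊓ D k) (g i k)) :
    ∃ (L : InvertibleSheaf X) (e : ∀ i, Γ(L.mod, D i)), (∀ i, IsBasisOn (D i) ![e i]) ∧
      ∀ i j, res inf_le_left (e i) = g i j • res inf_le_right (e j) := by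
  let c : Cocycle X 1 := ⟨ι, D, hD, fun i j _ _ => g i j, fun i a b => by
    simp [g_self, Subsingleton.elim a b], fun i j k a b => by simpa using g_mul i j k⟩
  refine ⟨⟨c.modules, fun x => ?_⟩, fun i => c.frame i 0, fun i => ?_, fun i j => ?_⟩
  · obtain ⟨i, hi⟩ := hD x
    exact ⟨D i, hi, c.frame i, c.isBasisOn_frame i⟩
  · convert c.isBasisOn_frame i using 1
    ext a
    fin_cases a
    rfl
  · simpa using c.frame_eq i j 0

/-- The local generators of a sheaf of modules. -/
def Frame (M : X.Modules) : Type u := Σ U : X.Opens, {e : Γ(M, U) // IsBasisOn U ![e]}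

/-- The quotient of two local generators. -/
def Frame.tr (i j : Frame M) : Γ(X, i.1 ⊓ j.1) :=
  (exists_transition_one i.2.1 j.2.2).choose

lemma Frame.tr_spec (i j : Frame M) :
    res inf_le_left i.2.1 = i.tr j • res inf_le_right j.2.1 :=
  (exists_transition_one i.2.1 j.2.2).choose_spec

lemma Frame.tr_spec' {i j : Frame M} (h : W ≤ i.1 ⊓ j.1) :
    res (h.trans inf_le_left) i.2.1 = resO h (i.tr j) • res (h.trans inf_le_right) j.2.1 := by
  simpa [res_smul] using congrArg (res h) (i.tr_spec j)

lemma Frame.tr_self (i : Frame M) : i.tr i = 1 :=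
  i.2.2.cancel_one _ ((i.tr_spec i).symm.trans (one_smul _ _).symm)

lemma Frame.tr_mul {i j k : Frame M} (hij : W ≤ i.1 ⊓ j.1) (hjk : W ≤ j.1 ⊓ k.1)
    (hik : W ≤ i.1 ⊓ k.1) :
    resO hij (i.tr j) * resO hjk (j.tr k) = resO hik (i.tr k) := by
  refine k.2.2.cancel_one (hik.trans inf_le_right) ?_
  rw [mul_smul, ← tr_spec', ← tr_spec', ← tr_spec']

lemma InvertibleSheaf.cover (L : InvertibleSheaf X) (x : X) : ∃ i : Frame L.mod, x ∈ i.1 := by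
  obtain ⟨U, e, hx, he⟩ := L.exists_generator x
  exact ⟨⟨U, e, he⟩, hx⟩

/-- The product cocycle is glued over the index set of all pairs of generators on a common open set,
not over a chosen cover. The last clause is then immediate, since any given pair of generators is
one of the indices. -/
theorem InvertibleSheaf.exists_tensor (L M : InvertibleSheaf X) :
    ∃ (N : InvertibleSheaf X) (β : Pairing L.mod M.mod N.mod), β.IsTensor ∧
      ∀ (U : X.Opens) (e : Γ(L.mod, U)) (f : Γ(M.mod, U)), IsBasisOn U ![e] → IsBasisOn U ![f] →
        IsBasisOn U ![β.app U e f] := by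
  let ι := Σ U : X.Opens, {e : Γ(L.mod, U) // IsBasisOn U ![e]} ×
    {e : Γ(M.mod, U) // IsBasisOn U ![e]}
  let l : ι → Frame L.mod := fun i => ⟨i.1, i.2.1⟩
  let m : ι → Frame M.mod := fun i => ⟨i.1, i.2.2⟩
  have hD : ∀ x, ∃ i : ι, x ∈ i.1 := fun x => by
    obtain ⟨U, e, hx, he⟩ := L.exists_generator x
    obtain ⟨V, f, hx', hf⟩ := M.exists_generator x
    exact ⟨⟨U ⊓ V, ⟨_, he.restrict_one inf_le_left⟩, ⟨_, hf.restrict_one inf_le_right⟩⟩, hx, hx'⟩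
  obtain ⟨N, b, hb, hg⟩ := exists_invertibleSheaf (fun i : ι => i.1) hD
    (fun i j => (l i).tr (l j) * (m i).tr (m j))
    (fun i => by rw [Frame.tr_self, Frame.tr_self, one_mul]) fun i j k => by
      rw [resO_mul, resO_mul, resO_mul, mul_mul_mul_comm]
      exact congrArg₂ _ (Frame.tr_mul (i := l i) (j := l j) (k := l k) _ _ _)
        (Frame.tr_mul (i := m i) (j := m j) (k := m k) _ _ _)
  obtain ⟨β, hβ⟩ := exists_pairing_one (K := N.mod) hD (fun i => i.2.1.2) (fun i => i.2.2.2) b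
    fun i j => ⟨_, _, (l i).tr_spec (l j), (m i).tr_spec (m j), hg i j⟩
  refine ⟨N, β, isTensor_of_frames hD (fun i => i.2.1.2) (fun i => i.2.2.2) β fun i => ?_,
    fun U e f he hf => ?_⟩
  · rw [hβ]
    exact hb i
  · rw [hβ ⟨U, ⟨e, he⟩, ⟨f, hf⟩⟩]
    exact hb ⟨U, ⟨e, he⟩, ⟨f, hf⟩⟩

end

/-! ### Products and pullbacks of discriminants, compared on generators -/

section

variable {X Y Z : Scheme.{u}} {M N K : X.Modules} {U V W : X.Opens}

lemma Pairing.app_smul_smul (β : Pairing M N K) (x : Γ(M, U)) (y : Γ(N, U)) (a b : Γ(X, U)) :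
    β.app U (a • x) (b • y) = (a * b) • β.app U x y := by
  simp only [map_smul, LinearMap.smul_apply, mul_smul]
  exact smul_comm _ _ _

lemma Pairing.res_app_of_transition {D D' : X.Opens} (β : Pairing M N K) {e : Γ(M, D)}
    {e' : Γ(M, D')} {f : Γ(N, D)} {f' : Γ(N, D')} {v w : Γ(X, D ⊓ D')}
    (hv : res inf_le_left e = v • res inf_le_right e')
    (hw : res inf_le_left f = w • res inf_le_right f') :
    res inf_le_left (β.app D e f) = (v * w) • res inf_le_right (β.app D' e' f') := by
  rw [β.map_res, β.map_res, hv, hw, β.app_smul_smul]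

namespace InvertibleSheaf

lemma exists_frames (L : InvertibleSheaf X) :
    ∃ (D : X → X.Opens) (e : ∀ x, Γ(L.mod, D x)), (∀ x, x ∈ D x) ∧
      ∀ x, IsBasisOn (D x) ![e x] := by
  choose D e hx he using L.exists_generator
  exact ⟨D, e, hx, he⟩

lemma exists_frames₂ (L M : InvertibleSheaf X) :
    ∃ (D : X → X.Opens) (e : ∀ x, Γ(L.mod, D x)) (f : ∀ x, Γ(M.mod, D x)), (∀ x, x ∈ D x) ∧
      (∀ x, IsBasisOn (D x) ![e x]) ∧ ∀ x, IsBasisOn (D x) ![f x] := by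
  obtain ⟨D, e, hx, he⟩ := L.exists_frames
  obtain ⟨D', f, hx', hf⟩ := M.exists_frames
  exact ⟨fun x => D x ⊓ D' x, fun x => res inf_le_left (e x), fun x => res inf_le_right (f x),
    fun x => ⟨hx x, hx' x⟩, fun x => (he x).restrict_one _, fun x => (hf x).restrict_one _⟩

lemma exists_frames₃ (L M N : InvertibleSheaf X) :
    ∃ (D : X → X.Opens) (e : ∀ x, Γ(L.mod, D x)) (f : ∀ x, Γ(M.mod, D x))
      (g : ∀ x, Γ(N.mod, D x)), (∀ x, x ∈ D x) ∧ (∀ x, IsBasisOn (D x) ![e x]) ∧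
      (∀ x, IsBasisOn (D x) ![f x]) ∧ ∀ x, IsBasisOn (D x) ![g x] := by
  obtain ⟨D, e, f, hx, he, hf⟩ := L.exists_frames₂ M
  obtain ⟨D', g, hx', hg⟩ := N.exists_frames
  exact ⟨fun x => D x ⊓ D' x, fun x => res inf_le_left (e x), fun x => res inf_le_left (f x),
    fun x => res inf_le_right (g x), fun x => ⟨hx x, hx' x⟩, fun x => (he x).restrict_one _,
    fun x => (hf x).restrict_one _, fun x => (hg x).restrict_one _⟩

end InvertibleSheaf

/-- True of the tensor product built by gluing, hence of every tensor product by uniqueness. This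
turns the universal property into a usable statement on generators. -/
lemma Pairing.IsTensor.isBasisOn {L M : InvertibleSheaf X} {β : Pairing L.mod M.mod K}
    (hβ : β.IsTensor) {e : Γ(L.mod, U)} {f : Γ(M.mod, U)} (he : IsBasisOn U ![e])
    (hf : IsBasisOn U ![f]) : IsBasisOn U ![β.app U e f] := by
  obtain ⟨N, γ, hγ, hb⟩ := L.exists_tensor M
  obtain ⟨φ, hφ⟩ := hγ.exists_iso hβ
  rw [← hφ]
  exact (hb U e f he hf).map_iso_one φ

/-- The transition functions between all generators of `L` are pulled back along `f`; as before,
indexing by all generators yields the last clause. -/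
lemma InvertibleSheaf.exists_pull {f : X ⟶ Y} (L : InvertibleSheaf Y) :
    ∃ (L' : InvertibleSheaf X) (η : L.mod ⟶ (Scheme.Modules.pushforward f).obj L'.mod),
      IsPullback f η ∧ ∀ (V : Y.Opens) (e : Γ(L.mod, V)), IsBasisOn V ![e] →
        IsBasisOn (f ⁻¹ᵁ V) ![pullSection η e] := by
  obtain ⟨L', b, hb, hg⟩ := exists_invertibleSheaf (fun i : Frame L.mod => f ⁻¹ᵁ i.1)
    (preimage_cover L.cover) (fun i j => f.app (i.1 ⊓ j.1) (i.tr j))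
    (fun i => by rw [Frame.tr_self]; exact map_one _) fun i j k => by
      have := congrArg (f.app (i.1 ⊓ j.1 ⊓ k.1)) (Frame.tr_mul (i := i) (j := j) (k := k)
        inf_le_left (inf_le_inf_right _ inf_le_right) (inf_le_inf_right _ inf_le_left))
      rw [map_mul, app_resO, app_resO, app_resO] at this
      exact this
  obtain ⟨η, hη⟩ := exists_hom_one (N := (Scheme.Modules.pushforward f).obj L'.mod) L.cover
    (fun i => i.2.2) b fun i j => ⟨i.tr j, i.tr_spec j, hg i j⟩
  have hη' : ∀ i : Frame L.mod, IsBasisOn (f ⁻¹ᵁ i.1) ![pullSection η i.2.1] := fun i => by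
    have : pullSection η i.2.1 = b i := hη i
    rw [this]
    exact hb i
  refine ⟨L', η, isPullback_of_frames L.cover (fun i => i.2.2) fun i => ?_,
    fun V e he => hη' ⟨V, e, he⟩⟩
  convert hη' i using 1
  ext a
  fin_cases a
  rfl

lemma IsPullback.isBasisOn {f : X ⟶ Y} {L : InvertibleSheaf Y}
    {η : L.mod ⟶ (Scheme.Modules.pushforward f).obj K} (hη : IsPullback f η) {V : Y.Opens}
    {e : Γ(L.mod, V)} (he : IsBasisOn V ![e]) : IsBasisOn (f ⁻¹ᵁ V) ![pullSection η e] := by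
  obtain ⟨L', η', hη', hb⟩ := L.exists_pull (f := f)
  obtain ⟨φ, hφ⟩ := hη'.exists_iso hη
  rw [← hφ]
  exact (hb V e he).map_iso_one φ

lemma isPullback_of_frames_one {f : X ⟶ Y} {M : Y.Modules} {M' : X.Modules}
    {η : M ⟶ (Scheme.Modules.pushforward f).obj M'} {ι : Type*} {D : ι → Y.Opens}
    (hD : ∀ y, ∃ i, y ∈ D i) {b : ∀ i, Γ(M, D i)} (hb : ∀ i, IsBasisOn (D i) ![b i])
    (hη : ∀ i, IsBasisOn (f ⁻¹ᵁ D i) ![pullSection η (b i)]) : IsPullback f η := by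
  refine isPullback_of_frames hD hb fun i => ?_
  convert hη i using 1
  ext a
  fin_cases a
  rfl

/-- The unit of the pullback along the identity. -/
def pullId (M : X.Modules) : M ⟶ (Scheme.Modules.pushforward (𝟙 X)).obj M :=
  (Scheme.Modules.pushforwardId X).inv.app M

/-- The composition of pullbacks. -/
def pullComp {f : X ⟶ Y} {g : Y ⟶ Z} {M : Z.Modules} {M' : Y.Modules} {M'' : X.Modules}
    (η : M ⟶ (Scheme.Modules.pushforward g).obj M')
    (η' : M' ⟶ (Scheme.Modules.pushforward f).obj M'') :
    M ⟶ (Scheme.Modules.pushforward (f ≫ g)).obj M'' :=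
  η ≫ (Scheme.Modules.pushforward g).map η' ≫ (Scheme.Modules.pushforwardComp f g).hom.app M''

lemma pullSection_pullComp {f : X ⟶ Y} {g : Y ⟶ Z} {M : Z.Modules} {M' : Y.Modules}
    {M'' : X.Modules} (η : M ⟶ (Scheme.Modules.pushforward g).obj M')
    (η' : M' ⟶ (Scheme.Modules.pushforward f).obj M'') {V : Z.Opens} (s : Γ(M, V)) :
    pullSection (pullComp η η') s = pullSection η' (pullSection η s) := rfl

lemma pullSection_transition {f : X ⟶ Y} {M : Y.Modules} {M' : X.Modules}
    (η : M ⟶ (Scheme.Modules.pushforward f).obj M') {D D' : Y.Opens} {e : Γ(M, D)} {e' : Γ(M, D')}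
    {v : Γ(Y, D ⊓ D')} (hv : res inf_le_left e = v • res inf_le_right e') :
    res (inf_le_left : f ⁻¹ᵁ D ⊓ f ⁻¹ᵁ D' ≤ f ⁻¹ᵁ D) (pullSection η e) =
      (show Γ(X, f ⁻¹ᵁ D ⊓ f ⁻¹ᵁ D') from f.app _ v) • res inf_le_right (pullSection η e') := by
  have := congrArg (pullSection η) hv
  rwa [pullSection_smul, pullSection_res, pullSection_res] at this

namespace Discriminant

lemma exists_one : ∃ E : Discriminant X, E.IsOne := by
  obtain ⟨B, hB⟩ := BilinearForm.exists_of_frames (M := structureModule X)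
    (D := fun _ : PUnit.{u + 1} => ⊤) (fun x => ⟨⟨⟩, trivial⟩)
    (fun _ => isBasisOn_structureModule) (fun _ => 1)
    (fun _ _ => ⟨1, by simp [res_unitSection], by simp⟩)
  refine ⟨⟨⟨structureModule X, fun x => ⟨⊤, trivial, _, isBasisOn_structureModule⟩⟩, B, ?_⟩,
    unitSection ⊤, isBasisOn_structureModule, hB ⟨⟩⟩
  refine isSquareModFour_of_frames (D := fun _ : PUnit.{u + 1} => ⊤) (fun x => ⟨⟨⟩, trivial⟩)
    (fun _ => isBasisOn_structureModule) (fun _ => 1) (fun i => ?_)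
    (fun _ _ => ⟨1, by simp [res_unitSection], ?_⟩)
  · rw [hB ⟨⟩]
    simpa using LocallyDvd.zero
  · simpa using LocallyDvd.zero

lemma one_unique {E F : Discriminant X} (hE : E.IsOne) (hF : F.IsOne) : E ≈ F := by
  obtain ⟨e, he, h1⟩ := hE
  obtain ⟨f, hf, h2⟩ := hF
  exact equiv_of_frames (D := fun _ : Unit => ⊤) (fun x => ⟨⟨⟩, trivial⟩) (fun _ => e) (fun _ => f)
    (fun _ => he) (fun _ => hf) (fun _ _ => ⟨1, by simp, by simp⟩) (fun _ => h1.trans h2.symm)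

lemma one_congr {E F : Discriminant X} (hE : E.IsOne) (h : E ≈ F) : F.IsOne := by
  obtain ⟨e, he, h1⟩ := hE
  obtain ⟨φ, hφ⟩ := h
  exact ⟨φ.hom.app _ e, he.map_iso_one φ, by rw [hφ, h1]⟩

/-- On `e ⊗ f` the product form takes the product of the two values, and the product of the two
square roots is a square root modulo `4`. -/
theorem exists_mul (E F : Discriminant X) : ∃ G : Discriminant X, E.IsMul F G := by
  obtain ⟨N, β, hβ, hb⟩ := E.toInvertibleSheaf.exists_tensor F.toInvertibleSheaf
  obtain ⟨D, e, f, hx, he, hf⟩ := E.toInvertibleSheaf.exists_frames₂ F.toInvertibleSheaf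
  have hD : ∀ x, ∃ y, x ∈ D y := fun x => ⟨x, hx x⟩
  have hN := fun x => hb _ _ _ (he x) (hf x)
  obtain ⟨B, hB⟩ := BilinearForm.exists_of_frames hD hN
    (fun x => E.form.app _ (e x) (e x) * F.form.app _ (f x) (f x)) fun x y => by
      obtain ⟨v, hv⟩ := exists_transition_one (e x) (he y)
      obtain ⟨w, hw⟩ := exists_transition_one (f x) (hf y)
      refine ⟨v * w, β.res_app_of_transition hv hw, ?_⟩
      rw [resO_mul, resO_mul, E.form.map_res, E.form.map_res, F.form.map_res, F.form.map_res, hv,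
        hw, BilinearForm.app_smul_smul, BilinearForm.app_smul_smul]
      ring
  have hform : ∀ (U : X.Opens) (x x' : Γ(E.mod, U)) (y y' : Γ(F.mod, U)),
      B.app U (β.app U x y) (β.app U x' y') = E.form.app U x x' * F.form.app U y y' := by
    intro U x x' y y'
    refine sectionO_ext fun z hz => ⟨U ⊓ D z, inf_le_left, ⟨hz, hx z⟩, ?_⟩
    have hE := fun s => (he z).coord_one (inf_le_right : U ⊓ D z ≤ D z) s
    have hF := fun s => (hf z).coord_one (inf_le_right : U ⊓ D z ≤ D z) s
    obtain ⟨a, ha⟩ := hE (res inf_le_left x)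
    obtain ⟨a', ha'⟩ := hE (res inf_le_left x')
    obtain ⟨b, hb⟩ := hF (res inf_le_left y)
    obtain ⟨b', hb'⟩ := hF (res inf_le_left y')
    rw [B.map_res, β.map_res, β.map_res, resO_mul, E.form.map_res, F.form.map_res, ha, ha', hb, hb',
      β.app_smul_smul, β.app_smul_smul, BilinearForm.app_smul_smul, BilinearForm.app_smul_smul,
      BilinearForm.app_smul_smul, ← β.map_res, ← B.map_res, hB, ← E.form.map_res, ← F.form.map_res,
      resO_mul]
    ring
  have hsq : B.IsSquareModFour := by
    obtain ⟨D₁, e₁, t, hx₁, he₁, h4, h2⟩ := E.exists_roots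
    obtain ⟨D₂, e₂, s, hx₂, he₂, h4', h2'⟩ := F.exists_roots
    refine isSquareModFour_of_frames (D := fun x => D₁ x ⊓ D₂ x) (fun x => ⟨x, hx₁ x, hx₂ x⟩)
      (fun x => hb _ _ _ ((he₁ x).restrict_one inf_le_left) ((he₂ x).restrict_one inf_le_right))
      (fun x => resO inf_le_left (t x) * resO inf_le_right (s x)) (fun x => ?_) fun x y => ?_
    -- With `d`, `d'` the values of the forms: `d d' - t² s² = d' (d - t²) + t² (d' - s²)`.
    · have h1 := ((h4 x).restrict (inf_le_left : D₁ x ⊓ D₂ x ≤ D₁ x)).mul_left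
        (F.form.app _ (res inf_le_right (e₂ x)) (res inf_le_right (e₂ x)))
      have h1' := ((h4' x).restrict (inf_le_right : D₁ x ⊓ D₂ x ≤ D₂ x)).mul_left
        (resO inf_le_left (t x) ^ 2)
      rw [hform]
      rw [resO_sub, resO_pow, E.form.map_res] at h1
      rw [resO_sub, resO_pow, F.form.map_res] at h1'
      convert h1.add h1' using 1
      ring
    · obtain ⟨v, hv⟩ := exists_transition_one (e₁ x) (he₁ y)
      obtain ⟨w, hw⟩ := exists_transition_one (e₂ x) (he₂ y)
      have l₁ : D₁ x ⊓ D₂ x ⊓ (D₁ y ⊓ D₂ y) ≤ D₁ x ⊓ D₁ y := inf_le_inf inf_le_left inf_le_left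
      have l₂ : D₁ x ⊓ D₂ x ⊓ (D₁ y ⊓ D₂ y) ≤ D₂ x ⊓ D₂ y := inf_le_inf inf_le_right inf_le_right
      refine ⟨resO l₁ v * resO l₂ w, β.res_app_of_transition ?_ ?_, ?_⟩
      · simpa [res_smul] using congrArg (res l₁) hv
      · simpa [res_smul] using congrArg (res l₂) hw
      -- Primes denote the data at `y`: `t s - v w t' s' = s (t - v t') + v t' (s - w s')`.
      · have h1 := ((h2 x y v hv).restrict l₁).mul_left (resO (l₂.trans inf_le_left) (s x))
        have h1' := ((h2' x y w hw).restrict l₂).mul_left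
          (resO l₁ v * resO (l₁.trans inf_le_right) (t y))
        simp only [resO_sub, resO_mul, resO_resO] at h1 h1' ⊢
        convert h1.add h1' using 1
        ring
  exact ⟨⟨N, B, hsq⟩, β, hβ, hform⟩

lemma mul_congr {E F G G' : Discriminant X} (h : E.IsMul F G) (hG : G ≈ G') : E.IsMul F G' := by
  obtain ⟨β, hβ, hf⟩ := h
  obtain ⟨φ, hφ⟩ := hG
  exact ⟨β.comp φ.hom, hβ.comp_iso φ, fun U x x' y y' => by
    rw [Pairing.comp_app, Pairing.comp_app, hφ, hf]⟩

theorem mul_unique {E F G E' F' G' : Discriminant X} (h : E.IsMul F G) (h' : E'.IsMul F' G')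
    (hE : E ≈ E') (hF : F ≈ F') : G ≈ G' := by
  obtain ⟨β, hβ, hf⟩ := h
  obtain ⟨β', hβ', hf'⟩ := h'
  obtain ⟨φ, hφ⟩ := hE
  obtain ⟨ψ, hψ⟩ := hF
  obtain ⟨D, e, f, hx, he, hf⟩ := E.toInvertibleSheaf.exists_frames₂ F.toInvertibleSheaf
  refine equiv_of_frames (fun x => ⟨x, hx x⟩) (fun x => β.app _ (e x) (f x))
    (fun x => β'.app _ (φ.hom.app _ (e x)) (ψ.hom.app _ (f x)))
    (fun x => hβ.isBasisOn (he x) (hf x))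
    (fun x => Pairing.IsTensor.isBasisOn (L := E'.toInvertibleSheaf) (M := F'.toInvertibleSheaf) hβ'
      ((he x).map_iso_one φ) ((hf x).map_iso_one ψ)) (fun x y => ?_) fun x => ?_
  · obtain ⟨v, hv⟩ := exists_transition_one (e x) (he y)
    obtain ⟨w, hw⟩ := exists_transition_one (f x) (hf y)
    refine ⟨v * w, β.res_app_of_transition hv hw, β'.res_app_of_transition ?_ ?_⟩
    · rw [← Hom.app_res, ← Hom.app_res, hv, Scheme.Modules.Hom.app_smul]
    · rw [← Hom.app_res, ← Hom.app_res, hw, Scheme.Modules.Hom.app_smul]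
  · simp only [*]

lemma mul_comm {E F G : Discriminant X} (h : E.IsMul F G) : F.IsMul E G := by
  obtain ⟨β, hβ, hf⟩ := h
  exact ⟨β.flip, hβ.flip, fun U y y' x x' => by
    rw [Pairing.flip_app, Pairing.flip_app, hf, _root_.mul_comm]⟩

theorem mul_assoc {E F G EF FG H H' : Discriminant X} (h₁ : E.IsMul F EF) (h₂ : EF.IsMul G H)
    (h₃ : F.IsMul G FG) (h₄ : E.IsMul FG H') : H ≈ H' := by
  obtain ⟨β₁, t₁, f₁⟩ := h₁
  obtain ⟨β₂, t₂, f₂⟩ := h₂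
  obtain ⟨β₃, t₃, f₃⟩ := h₃
  obtain ⟨β₄, t₄, f₄⟩ := h₄
  obtain ⟨D, e, f, g, hx, he, hf, hg⟩ :=
    E.toInvertibleSheaf.exists_frames₃ F.toInvertibleSheaf G.toInvertibleSheaf
  refine equiv_of_frames (fun x => ⟨x, hx x⟩) (fun x => β₂.app _ (β₁.app _ (e x) (f x)) (g x))
    (fun x => β₄.app _ (e x) (β₃.app _ (f x) (g x)))
    (fun x => t₂.isBasisOn (L := EF.toInvertibleSheaf) (t₁.isBasisOn (he x) (hf x)) (hg x))
    (fun x => t₄.isBasisOn (M := FG.toInvertibleSheaf) (he x) (t₃.isBasisOn (hf x) (hg x)))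
    (fun x y => ?_) fun x => ?_
  · obtain ⟨v, hv⟩ := exists_transition_one (e x) (he y)
    obtain ⟨w, hw⟩ := exists_transition_one (f x) (hf y)
    obtain ⟨r, hr⟩ := exists_transition_one (g x) (hg y)
    exact ⟨v * w * r, β₂.res_app_of_transition (β₁.res_app_of_transition hv hw) hr,
      _root_.mul_assoc v w r ▸ β₄.res_app_of_transition hv (β₃.res_app_of_transition hw hr)⟩
  · rw [f₂, f₁, f₄, f₃, _root_.mul_assoc]

theorem one_mul {E F G : Discriminant X} (hE : E.IsOne) (h : E.IsMul F G) : G ≈ F := by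
  obtain ⟨e, he, h1⟩ := hE
  obtain ⟨β, hβ, hf⟩ := h
  obtain ⟨D, f, hx, hf'⟩ := F.toInvertibleSheaf.exists_frames
  refine equiv_of_frames (fun x => ⟨x, hx x⟩) (fun x => β.app _ (res le_top e) (f x)) f
    (fun x => hβ.isBasisOn (L := E.toInvertibleSheaf) (he.restrict_one _) (hf' x)) hf'
    (fun x y => ?_) fun x => ?_
  · obtain ⟨w, hw⟩ := exists_transition_one (f x) (hf' y)
    refine ⟨w, ?_, hw⟩
    have := β.res_app_of_transition (e := res le_top e) (e' := res le_top e) (v := 1)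
      (D := D x) (D' := D y) (by simp) hw
    rwa [_root_.one_mul] at this
  · rw [hf, ← E.form.map_res, h1, resO_one, _root_.one_mul]

variable {f : X ⟶ Y}

theorem exists_pull (E : Discriminant Y) : ∃ E' : Discriminant X, E.IsPull f E' := by
  obtain ⟨L, η, hη, hb⟩ := E.toInvertibleSheaf.exists_pull (f := f)
  obtain ⟨D, e, t, hx, he, h4, h2⟩ := E.exists_roots
  have hD : ∀ y, ∃ z, y ∈ D z := fun y => ⟨y, hx y⟩
  have hN := fun y => hb _ _ (he y)
  obtain ⟨B, hB⟩ := BilinearForm.exists_of_frames (preimage_cover hD) hN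
    (fun y => f.app _ (E.form.app _ (e y) (e y))) fun y z => by
      obtain ⟨v, hv⟩ := exists_transition_one (e y) (he z)
      refine ⟨_, pullSection_transition η hv, ?_⟩
      have : resO inf_le_left (E.form.app _ (e y) (e y)) =
          v ^ 2 * resO inf_le_right (E.form.app _ (e z) (e z)) := by
        rw [E.form.map_res, E.form.map_res, hv, BilinearForm.app_smul_smul, sq]
      have := congrArg (f.app _) this
      rw [map_mul, map_pow, app_resO, app_resO] at this
      exact this
  have hsq : B.IsSquareModFour := by
    refine isSquareModFour_of_frames (ι := X) (D := fun x => f ⁻¹ᵁ D (f x))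
      (fun x => ⟨x, hx (f x)⟩) (fun x => hN (f x)) (fun x => f.app _ (t (f x))) (fun x => ?_)
      fun x x' => ?_
    · rw [hB, ← map_pow, ← map_sub]
      exact (h4 (f x)).app
    · obtain ⟨v, hv⟩ := exists_transition_one (e (f x)) (he (f x'))
      refine ⟨_, pullSection_transition η hv, ?_⟩
      have := (h2 _ _ v hv).app (f := f)
      rw [map_sub, map_mul, app_resO, app_resO] at this
      exact this
  refine ⟨⟨L, B, hsq⟩, η, hη, fun V x y => ?_⟩
  refine sectionO_ext fun z hz => ?_
  have hl : V ⊓ D (f z) ≤ V := inf_le_left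
  refine ⟨f ⁻¹ᵁ (V ⊓ D (f z)), f.preimage_mono hl, ⟨hz, hx (f z)⟩, ?_⟩
  obtain ⟨a, ha⟩ := (he (f z)).coord_one (inf_le_right : V ⊓ D (f z) ≤ D (f z)) (res hl x)
  obtain ⟨b, hb⟩ := (he (f z)).coord_one (inf_le_right : V ⊓ D (f z) ≤ D (f z)) (res hl y)
  rw [← app_resO hl, B.map_res, E.form.map_res, ← pullSection_res hl, ← pullSection_res hl, ha, hb,
    BilinearForm.app_smul_smul, pullSection_smul, pullSection_smul, BilinearForm.app_smul_smul,
    pullSection_res, ← B.map_res, hB, ← E.form.map_res, map_mul, map_mul, app_resO]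

lemma pull_congr {E : Discriminant Y} {F F' : Discriminant X} (h : E.IsPull f F) (hF : F ≈ F') :
    E.IsPull f F' := by
  obtain ⟨η, hη, hf⟩ := h
  obtain ⟨φ, hφ⟩ := hF
  exact ⟨_, hη.comp_iso φ, fun V x y => by
    rw [pullSection_comp_map, pullSection_comp_map, hφ, hf]⟩

theorem pull_unique {E E' : Discriminant Y} {F F' : Discriminant X} (hE : E ≈ E')
    (h : E.IsPull f F) (h' : E'.IsPull f F') : F ≈ F' := by
  obtain ⟨φ, hφ⟩ := hE
  obtain ⟨η, hη, hf⟩ := h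
  obtain ⟨η', hη', hf'⟩ := h'
  obtain ⟨D, e, hx, he⟩ := E.toInvertibleSheaf.exists_frames
  refine equiv_of_frames (preimage_cover fun y => ⟨y, hx y⟩) (fun y => pullSection η (e y))
    (fun y => pullSection η' (φ.hom.app _ (e y)))
    (fun y => hη.isBasisOn (he y))
    (fun y => hη'.isBasisOn (L := E'.toInvertibleSheaf) ((he y).map_iso_one φ))
    (fun y z => ?_) fun y => ?_
  · obtain ⟨v, hv⟩ := exists_transition_one (e y) (he z)
    refine ⟨_, pullSection_transition η hv, pullSection_transition η' ?_⟩
    rw [← Hom.app_res, ← Hom.app_res, hv, Scheme.Modules.Hom.app_smul]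
  · rw [hf, hf', hφ]

lemma pull_one {E : Discriminant Y} {F : Discriminant X} (hE : E.IsOne) (h : E.IsPull f F) :
    F.IsOne := by
  obtain ⟨e, he, h1⟩ := hE
  obtain ⟨η, hη, hf⟩ := h
  refine ⟨pullSection η e, hη.isBasisOn (L := E.toInvertibleSheaf) he, ?_⟩
  refine (hf ⊤ e e).trans ?_
  rw [h1, map_one]
  rfl

theorem pull_mul {E F G : Discriminant Y} {E' F' G' H : Discriminant X} (h : E.IsMul F G)
    (hE : E.IsPull f E') (hF : F.IsPull f F') (hG : G.IsPull f G') (h' : E'.IsMul F' H) :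
    G' ≈ H := by
  obtain ⟨β, hβ, hf⟩ := h
  obtain ⟨β', hβ', hf'⟩ := h'
  obtain ⟨η₁, t₁, f₁⟩ := hE
  obtain ⟨η₂, t₂, f₂⟩ := hF
  obtain ⟨η₃, t₃, f₃⟩ := hG
  obtain ⟨D, e, k, hx, he, hk⟩ := E.toInvertibleSheaf.exists_frames₂ F.toInvertibleSheaf
  refine equiv_of_frames (preimage_cover fun y => ⟨y, hx y⟩)
    (fun y => pullSection η₃ (β.app _ (e y) (k y)))
    (fun y => β'.app _ (pullSection η₁ (e y)) (pullSection η₂ (k y)))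
    (fun y => t₃.isBasisOn (L := G.toInvertibleSheaf) (hβ.isBasisOn (he y) (hk y)))
    (fun y => Pairing.IsTensor.isBasisOn (L := E'.toInvertibleSheaf) (M := F'.toInvertibleSheaf) hβ'
      (t₁.isBasisOn (he y)) (t₂.isBasisOn (hk y)))
    (fun y z => ?_) fun y => ?_
  · obtain ⟨v, hv⟩ := exists_transition_one (e y) (he z)
    obtain ⟨w, hw⟩ := exists_transition_one (k y) (hk z)
    refine ⟨_, pullSection_transition η₃ (β.res_app_of_transition hv hw), ?_⟩
    rw [map_mul]
    exact β'.res_app_of_transition (pullSection_transition η₁ hv) (pullSection_transition η₂ hw)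
  · rw [f₃, hf, hf', f₁, f₂, map_mul]

lemma pull_id (E : Discriminant X) : E.IsPull (𝟙 X) E := by
  obtain ⟨D, e, hx, he⟩ := E.toInvertibleSheaf.exists_frames
  refine ⟨pullId E.mod, isPullback_of_frames_one (fun x => ⟨x, hx x⟩) he he, fun V x y => ?_⟩
  rw [Scheme.Hom.id_app]
  rfl

lemma pull_comp {g : Y ⟶ Z} {E : Discriminant Z} {F : Discriminant Y} {G : Discriminant X}
    (h : E.IsPull g F) (h' : F.IsPull f G) : E.IsPull (f ≫ g) G := by
  obtain ⟨η, t, hf⟩ := h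
  obtain ⟨η', t', hf'⟩ := h'
  obtain ⟨D, e, hx, he⟩ := E.toInvertibleSheaf.exists_frames
  refine ⟨pullComp η η', isPullback_of_frames_one (fun x => ⟨x, hx x⟩) he fun x =>
    t'.isBasisOn (L := F.toInvertibleSheaf) (t.isBasisOn (he x)), fun V x y => ?_⟩
  rw [Scheme.Hom.comp_app]
  exact (hf' _ _ _).trans (congrArg (f.app _) (hf V x y))

end Discriminant

end

/-! ### Quadratic algebras: local generators, equations and gluing -/

section

variable {X Y Z : Scheme.{u}} {M N K : X.Modules} {U V W : X.Opens}

/-- The product of two linear combinations of `1` and a root of `x² = t x - n`. -/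
lemma bilin_comb {R A : Type*} [CommRing R] [AddCommGroup A] [Module R A] (f : A →ₗ[R] A →ₗ[R] A)
    {o x : A} {t n : R} (h1 : f o o = o) (h2 : f o x = x) (h3 : f x o = x)
    (h4 : f x x = t • x - n • o) (a b c d : R) :
    f (a • o + b • x) (c • o + d • x) =
      (a * c - b * d * n) • o + (a * d + b * c + b * d * t) • x := by
  simp only [map_add, LinearMap.add_apply, map_smul, LinearMap.smul_apply, h1, h2, h3, h4]
  module

lemma isBasisOn_two_of {p q : Γ(M, U)} (hex : ∀ (V : X.Opens) (h : V ≤ U) (s : Γ(M, V)),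
      ∃ a b : Γ(X, V), s = a • res h p + b • res h q)
    (hinj : ∀ (V : X.Opens) (h : V ≤ U) (a b : Γ(X, V)), a • res h p + b • res h q = 0 →
      a = 0 ∧ b = 0) : IsBasisOn U ![p, q] := by
  intro V h s
  obtain ⟨a, b, hab⟩ := hex V h s
  refine ⟨![a, b], by simpa using hab, fun c hc => ?_⟩
  have h0 : (c 0 - a) • res h p + (c 1 - b) • res h q = 0 := by
    simp only [Fin.sum_univ_two, Matrix.cons_val_zero, Matrix.cons_val_one] at hc
    rw [sub_smul, sub_smul, ← sub_eq_zero.mpr (hc.symm.trans hab)]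
    module
  obtain ⟨h1, h2⟩ := hinj V h _ _ h0
  ext i
  fin_cases i
  · exact sub_eq_zero.mp h1
  · exact sub_eq_zero.mp h2

lemma IsBasisOn.coord_two {p q : Γ(M, U)} (hb : IsBasisOn U ![p, q]) (h : V ≤ U) (s : Γ(M, V)) :
    ∃ a b : Γ(X, V), s = a • res h p + b • res h q := by
  obtain ⟨c, hc⟩ := hb.exists_coords h s
  exact ⟨c 0, c 1, by simpa using hc⟩

lemma IsBasisOn.cancel_two {p q : Γ(M, U)} (hb : IsBasisOn U ![p, q]) (h : V ≤ U)
    {a b c d : Γ(X, V)} (H : a • res h p + b • res h q = c • res h p + d • res h q) :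
    a = c ∧ b = d := by
  have := hb.coords_ext h (c := ![a, b]) (d := ![c, d]) (by simpa using H)
  exact ⟨congrFun this 0, congrFun this 1⟩

namespace QuadraticAlgebra

variable {S T P : QuadraticAlgebra X}

lemma IsGen.restrict {x : Γ(S.mod, U)} (hx : S.IsGen x) (h : V ≤ U) : S.IsGen (res h x) := by
  have := IsBasisOn.restrict hx h
  unfold IsGen
  convert this using 1
  ext i
  fin_cases i
  · exact (S.one_res h).symm
  · rfl

lemma IsGen.coord {x : Γ(S.mod, U)} (hx : S.IsGen x) (s : Γ(S.mod, U)) :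
    ∃ a b : Γ(X, U), s = a • S.one U + b • x := by
  obtain ⟨a, b, h⟩ := IsBasisOn.coord_two hx le_rfl s
  exact ⟨a, b, by simpa using h⟩

lemma IsGen.cancel {x : Γ(S.mod, U)} (hx : S.IsGen x) {a b c d : Γ(X, U)}
    (H : a • S.one U + b • x = c • S.one U + d • x) : a = c ∧ b = d :=
  IsBasisOn.cancel_two hx le_rfl (by simpa using H)

lemma IsGen.exists_equation {x : Γ(S.mod, U)} (hx : S.IsGen x) :
    ∃ t n : Γ(X, U), S.HasEquation x t n := by
  obtain ⟨a, b, h⟩ := hx.coord (S.mul.app U x x)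
  refine ⟨b, -a, h.trans ?_⟩
  module

lemma IsGen.equation_unique {x : Γ(S.mod, U)} (hx : S.IsGen x) {t n t' n' : Γ(X, U)}
    (h : S.HasEquation x t n) (h' : S.HasEquation x t' n') : t = t' ∧ n = n' := by
  have := hx.cancel (a := -n) (b := t) (c := -n') (d := t') (by
    have := h.symm.trans h'
    rw [neg_smul, neg_smul, neg_add_eq_sub, neg_add_eq_sub, this])
  exact ⟨this.2, neg_injective this.1⟩

lemma HasEquation.restrict {x : Γ(S.mod, U)} {t n : Γ(X, U)} (hx : S.HasEquation x t n)
    (h : V ≤ U) : S.HasEquation (res h x) (resO h t) (resO h n) := by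
  have := congrArg (res h) hx
  rwa [S.mul.map_res, res_sub, res_smul, res_smul, S.one_res] at this

/-- The product in the basis `1, x`. -/
lemma HasEquation.mul_comb {x : Γ(S.mod, U)} {t n : Γ(X, U)} (hx : S.HasEquation x t n)
    (a b c d : Γ(X, U)) :
    S.mul.app U (a • S.one U + b • x) (c • S.one U + d • x) =
      (a * c - b * d * n) • S.one U + (a * d + b * c + b * d * t) • x :=
  bilin_comb _ (S.one_mul _ _) (S.one_mul _ _) (S.mul_one _ _) hx a b c d

/-- The new coefficients are the trace and the norm of `v x + r`. -/
lemma HasEquation.transition {x : Γ(S.mod, U)} {t n : Γ(X, U)} (hx : S.HasEquation x t n)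
    (v r : Γ(X, U)) :
    S.HasEquation (v • x + r • S.one U) (v * t + 2 * r) (v * t * r + v ^ 2 * n + r ^ 2) := by
  unfold HasEquation
  rw [add_comm, hx.mul_comb]
  module

/-- A local basis `b 0, b 1` need not contain `1`. Write `1 = a b₀ + c b₁`, and let `p`, `q` be the
`b₀`-coordinates of `b₀ b₀` and `b₁ b₀`. Comparing `b₀`-coordinates in `1 b₀ = b₀` gives `a p + c q
= 1`, so `(a, c)` is unimodular and `-q b₀ + p b₁` completes `1` to a basis of determinant one. -/
theorem exists_gen (S : QuadraticAlgebra X) (z : X) :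
    ∃ (U : X.Opens) (x : Γ(S.mod, U)), z ∈ U ∧ S.IsGen x := by
  obtain ⟨U, hz, b, hb⟩ := S.rank_two z
  have hb' : IsBasisOn U ![b 0, b 1] := by
    convert hb using 1
    ext i
    fin_cases i <;> rfl
  obtain ⟨a, c, hac⟩ := hb'.coord_two le_rfl (S.one U)
  obtain ⟨p, p', hp⟩ := hb'.coord_two le_rfl (S.mul.app U (b 0) (b 0))
  obtain ⟨q, q', hq⟩ := hb'.coord_two le_rfl (S.mul.app U (b 1) (b 0))
  rw [res_self, res_self] at hac hp hq
  have hdet : a * p + c * q = 1 := by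
    have h := S.one_mul U (b 0)
    rw [hac, map_add, LinearMap.add_apply, map_smul, map_smul, LinearMap.smul_apply,
      LinearMap.smul_apply, hp, hq] at h
    refine (hb'.cancel_two le_rfl (a := a * p + c * q) (b := a * p' + c * q') (c := 1) (d := 0)
      ?_).1
    rw [res_self, res_self, one_smul, zero_smul, add_zero]
    refine Eq.trans ?_ h
    module
  refine ⟨U, -q • b 0 + p • b 1, hz, isBasisOn_two_of (fun V h s => ?_) fun V h d e H => ?_⟩
  · obtain ⟨d, e, rfl⟩ := hb'.coord_two h s
    have hdet' := congrArg (resO h) hdet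
    simp only [resO_add, resO_mul, resO_one] at hdet'
    -- Cramer's rule for the matrix with rows `(a, c)` and `(-q, p)`, whose determinant is one.
    refine ⟨d * resO h p + e * resO h q, e * resO h a - d * resO h c, ?_⟩
    rw [hac, res_add, res_add, res_smul, res_smul, res_smul, res_smul, resO_neg]
    match_scalars
    · linear_combination (-d) * hdet'
    · linear_combination (-e) * hdet'
  · have hdet' := congrArg (resO h) hdet
    simp only [resO_add, resO_mul, resO_one] at hdet'
    rw [hac, res_add, res_add, res_smul, res_smul, res_smul, res_smul, resO_neg] at H
    obtain ⟨h1, h2⟩ := hb'.cancel_two h (a := d * resO h a - e * resO h q)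
      (b := d * resO h c + e * resO h p) (c := 0) (d := 0) (by
        rw [zero_smul, zero_smul, zero_add, ← H]
        module)
    constructor
    · linear_combination (-d) * hdet' + resO h p * h1 + resO h q * h2
    · linear_combination (-e) * hdet' - resO h c * h1 + resO h a * h2

lemma exists_gens (S : QuadraticAlgebra X) :
    ∃ (D : X → X.Opens) (x : ∀ z, Γ(S.mod, D z)), (∀ z, z ∈ D z) ∧ ∀ z, S.IsGen (x z) := by
  choose D x hz hx using S.exists_gen
  exact ⟨D, x, hz, hx⟩

lemma exists_gens₂ (S T : QuadraticAlgebra X) :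
    ∃ (D : X → X.Opens) (x : ∀ z, Γ(S.mod, D z)) (y : ∀ z, Γ(T.mod, D z)), (∀ z, z ∈ D z) ∧
      (∀ z, S.IsGen (x z)) ∧ ∀ z, T.IsGen (y z) := by
  obtain ⟨D, x, hz, hx⟩ := S.exists_gens
  obtain ⟨D', y, hz', hy⟩ := T.exists_gens
  exact ⟨fun z => D z ⊓ D' z, fun z => res inf_le_left (x z), fun z => res inf_le_right (y z),
    fun z => ⟨hz z, hz' z⟩, fun z => (hx z).restrict _, fun z => (hy z).restrict _⟩

lemma exists_gens₃ (S T P : QuadraticAlgebra X) :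
    ∃ (D : X → X.Opens) (x : ∀ z, Γ(S.mod, D z)) (y : ∀ z, Γ(T.mod, D z))
      (w : ∀ z, Γ(P.mod, D z)), (∀ z, z ∈ D z) ∧
      (∀ z, S.IsGen (x z)) ∧ (∀ z, T.IsGen (y z)) ∧ ∀ z, P.IsGen (w z) := by
  obtain ⟨D, x, y, hz, hx, hy⟩ := S.exists_gens₂ T
  obtain ⟨D', w, hz', hw⟩ := P.exists_gens
  exact ⟨fun z => D z ⊓ D' z, fun z => res inf_le_left (x z), fun z => res inf_le_left (y z),
    fun z => res inf_le_right (w z), fun z => ⟨hz z, hz' z⟩, fun z => (hx z).restrict _,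
    fun z => (hy z).restrict _, fun z => (hw z).restrict _⟩

/-- Around every point, and inside a given open set, there is a generator. -/
lemma exists_gen_le (S : QuadraticAlgebra X) {z : X} (hz : z ∈ U) :
    ∃ (W : X.Opens) (_ : W ≤ U) (x : Γ(S.mod, W)), z ∈ W ∧ S.IsGen x := by
  obtain ⟨V, x, hzV, hx⟩ := S.exists_gen z
  exact ⟨U ⊓ V, inf_le_left, res inf_le_right x, ⟨hz, hzV⟩, hx.restrict _⟩

lemma IsGen.exists_transition {x : Γ(S.mod, U)} {y : Γ(S.mod, V)} (hy : S.IsGen y) :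
    ∃ v r : Γ(X, U ⊓ V), res inf_le_left x = v • res inf_le_right y + r • S.one _ := by
  obtain ⟨a, b, h⟩ := (hy.restrict (inf_le_right : U ⊓ V ≤ V)).coord (res inf_le_left x)
  exact ⟨b, a, h.trans (add_comm _ _)⟩

lemma IsGen.transition_unique {y : Γ(S.mod, U)} (hy : S.IsGen y) {v r v' r' : Γ(X, U)}
    (H : v • y + r • S.one U = v' • y + r' • S.one U) : v = v' ∧ r = r' := by
  obtain ⟨h1, h2⟩ := hy.cancel (a := r) (b := v) (c := r') (d := v') (by rw [add_comm, H, add_comm])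
  exact ⟨h2, h1⟩

lemma IsGen.map_iso {x : Γ(S.mod, U)} (hx : S.IsGen x) (e : S.mod ≅ T.mod)
    (h : e.hom.app U (S.one U) = T.one U) : T.IsGen (e.hom.app U x) := by
  have := IsBasisOn.map_iso hx e
  unfold IsGen
  convert this using 1
  ext i
  fin_cases i
  · exact h.symm
  · rfl

lemma HasEquation.map {x : Γ(S.mod, U)} {t n : Γ(X, U)} (hx : S.HasEquation x t n)
    (e : S.mod ⟶ T.mod) (h1 : e.app U (S.one U) = T.one U)
    (h2 : e.app U (S.mul.app U x x) = T.mul.app U (e.app U x) (e.app U x)) :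
    T.HasEquation (e.app U x) t n := by
  unfold HasEquation
  rw [← h2, hx, map_sub, Scheme.Modules.Hom.app_smul, Scheme.Modules.Hom.app_smul, h1]

/-- Matching local generators define an isomorphism of quadratic algebras. -/
theorem equiv_of_frames {ι : Type*} {D : ι → X.Opens} (hD : ∀ z, ∃ i, z ∈ D i)
    (x : ∀ i, Γ(S.mod, D i)) (y : ∀ i, Γ(T.mod, D i)) (hx : ∀ i, S.IsGen (x i))
    (hy : ∀ i, T.IsGen (y i))
    (H : ∀ i j, ∃ v r : Γ(X, D i ⊓ D j),
      res inf_le_left (x i) = v • res inf_le_right (x j) + r • S.one _ ∧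
      res inf_le_left (y i) = v • res inf_le_right (y j) + r • T.one _)
    (hxy : ∀ i, ∃ t n : Γ(X, D i), S.HasEquation (x i) t n ∧ T.HasEquation (y i) t n) : S ≈ T := by
  obtain ⟨φ, hφ⟩ := exists_iso hD hx hy fun i j => by
    obtain ⟨v, r, h1, h2⟩ := H i j
    -- The rows express `1` and `x i` in the basis `1, x j`; the first is trivial because `1` is
    -- global.
    refine ⟨![![1, 0], ![r, v]], fun a => ?_, fun a => ?_⟩
    · fin_cases a
      · simp [S.one_res]
      · simpa [S.one_res, add_comm] using h1
    · fin_cases a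
      · simp [T.one_res]
      · simpa [T.one_res, add_comm] using h2
  have h1 : ∀ i, φ.hom.app _ (S.one (D i)) = T.one (D i) := fun i => hφ i 0
  have h2 : ∀ i, φ.hom.app _ (x i) = y i := fun i => hφ i 1
  have h1' : ∀ i W (h : W ≤ D i), φ.hom.app _ (S.one W) = T.one W := fun i W h => by
    rw [← S.one_res h, ← T.one_res h, Hom.app_res, h1]
  refine ⟨φ, fun U => ⟨section_ext fun z hz => ?_, fun s s' => section_ext fun z hz => ?_⟩⟩
  · obtain ⟨i, hi⟩ := hD z
    exact ⟨U ⊓ D i, inf_le_left, ⟨hz, hi⟩, by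
      rw [← Hom.app_res, S.one_res, T.one_res, h1' i _ inf_le_right]⟩
  · obtain ⟨i, hi⟩ := hD z
    refine ⟨U ⊓ D i, inf_le_left, ⟨hz, hi⟩, ?_⟩
    have hg := (hx i).restrict (inf_le_right : U ⊓ D i ≤ D i)
    obtain ⟨a, b, hs⟩ := hg.coord (res inf_le_left s)
    obtain ⟨c, d, hs'⟩ := hg.coord (res inf_le_left s')
    obtain ⟨t, n, ht, hn⟩ := hxy i
    have h3 := ht.restrict (inf_le_right : U ⊓ D i ≤ D i)
    have h4 := hn.restrict (inf_le_right : U ⊓ D i ≤ D i)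
    have e1 : ∀ a b : Γ(X, U ⊓ D i), φ.hom.app _ (a • S.one _ + b • res inf_le_right (x i)) =
        a • T.one _ + b • res inf_le_right (y i) := fun a b => by
      rw [map_add, Scheme.Modules.Hom.app_smul, Scheme.Modules.Hom.app_smul, h1' i _ inf_le_right,
        Hom.app_res, h2]
    rw [← Hom.app_res, S.mul.map_res, T.mul.map_res, ← Hom.app_res, ← Hom.app_res, hs, hs',
      h3.mul_comb, e1, e1, e1, h4.mul_comb]

end QuadraticAlgebra

section Frames

variable {ι : Type*} {D : ι → X.Opens} {one : ∀ U : X.Opens, Γ(M, U)} {x : ∀ i, Γ(M, D i)}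
  {t n : ∀ i, Γ(X, D i)}

/-- The hypotheses on `t` and `n` say that they are the trace and norm of `v x j + r`, so expanding
`(v x j + r)²` by the table at `j` gives the table at `i`. This is the only nontrivial entry of the
compatibility. -/
lemma exists_quadratic_mul (hD : ∀ z, ∃ i, z ∈ D i)
    (one_res : ∀ {U V : X.Opens} (h : V ≤ U), res h (one U) = one V)
    (basis : ∀ i, IsBasisOn (D i) ![one (D i), x i])
    (v r : ∀ i j, Γ(X, D i ⊓ D j))
    (hfr : ∀ i j, res inf_le_left (x i) = v i j • res inf_le_right (x j) + r i j • one _)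
    (ht : ∀ i j, resO inf_le_left (t i) = v i j * resO inf_le_right (t j) + 2 * r i j)
    (hn : ∀ i j, resO inf_le_left (n i) = v i j * resO inf_le_right (t j) * r i j +
      v i j ^ 2 * resO inf_le_right (n j) + r i j ^ 2) :
    ∃ m : Pairing M M M, ∀ i, m.app _ (one (D i)) (one (D i)) = one (D i) ∧
      m.app _ (one (D i)) (x i) = x i ∧ m.app _ (x i) (one (D i)) = x i ∧
      m.app _ (x i) (x i) = t i • x i - n i • one (D i) := by
  obtain ⟨m, hm⟩ := exists_pairing hD basis basis
    (fun i => ![![one (D i), x i], ![x i, t i • x i - n i • one (D i)]]) fun i j => by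
      have hA : ∀ a, res inf_le_left (![one (D i), x i] a) =
          ∑ e, (![![1, 0], ![r i j, v i j]] : Fin 2 → Fin 2 → Γ(X, D i ⊓ D j)) a e •
            res inf_le_right (![one (D j), x j] e) := by
        intro a
        rw [Fin.sum_univ_two]
        fin_cases a
        · simp [one_res]
        · simpa [one_res] using (hfr i j).trans (add_comm _ _)
      refine ⟨_, _, hA, hA, fun a a' => ?_⟩
      rw [Fin.sum_univ_two, Fin.sum_univ_two, Fin.sum_univ_two]
      fin_cases a <;> fin_cases a'
      · simp [one_res]
      · simp only [Fin.zero_eta, Fin.mk_one, Matrix.cons_val_zero, Matrix.cons_val_one, hfr,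
          one_res]
        module
      · simp only [Fin.zero_eta, Fin.mk_one, Matrix.cons_val_zero, Matrix.cons_val_one, hfr,
          one_res]
        module
      · simp only [Fin.mk_one, Matrix.cons_val_zero, Matrix.cons_val_one, res_sub,
          res_smul, hfr, one_res, ht, hn]
        module
  exact ⟨m, fun i => ⟨hm i 0 0, hm i 0 1, hm i 1 0, hm i 1 1⟩⟩

/-- The quadratic algebra with prescribed local multiplication tables. -/
def QuadraticAlgebra.ofFrames (hD : ∀ z, ∃ i, z ∈ D i)
    (one_res : ∀ {U V : X.Opens} (h : V ≤ U), res h (one U) = one V)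
    (basis : ∀ i, IsBasisOn (D i) ![one (D i), x i]) (m : Pairing M M M)
    (hm : ∀ i, m.app _ (one (D i)) (one (D i)) = one (D i) ∧
      m.app _ (one (D i)) (x i) = x i ∧ m.app _ (x i) (one (D i)) = x i ∧
      m.app _ (x i) (x i) = t i • x i - n i • one (D i)) : QuadraticAlgebra X :=
  -- Once products of combinations of `1` and `x i` have this closed form, the ring axioms are
  -- polynomial identities in the coordinates.
  have comb : ∀ i W (h : W ≤ D i) (a b a' b' : Γ(X, W)),
      m.app W (a • one W + b • res h (x i)) (a' • one W + b' • res h (x i)) =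
        (a * a' - b * b' * resO h (n i)) • one W +
          (a * b' + b * a' + b * b' * resO h (t i)) • res h (x i) := by
    intro i W h a b a' b'
    refine bilin_comb _ ?_ ?_ ?_ ?_ a b a' b'
    · rw [← one_res h, ← m.map_res, (hm i).1]
    · rw [← one_res h, ← m.map_res, (hm i).2.1]
    · rw [← one_res h, ← m.map_res, (hm i).2.2.1]
    · rw [← one_res h, ← m.map_res, (hm i).2.2.2, res_sub, res_smul, res_smul]
  have loc : ∀ {U : X.Opens} {s s' : Γ(M, U)},
      (∀ i W (hU : W ≤ U) (_ : W ≤ D i), res hU s = res hU s') → s = s' := by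
    intro U s t h
    refine section_ext fun z hz => ?_
    obtain ⟨i, hi⟩ := hD z
    exact ⟨U ⊓ D i, inf_le_left, ⟨hz, hi⟩, h i _ _ inf_le_right⟩
  have coord : ∀ i W (h : W ≤ D i) (s : Γ(M, W)), ∃ a b : Γ(X, W),
      s = a • one W + b • res h (x i) := by
    intro i W h s
    obtain ⟨a, b, hs⟩ := (basis i).coord_two h s
    exact ⟨a, b, by rw [hs, one_res]⟩
  { mod := M
    mul := m
    one := one
    one_res := one_res
    one_mul := fun U s => loc fun i W hU hi => by
      obtain ⟨a, b, hs⟩ := coord i W hi (res hU s)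
      have := comb i W hi 1 0 a b
      rw [zero_smul, add_zero, one_smul] at this
      rw [m.map_res, one_res, hs, this]
      module
    mul_one := fun U s => loc fun i W hU hi => by
      obtain ⟨a, b, hs⟩ := coord i W hi (res hU s)
      have := comb i W hi a b 1 0
      rw [zero_smul, add_zero, one_smul] at this
      rw [m.map_res, one_res, hs, this]
      module
    mul_assoc := fun U p q s => loc fun i W hU hi => by
      obtain ⟨a, b, hp⟩ := coord i W hi (res hU p)
      obtain ⟨a', b', hq⟩ := coord i W hi (res hU q)
      obtain ⟨a'', b'', hs⟩ := coord i W hi (res hU s)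
      rw [m.map_res, m.map_res, m.map_res, m.map_res, hp, hq, hs, comb, comb, comb, comb]
      module
    rank_two := fun z => by
      obtain ⟨i, hi⟩ := hD z
      exact ⟨D i, hi, _, basis i⟩ }

end Frames

/-- Gluing of quadratic algebras. -/
theorem exists_quadraticAlgebra {ι : Type u} (D : ι → X.Opens) (hD : ∀ x, ∃ i, x ∈ D i)
    (v r : ∀ i j, Γ(X, D i ⊓ D j)) (t n : ∀ i, Γ(X, D i))
    (v_self : ∀ i, v i i = 1) (r_self : ∀ i, r i i = 0)
    (v_mul : ∀ i j k,
      resO (inf_le_left : D i ⊓ D j ⊓ D k ≤ D i ⊓ D j) (v i j) *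
        resO (inf_le_inf_right _ inf_le_right : D i ⊓ D j ⊓ D k ≤ D j ⊓ D k) (v j k) =
      resO (inf_le_inf_right _ inf_le_left : D i ⊓ D j ⊓ D k ≤ D i ⊓ D k) (v i k))
    (r_mul : ∀ i j k,
      resO (inf_le_left : D i ⊓ D j ⊓ D k ≤ D i ⊓ D j) (r i j) +
      resO (inf_le_left : D i ⊓ D j ⊓ D k ≤ D i ⊓ D j) (v i j) *
        resO (inf_le_inf_right _ inf_le_right : D i ⊓ D j ⊓ D k ≤ D j ⊓ D k) (r j k) =
      resO (inf_le_inf_right _ inf_le_left : D i ⊓ D j ⊓ D k ≤ D i ⊓ D k) (r i k))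
    (ht : ∀ i j, resO inf_le_left (t i) = v i j * resO inf_le_right (t j) + 2 * r i j)
    (hn : ∀ i j, resO inf_le_left (n i) = v i j * resO inf_le_right (t j) * r i j +
      v i j ^ 2 * resO inf_le_right (n j) + r i j ^ 2) :
    ∃ (S : QuadraticAlgebra X) (x : ∀ i, Γ(S.mod, D i)), (∀ i, S.IsGen (x i)) ∧
      (∀ i j, res inf_le_left (x i) = v i j • res inf_le_right (x j) + r i j • S.one _) ∧
      ∀ i, S.HasEquation (x i) (t i) (n i) := by
  let c : Cocycle X 2 :=
    { ι := ι
      D := D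
      cover := hD
      -- The affine substitution `x ↦ v x + r` as a triangular matrix in the basis `1, x`; `v_mul`
      -- and `r_mul` are its cocycle identity.
      g := fun i j => ![![1, 0], ![r i j, v i j]]
      g_self := fun i a b => by fin_cases a <;> fin_cases b <;> simp [v_self, r_self]
      g_mul := fun i j k a b => by
        fin_cases a <;> fin_cases b <;> simp [v_mul, r_mul] }
  have hfr : ∀ i j, res inf_le_left (c.frame i 1) =
      v i j • res inf_le_right (c.frame j 1) + r i j • res inf_le_right (c.frame j 0) := by
    intro i j
    have := c.frame_eq i j 1
    rw [Fin.sum_univ_two] at this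
    exact this.trans (add_comm _ _)
  have hfr0 : ∀ i j, res (inf_le_left : D i ⊓ D j ≤ D i) (c.frame i 0) =
      res inf_le_right (c.frame j 0) := by
    intro i j
    have := c.frame_eq i j 0
    rw [Fin.sum_univ_two] at this
    refine this.trans ?_
    change (1 : Γ(X, D i ⊓ D j)) • _ + (0 : Γ(X, D i ⊓ D j)) • _ = _
    rw [one_smul, zero_smul, add_zero]
  -- The first basis vectors agree on overlaps, so they glue to a global section. It is obtained as
  -- a morphism out of `O_X`, whose value at `1` is the unit of the algebra.
  obtain ⟨o, ho⟩ := exists_hom_one (N := c.modules) hD (fun i => isBasisOn_structureModule)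
    (fun i => c.frame i 0) fun i j => ⟨1, by simp [res_unitSection], by
      rw [one_smul]
      exact hfr0 i j⟩
  have one_res : ∀ {U V : X.Opens} (h : V ≤ U),
      res h (o.app U (unitSection U)) = o.app V (unitSection V) := fun h => by
    rw [← Hom.app_res, res_unitSection]
  have basis : ∀ i, IsBasisOn (D i) ![o.app _ (unitSection (D i)), c.frame i 1] := fun i => by
    convert c.isBasisOn_frame i using 1
    ext a
    fin_cases a
    · exact ho i
    · rfl
  have hfr' : ∀ i j, res inf_le_left (c.frame i 1) =
      v i j • res inf_le_right (c.frame j 1) + r i j • o.app _ (unitSection _) := fun i j => by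
    rw [hfr i j, ← ho, one_res]
  obtain ⟨m, hm⟩ := exists_quadratic_mul hD one_res basis v r hfr' ht hn
  exact ⟨QuadraticAlgebra.ofFrames hD one_res basis m hm, fun i => c.frame i 1, basis, hfr',
    fun i => (hm i).2.2.2⟩

end

/-! ### The product of quadratic algebras -/

section

variable {X Y Z : Scheme.{u}} {M N K : X.Modules} {U V W : X.Opens}

namespace QuadraticAlgebra

variable {S T P S' T' P' : QuadraticAlgebra X}

lemma res_transition {x : Γ(S.mod, U)} {y : Γ(S.mod, V)} {v r : Γ(X, U ⊓ V)}
    (H : res inf_le_left x = v • res inf_le_right y + r • S.one _) (h : W ≤ U ⊓ V) :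
    res (h.trans inf_le_left) x = resO h v • res (h.trans inf_le_right) y + resO h r • S.one _ := by
  simpa [res_add, res_smul, S.one_res] using congrArg (res h) H

lemma map_transition {x : Γ(S.mod, U)} {y : Γ(S.mod, V)} {v r : Γ(X, U ⊓ V)}
    (H : res inf_le_left x = v • res inf_le_right y + r • S.one _) (e : S.mod ⟶ T.mod)
    (he : ∀ U, e.app U (S.one U) = T.one U) :
    res inf_le_left (e.app _ x) = v • res inf_le_right (e.app _ y) + r • T.one _ := by
  rw [← Hom.app_res, ← Hom.app_res, H, map_add, Scheme.Modules.Hom.app_smul,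
    Scheme.Modules.Hom.app_smul, he]

lemma IsGen.equation_transition {x : Γ(S.mod, U)} {y : Γ(S.mod, V)} {v r : Γ(X, U ⊓ V)}
    {t n : Γ(X, U)} {s m : Γ(X, V)} (hx : S.IsGen x) (ht : S.HasEquation x t n)
    (hs : S.HasEquation y s m)
    (H : res inf_le_left x = v • res inf_le_right y + r • S.one _) :
    resO inf_le_left t = v * resO inf_le_right s + 2 * r ∧
    resO inf_le_left n = v * resO inf_le_right s * r + v ^ 2 * resO inf_le_right m + r ^ 2 := by
  refine (hx.restrict inf_le_left).equation_unique (ht.restrict inf_le_left) ?_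
  rw [H]
  exact (hs.restrict inf_le_right).transition v r

/-- The local generators of a quadratic algebra. -/
def GenFrame (S : QuadraticAlgebra X) : Type u := Σ U : X.Opens, {x : Γ(S.mod, U) // S.IsGen x}

namespace GenFrame

variable (i j k : S.GenFrame)

/-- The trace of a generator. -/
def t : Γ(X, i.1) := i.2.2.exists_equation.choose

/-- The norm of a generator. -/
def n : Γ(X, i.1) := i.2.2.exists_equation.choose_spec.choose

lemma equation : S.HasEquation i.2.1 i.t i.n := i.2.2.exists_equation.choose_spec.choose_spec

/-- The linear coefficient of a change of generators. -/
def v : Γ(X, i.1 ⊓ j.1) := (j.2.2.exists_transition (x := i.2.1)).choose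

/-- The constant coefficient of a change of generators. -/
def r : Γ(X, i.1 ⊓ j.1) := (j.2.2.exists_transition (x := i.2.1)).choose_spec.choose

lemma spec : res inf_le_left i.2.1 = v i j • res inf_le_right j.2.1 + r i j • S.one _ :=
  (j.2.2.exists_transition (x := i.2.1)).choose_spec.choose_spec

lemma t_eq : resO inf_le_left i.t = v i j * resO inf_le_right j.t + 2 * r i j :=
  (i.2.2.equation_transition i.equation j.equation (spec i j)).1

lemma n_eq : resO inf_le_left i.n = v i j * resO inf_le_right j.t * r i j +
    v i j ^ 2 * resO inf_le_right j.n + r i j ^ 2 :=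
  (i.2.2.equation_transition i.equation j.equation (spec i j)).2

variable {i j k}

/-- Makes the choice of `v` and `r` harmless: any formula relating two generators over a smaller
open set is the restriction of the chosen one. -/
lemma unique (h : W ≤ i.1 ⊓ j.1) {a b : Γ(X, W)}
    (H : res (h.trans inf_le_left) i.2.1 = a • res (h.trans inf_le_right) j.2.1 + b • S.one W) :
    a = resO h (v i j) ∧ b = resO h (r i j) :=
  (j.2.2.restrict (h.trans inf_le_right)).transition_unique
    (H.symm.trans (res_transition (spec i j) h))

lemma self : v i i = 1 ∧ r i i = 0 := by
  obtain ⟨h1, h2⟩ := unique (i := i) (j := i) le_rfl (a := 1) (b := 0) (by simp)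
  rw [resO_self] at h1 h2
  exact ⟨h1.symm, h2.symm⟩

/-- Composition of affine substitutions, identified with the chosen one by uniqueness. -/
lemma mul (hij : W ≤ i.1 ⊓ j.1) (hjk : W ≤ j.1 ⊓ k.1) (hik : W ≤ i.1 ⊓ k.1) :
    resO hij (v i j) * resO hjk (v j k) = resO hik (v i k) ∧
    resO hij (r i j) + resO hij (v i j) * resO hjk (r j k) = resO hik (r i k) := by
  refine unique hik ?_
  rw [res_transition (spec i j) hij, res_transition (spec j k) hjk]
  module

end GenFrame

lemma cover (S : QuadraticAlgebra X) (z : X) : ∃ i : S.GenFrame, z ∈ i.1 := by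
  obtain ⟨U, x, hz, hx⟩ := S.exists_gen z
  exact ⟨⟨U, x, hx⟩, hz⟩

/-- The function `w` exhibits `P` as the product of `S` and `T`. -/
structure IsMulBy (S T P : QuadraticAlgebra X)
    (w : ∀ U : X.Opens, Γ(S.mod, U) → Γ(T.mod, U) → Γ(P.mod, U)) : Prop where
  gen : ∀ {U : X.Opens} {x : Γ(S.mod, U)} {y : Γ(T.mod, U)}, S.IsGen x → T.IsGen y →
    P.IsGen (w U x y)
  res_eq : ∀ {U V : X.Opens} (h : V ≤ U) {x : Γ(S.mod, U)} {y : Γ(T.mod, U)}, S.IsGen x →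
    T.IsGen y → res h (w U x y) = w V (res h x) (res h y)
  equation : ∀ {U : X.Opens} {x : Γ(S.mod, U)} {y : Γ(T.mod, U)}, S.IsGen x → T.IsGen y →
    ∀ {t n s m : Γ(X, U)}, S.HasEquation x t n → T.HasEquation y s m →
      P.HasEquation (w U x y) (s * t) (m * t ^ 2 + n * s ^ 2 - 4 * n * m)
  change : ∀ {U : X.Opens} {x x' : Γ(S.mod, U)} {y y' : Γ(T.mod, U)},
      S.IsGen x → S.IsGen x' → T.IsGen y → T.IsGen y' →
      ∀ {t n s m u r v q : Γ(X, U)}, S.HasEquation x t n → T.HasEquation y s m →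
        x = u • x' + r • S.one U → y = v • y' + q • T.one U →
        w U x y = (u * v) • w U x' y' + (q * t + r * s - 2 * q * r) • P.one U

lemma isMul_iff : S.IsMul T P ↔ ∃ w, IsMulBy S T P w := by
  constructor
  · rintro ⟨w, h1, h2⟩
    exact ⟨w, fun hx hy => (h1 _ _ _ hx hy).1, fun h _ _ hx hy => (h1 _ _ _ hx hy).2.1 _ h,
      fun hx hy => (h1 _ _ _ hx hy).2.2 _ _ _ _,
      fun hx hx' hy hy' => h2 _ _ _ _ _ hx hx' hy hy' _ _ _ _ _ _ _ _⟩
  · rintro ⟨w, h⟩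
    exact ⟨w, fun U x y hx hy => ⟨h.gen hx hy, fun V hV => h.res_eq hV hx hy,
      fun t n s m => h.equation hx hy⟩,
      fun U x x' y y' hx hx' hy hy' t n s m u r v q => h.change hx hx' hy hy'⟩

lemma IsMulBy.transition {w : ∀ U : X.Opens, Γ(S.mod, U) → Γ(T.mod, U) → Γ(P.mod, U)}
    (hw : IsMulBy S T P w) {x : Γ(S.mod, U)} {x' : Γ(S.mod, V)} {y : Γ(T.mod, U)} {y' : Γ(T.mod, V)}
    (hx : S.IsGen x) (hx' : S.IsGen x') (hy : T.IsGen y) (hy' : T.IsGen y') {t n s m : Γ(X, U)}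
    (ht : S.HasEquation x t n) (hs : T.HasEquation y s m) {u r v q : Γ(X, U ⊓ V)}
    (h1 : res inf_le_left x = u • res inf_le_right x' + r • S.one _)
    (h2 : res inf_le_left y = v • res inf_le_right y' + q • T.one _) :
    res inf_le_left (w U x y) = (u * v) • res inf_le_right (w V x' y') +
      (q * resO inf_le_left t + r * resO inf_le_left s - 2 * q * r) • P.one _ := by
  rw [hw.res_eq _ hx hy, hw.res_eq _ hx' hy']
  exact hw.change (hx.restrict _) (hx'.restrict _) (hy.restrict _) (hy'.restrict _)
    (ht.restrict _) (hs.restrict _) h1 h2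

/-- The gluing data are indexed by all pairs of generators over a common open set. Since the
formulas are those of `x ⊗ y + σ(x) ⊗ σ(y)`, every gluing condition is a polynomial consequence of
the rules for `t, n, u, r` and `s, m, v, q`. -/
theorem exists_mul (S T : QuadraticAlgebra X) : ∃ P : QuadraticAlgebra X, S.IsMul T P := by
  let ι := Σ U : X.Opens, {x : Γ(S.mod, U) // S.IsGen x} × {y : Γ(T.mod, U) // T.IsGen y}
  let l : ι → S.GenFrame := fun i => ⟨i.1, i.2.1⟩
  let k : ι → T.GenFrame := fun i => ⟨i.1, i.2.2⟩
  have hD : ∀ z, ∃ i : ι, z ∈ i.1 := fun z => by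
    obtain ⟨D, x, y, hz, hx, hy⟩ := S.exists_gens₂ T
    exact ⟨⟨D z, ⟨x z, hx z⟩, ⟨y z, hy z⟩⟩, hz z⟩
  let t : ∀ i : ι, Γ(X, i.1) := fun i => (l i).t
  let n : ∀ i : ι, Γ(X, i.1) := fun i => (l i).n
  let s : ∀ i : ι, Γ(X, i.1) := fun i => (k i).t
  let m : ∀ i : ι, Γ(X, i.1) := fun i => (k i).n
  let u : ∀ i j : ι, Γ(X, i.1 ⊓ j.1) := fun i j => (l i).v (l j)
  let r : ∀ i j : ι, Γ(X, i.1 ⊓ j.1) := fun i j => (l i).r (l j)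
  let v : ∀ i j : ι, Γ(X, i.1 ⊓ j.1) := fun i j => (k i).v (k j)
  let q : ∀ i j : ι, Γ(X, i.1 ⊓ j.1) := fun i j => (k i).r (k j)
  have ht : ∀ i j, resO inf_le_left (t i) = u i j * resO inf_le_right (t j) + 2 * r i j :=
    fun i j => GenFrame.t_eq (l i) (l j)
  have hs : ∀ i j, resO inf_le_left (s i) = v i j * resO inf_le_right (s j) + 2 * q i j :=
    fun i j => GenFrame.t_eq (k i) (k j)
  have hn : ∀ i j, resO inf_le_left (n i) = u i j * resO inf_le_right (t j) * r i j +
    u i j ^ 2 * resO inf_le_right (n j) + r i j ^ 2 := fun i j => GenFrame.n_eq (l i) (l j)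
  have hm : ∀ i j, resO inf_le_left (m i) = v i j * resO inf_le_right (s j) * q i j +
    v i j ^ 2 * resO inf_le_right (m j) + q i j ^ 2 := fun i j => GenFrame.n_eq (k i) (k j)
  obtain ⟨P, b, hb, htr, heq⟩ := exists_quadraticAlgebra (fun i : ι => i.1) hD
    (fun i j => u i j * v i j)
    (fun i j => q i j * resO inf_le_left (t i) + r i j * resO inf_le_left (s i) -
      2 * q i j * r i j)
    (fun i => s i * t i) (fun i => m i * t i ^ 2 + n i * s i ^ 2 - 4 * n i * m i)
    (fun i => by
      have h1 : u i i = 1 := GenFrame.self.1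
      have h2 : v i i = 1 := GenFrame.self.1
      rw [h1, h2, _root_.one_mul])
    (fun i => by
      have h1 : r i i = 0 := GenFrame.self.2
      have h2 : q i i = 0 := GenFrame.self.2
      rw [h1, h2]
      ring)
    (fun i j k' => by
      have h1 := (GenFrame.mul (i := l i) (j := l j) (k := l k') (W := i.1 ⊓ j.1 ⊓ k'.1)
        inf_le_left (inf_le_inf_right _ inf_le_right) (inf_le_inf_right _ inf_le_left)).1
      have h2 := (GenFrame.mul (i := k i) (j := k j) (k := k k') (W := i.1 ⊓ j.1 ⊓ k'.1)
        inf_le_left (inf_le_inf_right _ inf_le_right) (inf_le_inf_right _ inf_le_left)).1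
      rw [resO_mul, resO_mul, resO_mul, mul_mul_mul_comm]
      exact congrArg₂ _ h1 h2)
    (fun i j k' => by
      have h1 := GenFrame.mul (i := l i) (j := l j) (k := l k') (W := i.1 ⊓ j.1 ⊓ k'.1)
        inf_le_left (inf_le_inf_right _ inf_le_right) (inf_le_inf_right _ inf_le_left)
      have h2 := GenFrame.mul (i := k i) (j := k j) (k := k k') (W := i.1 ⊓ j.1 ⊓ k'.1)
        inf_le_left (inf_le_inf_right _ inf_le_right) (inf_le_inf_right _ inf_le_left)
      -- The constant coefficient of a change of `w` involves the traces of the first pair of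
      -- generators; to compose two changes these are rewritten through the traces of the second
      -- pair.
      have h3 := congrArg (resO (inf_le_left : i.1 ⊓ j.1 ⊓ k'.1 ≤ i.1 ⊓ j.1)) (ht i j)
      have h4 := congrArg (resO (inf_le_left : i.1 ⊓ j.1 ⊓ k'.1 ≤ i.1 ⊓ j.1)) (hs i j)
      change _ = resO _ (u i k') ∧ _ = resO _ (r i k') at h1
      change _ = resO _ (v i k') ∧ _ = resO _ (q i k') at h2
      simp only [resO_add, resO_sub, resO_mul, resO_resO, resO_ofNat] at h3 h4 ⊢
      rw [← h1.2, ← h2.2, h3, h4]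
      ring)
    (fun i j => by
      simp only [resO_mul, ht i j, hs i j]
      ring)
    (fun i j => by
      simp only [resO_mul, resO_add, resO_sub, resO_pow, resO_ofNat, ht i j, hs i j, hn i j, hm i j]
      ring)
  classical
  -- The value `0` outside generators is never used: every clause of `IsMulBy` concerns generators.
  let w : ∀ U : X.Opens, Γ(S.mod, U) → Γ(T.mod, U) → Γ(P.mod, U) := fun U x y =>
    if h : S.IsGen x ∧ T.IsGen y then b ⟨U, ⟨x, h.1⟩, ⟨y, h.2⟩⟩ else 0
  have hw : ∀ {U : X.Opens} {x : Γ(S.mod, U)} {y : Γ(T.mod, U)} (hx : S.IsGen x) (hy : T.IsGen y),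
      w U x y = b ⟨U, ⟨x, hx⟩, ⟨y, hy⟩⟩ := fun hx hy => dif_pos ⟨hx, hy⟩
  -- By uniqueness of the coefficients, the glued transition formula holds for any given expression
  -- of one pair through another. It covers both restriction, where the coefficients are `1, 0`, and
  -- a change of generators on a fixed open set.
  have key : ∀ (i j : ι) (W : X.Opens) (h : W ≤ i.1 ⊓ j.1) (a c a' c' : Γ(X, W)),
      res (h.trans inf_le_left) i.2.1.1 =
        a • res (h.trans inf_le_right) j.2.1.1 + c • S.one W →
      res (h.trans inf_le_left) i.2.2.1 =
        a' • res (h.trans inf_le_right) j.2.2.1 + c' • T.one W →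
      res (h.trans inf_le_left) (b i) = (a * a') • res (h.trans inf_le_right) (b j) +
        (c' * resO (h.trans inf_le_left) (t i) + c * resO (h.trans inf_le_left) (s i) -
          2 * c' * c) • P.one W := by
    intro i j W h a c a' c' h1 h2
    obtain ⟨rfl, rfl⟩ := GenFrame.unique (i := l i) (j := l j) h h1
    obtain ⟨rfl, rfl⟩ := GenFrame.unique (i := k i) (j := k j) h h2
    simpa [resO_add, resO_sub, resO_mul] using res_transition (htr i j) h
  refine ⟨P, isMul_iff.mpr ⟨w, ?_, ?_, ?_, ?_⟩⟩
  · intro U x y hx hy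
    rw [hw hx hy]
    exact hb ⟨U, ⟨x, hx⟩, ⟨y, hy⟩⟩
  · intro U V h x y hx hy
    rw [hw hx hy, hw (hx.restrict h) (hy.restrict h)]
    have := key ⟨U, ⟨x, hx⟩, ⟨y, hy⟩⟩ ⟨V, ⟨_, hx.restrict h⟩, ⟨_, hy.restrict h⟩⟩ V
      (le_inf h le_rfl) 1 0 1 0 (by simp) (by simp)
    simpa using this
  · intro U x y hx hy t' n' s' m' ht' hs'
    rw [hw hx hy]
    obtain ⟨rfl, rfl⟩ := hx.equation_unique ht' (GenFrame.equation (S := S) ⟨U, x, hx⟩)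
    obtain ⟨rfl, rfl⟩ := hy.equation_unique hs' (GenFrame.equation (S := T) ⟨U, y, hy⟩)
    exact heq ⟨U, ⟨x, hx⟩, ⟨y, hy⟩⟩
  · intro U x x' y y' hx hx' hy hy' t' n' s' m' u' r' v' q' ht' hs' h1 h2
    rw [hw hx hy, hw hx' hy']
    obtain ⟨rfl, rfl⟩ := hx.equation_unique ht' (GenFrame.equation (S := S) ⟨U, x, hx⟩)
    obtain ⟨rfl, rfl⟩ := hy.equation_unique hs' (GenFrame.equation (S := T) ⟨U, y, hy⟩)
    have := key ⟨U, ⟨x, hx⟩, ⟨y, hy⟩⟩ ⟨U, ⟨x', hx'⟩, ⟨y', hy'⟩⟩ U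
      (le_inf le_rfl le_rfl) u' r' v' q' (by simpa using h1) (by simpa using h2)
    simpa using this

end QuadraticAlgebra

end

/-! ### Monoid laws and pullbacks for quadratic algebras -/

section

variable {X Y Z : Scheme.{u}} {M N K : X.Modules} {U V W : X.Opens}

namespace QuadraticAlgebra

variable {S T P S' T' P' : QuadraticAlgebra X}

lemma mul_congr (h : S.IsMul T P) (hP : P ≈ P') : S.IsMul T P' := by
  obtain ⟨w, hw⟩ := isMul_iff.mp h
  obtain ⟨φ, hφ⟩ := hP
  have h1 : ∀ U, φ.hom.app U (P.one U) = P'.one U := fun U => (hφ U).1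
  refine isMul_iff.mpr ⟨fun U x y => φ.hom.app U (w U x y), ?_, ?_, ?_, ?_⟩
  · exact fun hx hy => (hw.gen hx hy).map_iso φ (h1 _)
  · intro U V h x y hx hy
    rw [← Hom.app_res, hw.res_eq h hx hy]
  · intro U x y hx hy t n s m ht hs
    exact (hw.equation hx hy ht hs).map φ.hom (h1 _) ((hφ _).2 _ _)
  · intro U x x' y y' hx hx' hy hy' t n s m u r v q ht hs e1 e2
    rw [hw.change hx hx' hy hy' ht hs e1 e2, map_add, Scheme.Modules.Hom.app_smul,
      Scheme.Modules.Hom.app_smul, h1]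

theorem mul_unique (h : S.IsMul T P) (h' : S'.IsMul T' P') (hS : S ≈ S') (hT : T ≈ T') :
    P ≈ P' := by
  obtain ⟨w, hw⟩ := isMul_iff.mp h
  obtain ⟨w', hw'⟩ := isMul_iff.mp h'
  obtain ⟨φ, hφ⟩ := hS
  obtain ⟨ψ, hψ⟩ := hT
  obtain ⟨D, x, y, hz, hx, hy⟩ := S.exists_gens₂ T
  have hφx := fun z => (hx z).map_iso φ (hφ _).1
  have hψy := fun z => (hy z).map_iso ψ (hψ _).1
  choose t n ht using fun z => (hx z).exists_equation
  choose s m hs using fun z => (hy z).exists_equation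
  have ht' := fun z => (ht z).map φ.hom (hφ _).1 ((hφ _).2 _ _)
  have hs' := fun z => (hs z).map ψ.hom (hψ _).1 ((hψ _).2 _ _)
  refine equiv_of_frames (fun z => ⟨z, hz z⟩) (fun z => w _ (x z) (y z))
    (fun z => w' _ (φ.hom.app _ (x z)) (ψ.hom.app _ (y z))) (fun z => hw.gen (hx z) (hy z))
    (fun z => hw'.gen (hφx z) (hψy z)) (fun i j => ?_)
    fun z => ⟨_, _, hw.equation (hx z) (hy z) (ht z) (hs z),
      hw'.equation (hφx z) (hψy z) (ht' z) (hs' z)⟩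
  obtain ⟨u, r, e1⟩ := (hx j).exists_transition (x := x i)
  obtain ⟨v, q, e2⟩ := (hy j).exists_transition (x := y i)
  exact ⟨_, _, hw.transition (hx i) (hx j) (hy i) (hy j) (ht i) (hs i) e1 e2,
    hw'.transition (hφx i) (hφx j) (hψy i) (hψy j) (ht' i) (hs' i)
      (map_transition e1 _ fun U => (hφ U).1) (map_transition e2 _ fun U => (hψ U).1)⟩

lemma mul_comm (h : S.IsMul T P) : T.IsMul S P := by
  obtain ⟨w, hw⟩ := isMul_iff.mp h
  refine isMul_iff.mpr ⟨fun U y x => w U x y, fun hy hx => hw.gen hx hy,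
    fun h _ _ hy hx => hw.res_eq h hx hy, ?_, ?_⟩
  · intro U y x hy hx s m t n hs ht
    convert hw.equation hx hy ht hs using 1 <;> ring
  · intro U y y' x x' hy hy' hx hx' s m t n v q u r hs ht e1 e2
    rw [hw.change hx hx' hy hy' ht hs e2 e1]
    module

/-- The two bracketings of `x, y, z` give generators with the same transition coefficients and the
same equation, both by polynomial identities; the common trace is `t s p`. -/
theorem mul_assoc_equiv {R ST TR Q Q' : QuadraticAlgebra X} (h₁ : S.IsMul T ST) (h₂ : ST.IsMul R Q)
    (h₃ : T.IsMul R TR) (h₄ : S.IsMul TR Q') : Q ≈ Q' := by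
  obtain ⟨w₁, h₁⟩ := isMul_iff.mp h₁
  obtain ⟨w₂, h₂⟩ := isMul_iff.mp h₂
  obtain ⟨w₃, h₃⟩ := isMul_iff.mp h₃
  obtain ⟨w₄, h₄⟩ := isMul_iff.mp h₄
  obtain ⟨D, x, y, z, hD, hx, hy, hz⟩ := S.exists_gens₃ T R
  choose t n ht using fun i => (hx i).exists_equation
  choose s m hs using fun i => (hy i).exists_equation
  choose p l hp using fun i => (hz i).exists_equation
  have g₁ := fun i => h₁.gen (hx i) (hy i)
  have g₃ := fun i => h₃.gen (hy i) (hz i)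
  have e₁ := fun i => h₁.equation (hx i) (hy i) (ht i) (hs i)
  have e₃ := fun i => h₃.equation (hy i) (hz i) (hs i) (hp i)
  refine equiv_of_frames (fun i => ⟨i, hD i⟩) (fun i => w₂ _ (w₁ _ (x i) (y i)) (z i))
    (fun i => w₄ _ (x i) (w₃ _ (y i) (z i))) (fun i => h₂.gen (g₁ i) (hz i))
    (fun i => h₄.gen (hx i) (g₃ i)) (fun i j => ?_)
    fun i => ⟨_, _, h₂.equation (g₁ i) (hz i) (e₁ i) (hp i), ?_⟩
  · obtain ⟨u, r, e1⟩ := (hx j).exists_transition (x := x i)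
    obtain ⟨v, q, e2⟩ := (hy j).exists_transition (x := y i)
    obtain ⟨k, o, e3⟩ := (hz j).exists_transition (x := z i)
    refine ⟨_, _, h₂.transition (g₁ i) (g₁ j) (hz i) (hz j) (e₁ i) (hp i)
      (h₁.transition (hx i) (hx j) (hy i) (hy j) (ht i) (hs i) e1 e2) e3, ?_⟩
    rw [h₄.transition (hx i) (hx j) (g₃ i) (g₃ j) (ht i) (e₃ i) e1
      (h₃.transition (hy i) (hy j) (hz i) (hz j) (hs i) (hp i) e2 e3), resO_mul, resO_mul]
    module
  · convert h₄.equation (hx i) (g₃ i) (ht i) (e₃ i) using 1 <;> ring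

/-- An idempotent is a root of `e² = 1 e - 0`, and the pairs `e, 1 - e` and `1, e` differ by a
unimodular integral matrix. The unit object thereby fits the description by generators. -/
lemma isOne_iff : S.IsOne ↔ ∃ e : Γ(S.mod, ⊤), S.IsGen e ∧ S.HasEquation e 1 0 := by
  refine exists_congr fun e => ?_
  have key : ∀ V (h : V ≤ ⊤), res h (S.one ⊤ - e) = S.one V - res h e := fun V h => by
    rw [res_sub, S.one_res]
  have heq : S.HasEquation e 1 0 ↔ S.mul.app ⊤ e e = e := by
    rw [HasEquation, one_smul, zero_smul, sub_zero]
  rw [heq, and_comm]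
  refine and_congr_left' ⟨fun h => isBasisOn_two_of (fun V hV s => ?_) fun V hV a b H => ?_,
    fun h => isBasisOn_two_of (fun V hV s => ?_) fun V hV a b H => ?_⟩
  · obtain ⟨a, b, rfl⟩ := IsBasisOn.coord_two h hV s
    exact ⟨b, a - b, by rw [key, S.one_res]; module⟩
  · obtain ⟨h1, h2⟩ := IsBasisOn.cancel_two h hV (a := a + b) (b := a) (c := 0) (d := 0) (by
      rw [S.one_res] at H
      rw [key, zero_smul, zero_smul, zero_add, ← H]
      module)
    exact ⟨h2, by rw [h2, zero_add] at h1; exact h1⟩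
  · obtain ⟨a, b, rfl⟩ := IsBasisOn.coord_two h hV s
    exact ⟨a + b, a, by rw [key, S.one_res]; module⟩
  · obtain ⟨h1, h2⟩ := IsBasisOn.cancel_two h hV (a := b) (b := a - b) (c := 0) (d := 0) (by
      rw [key] at H
      rw [S.one_res, zero_smul, zero_smul, zero_add, ← H]
      module)
    exact ⟨by rw [h1, sub_zero] at h2; exact h2, h1⟩

lemma exists_one : ∃ S : QuadraticAlgebra X, S.IsOne := by
  obtain ⟨S, x, hx, -, h⟩ := exists_quadraticAlgebra (X := X) (fun _ : PUnit.{u + 1} => ⊤)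
    (fun _ => ⟨⟨⟩, trivial⟩) (fun _ _ => 1) (fun _ _ => 0) (fun _ => 1) (fun _ => 0)
    (fun _ => rfl) (fun _ => rfl) (by simp) (by simp) (by simp) (by simp)
  exact ⟨S, isOne_iff.mpr ⟨x ⟨⟩, hx ⟨⟩, h ⟨⟩⟩⟩

lemma one_unique (hS : S.IsOne) (hT : T.IsOne) : S ≈ T := by
  obtain ⟨e, he, h1⟩ := isOne_iff.mp hS
  obtain ⟨f, hf, h2⟩ := isOne_iff.mp hT
  exact equiv_of_frames (D := fun _ : Unit => ⊤) (fun x => ⟨⟨⟩, trivial⟩) (fun _ => e) (fun _ => f)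
    (fun _ => he) (fun _ => hf) (fun _ _ => ⟨1, 0, by simp, by simp⟩) (fun _ => ⟨1, 0, h1, h2⟩)

lemma one_congr (hS : S.IsOne) (h : S ≈ T) : T.IsOne := by
  obtain ⟨e, he, h1⟩ := isOne_iff.mp hS
  obtain ⟨φ, hφ⟩ := h
  exact isOne_iff.mpr ⟨φ.hom.app _ e, he.map_iso φ (hφ _).1, h1.map _ (hφ _).1 ((hφ _).2 _ _)⟩

/-- Putting `t = 1` and `n = 0`, and `u = 1`, `r = 0` in the transitions, reduces the product
formulas to those of `y`. -/
theorem one_mul_equiv (hS : S.IsOne) (h : S.IsMul T P) : P ≈ T := by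
  obtain ⟨e, he, h1⟩ := isOne_iff.mp hS
  obtain ⟨w, hw⟩ := isMul_iff.mp h
  obtain ⟨D, y, hz, hy⟩ := T.exists_gens
  choose s m hs using fun z => (hy z).exists_equation
  have he' := fun z => he.restrict (le_top : D z ≤ ⊤)
  have h1' := fun z => h1.restrict (le_top : D z ≤ ⊤)
  refine equiv_of_frames (fun z => ⟨z, hz z⟩) (fun z => w _ (res le_top e) (y z)) y
    (fun z => hw.gen (he' z) (hy z)) hy (fun i j => ?_) fun z => ⟨s z, m z, ?_, hs z⟩
  · obtain ⟨v, q, e2⟩ := (hy j).exists_transition (x := y i)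
    refine ⟨v, q, ?_, e2⟩
    rw [hw.transition (he' i) (he' j) (hy i) (hy j) (h1' i) (hs i) (u := 1) (r := 0)
      (by simp) e2, resO_resO, resO_one]
    module
  · convert hw.equation (he' z) (hy z) (h1' z) (hs z) using 1
    · rw [resO_one, mul_one]
    · rw [resO_one, resO_zero]
      ring

section Pull

variable {f : X ⟶ Y} {A B C : QuadraticAlgebra Y}

/-- The morphism `η` is a homomorphism of sheaves of algebras along `f`. -/
structure IsAlgHom (f : X ⟶ Y) {A : QuadraticAlgebra Y} {S : QuadraticAlgebra X}
    (η : A.mod ⟶ (Scheme.Modules.pushforward f).obj S.mod) : Prop where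
  one : ∀ V : Y.Opens, pullSection η (A.one V) = S.one (f ⁻¹ᵁ V)
  mul : ∀ (V : Y.Opens) (x y : Γ(A.mod, V)), pullSection η (A.mul.app V x y) =
    S.mul.app (f ⁻¹ᵁ V) (pullSection η x) (pullSection η y)

lemma isPull_iff : A.IsPull f S ↔ ∃ η : A.mod ⟶ (Scheme.Modules.pushforward f).obj S.mod,
    IsPullback f η ∧ IsAlgHom f η :=
  exists_congr fun _ => and_congr_right fun _ =>
    ⟨fun h => ⟨fun V => (h V).1, fun V => (h V).2⟩, fun h V => ⟨h.one V, h.mul V⟩⟩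

variable {η : A.mod ⟶ (Scheme.Modules.pushforward f).obj S.mod}

lemma IsAlgHom.equation (hη : IsAlgHom f η) {V : Y.Opens} {x : Γ(A.mod, V)} {t n : Γ(Y, V)}
    (h : A.HasEquation x t n) : S.HasEquation (pullSection η x) (f.app V t) (f.app V n) := by
  unfold HasEquation
  rw [← hη.mul, h, pullSection_sub, pullSection_smul, pullSection_smul, hη.one]

lemma IsAlgHom.transition (hη : IsAlgHom f η) {V V' : Y.Opens} {x : Γ(A.mod, V)}
    {y : Γ(A.mod, V')} {v r : Γ(Y, V ⊓ V')}
    (H : res inf_le_left x = v • res inf_le_right y + r • A.one _) :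
    res (inf_le_left : f ⁻¹ᵁ V ⊓ f ⁻¹ᵁ V' ≤ f ⁻¹ᵁ V) (pullSection η x) =
      (show Γ(X, f ⁻¹ᵁ V ⊓ f ⁻¹ᵁ V') from f.app _ v) • res inf_le_right (pullSection η y) +
      (show Γ(X, f ⁻¹ᵁ V ⊓ f ⁻¹ᵁ V') from f.app _ r) • S.one _ := by
  have := congrArg (pullSection η) H
  rwa [pullSection_add, pullSection_smul, pullSection_smul, pullSection_res, pullSection_res,
    hη.one] at this

lemma exists_pull_gen (f : X ⟶ Y) (A : QuadraticAlgebra Y) :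
    ∃ (S : QuadraticAlgebra X) (η : A.mod ⟶ (Scheme.Modules.pushforward f).obj S.mod),
      IsPullback f η ∧ IsAlgHom f η ∧ ∀ (V : Y.Opens) (x : Γ(A.mod, V)), A.IsGen x →
        S.IsGen (pullSection η x) := by
  obtain ⟨S, b, hb, htr, heq⟩ := exists_quadraticAlgebra (fun i : A.GenFrame => f ⁻¹ᵁ i.1)
    (preimage_cover A.cover) (fun i j => f.app (i.1 ⊓ j.1) (i.v j))
    (fun i j => f.app (i.1 ⊓ j.1) (i.r j)) (fun i => f.app _ i.t) (fun i => f.app _ i.n)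
    (fun i => by rw [GenFrame.self.1]; exact map_one _)
    (fun i => by rw [GenFrame.self.2]; exact map_zero _)
    (fun i j k => by
      have := congrArg (f.app (i.1 ⊓ j.1 ⊓ k.1)) (GenFrame.mul (i := i) (j := j) (k := k)
        inf_le_left (inf_le_inf_right _ inf_le_right) (inf_le_inf_right _ inf_le_left)).1
      rw [map_mul, app_resO, app_resO, app_resO] at this
      exact this)
    (fun i j k => by
      have := congrArg (f.app (i.1 ⊓ j.1 ⊓ k.1)) (GenFrame.mul (i := i) (j := j) (k := k)
        inf_le_left (inf_le_inf_right _ inf_le_right) (inf_le_inf_right _ inf_le_left)).2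
      rw [map_add, map_mul, app_resO, app_resO, app_resO, app_resO] at this
      exact this)
    (fun i j => by
      have := congrArg (f.app (i.1 ⊓ j.1)) (i.t_eq j)
      rw [map_add, map_mul, map_mul, app_resO, app_resO, map_ofNat] at this
      exact this)
    (fun i j => by
      have := congrArg (f.app (i.1 ⊓ j.1)) (i.n_eq j)
      rw [map_add, map_add, map_mul, map_mul, map_mul, map_pow, map_pow, app_resO, app_resO,
        app_resO] at this
      exact this)
  obtain ⟨η, hη⟩ := exists_hom (N := (Scheme.Modules.pushforward f).obj S.mod) A.cover
    (fun i => i.2.2) (fun i => ![S.one (f ⁻¹ᵁ i.1), b i]) fun i j => by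
      refine ⟨![![1, 0], ![i.r j, i.v j]], fun a => ?_, fun a => ?_⟩
      · fin_cases a
        · simp [A.one_res]
        · simpa [A.one_res, add_comm] using i.spec j
      · fin_cases a
        · simp only [Fin.zero_eta, Fin.sum_univ_two, Matrix.cons_val_zero, Matrix.cons_val_one,
            one_smul, zero_smul, add_zero]
          exact (S.one_res (f.preimage_mono (inf_le_left : i.1 ⊓ j.1 ≤ i.1))).trans
            (S.one_res (f.preimage_mono (inf_le_right : i.1 ⊓ j.1 ≤ j.1))).symm
        · simp only [Fin.mk_one, Fin.sum_univ_two, Matrix.cons_val_zero, Matrix.cons_val_one]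
          refine ((htr i j).trans (add_comm _ _)).trans ?_
          exact congrArg (fun s : Γ(S.mod, f ⁻¹ᵁ i.1 ⊓ f ⁻¹ᵁ j.1) =>
            (show Γ(X, f ⁻¹ᵁ i.1 ⊓ f ⁻¹ᵁ j.1) from f.app _ (i.r j)) • s +
            (show Γ(X, f ⁻¹ᵁ i.1 ⊓ f ⁻¹ᵁ j.1) from f.app _ (i.v j)) • res inf_le_right (b j))
            (S.one_res (f.preimage_mono (inf_le_right : i.1 ⊓ j.1 ≤ j.1))).symm
  have h1 : ∀ i : A.GenFrame, pullSection η (A.one i.1) = S.one _ := fun i => hη i 0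
  have h2 : ∀ i : A.GenFrame, pullSection η i.2.1 = b i := fun i => hη i 1
  have one : ∀ V : Y.Opens, pullSection η (A.one V) = S.one (f ⁻¹ᵁ V) := by
    intro V
    refine section_ext fun z hz => ?_
    obtain ⟨i, hi⟩ := A.cover (f z)
    have hl : V ⊓ i.1 ≤ V := inf_le_left
    have hr : V ⊓ i.1 ≤ i.1 := inf_le_right
    refine ⟨f ⁻¹ᵁ (V ⊓ i.1), f.preimage_mono hl, ⟨hz, hi⟩, ?_⟩
    rw [← pullSection_res hl, A.one_res, S.one_res, ← A.one_res hr, pullSection_res, h1, S.one_res]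
  have hgen : ∀ (V : Y.Opens) (x : Γ(A.mod, V)), A.IsGen x → S.IsGen (pullSection η x) := by
    intro V x hx
    have : pullSection η x = b ⟨V, x, hx⟩ := h2 ⟨V, x, hx⟩
    rw [this]
    exact hb ⟨V, x, hx⟩
  refine ⟨S, η, isPullback_of_frames A.cover (fun i => i.2.2) fun i => ?_, ⟨one, ?_⟩, hgen⟩
  · have := hgen _ _ i.2.2
    unfold IsGen at this
    rw [← one] at this
    convert this using 1
    ext a
    fin_cases a <;> rfl
  · intro V x y
    refine section_ext fun z hz => ?_
    obtain ⟨i, hi⟩ := A.cover (f z)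
    have hl : V ⊓ i.1 ≤ V := inf_le_left
    have hr : V ⊓ i.1 ≤ i.1 := inf_le_right
    refine ⟨f ⁻¹ᵁ (V ⊓ i.1), f.preimage_mono hl, ⟨hz, hi⟩, ?_⟩
    obtain ⟨a, c, hx⟩ := (i.2.2.restrict hr).coord (res hl x)
    obtain ⟨a', c', hy⟩ := (i.2.2.restrict hr).coord (res hl y)
    have e1 := (i.equation.restrict hr)
    have e2 : S.HasEquation (pullSection η (res hr i.2.1)) (f.app _ (resO hr i.t))
        (f.app _ (resO hr i.n)) := by
      rw [pullSection_res, h2, app_resO, app_resO]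
      exact (heq i).restrict _
    rw [← pullSection_res hl, A.mul.map_res, S.mul.map_res, ← pullSection_res hl,
      ← pullSection_res hl, hx, hy, e1.mul_comb]
    simp only [pullSection_add, pullSection_smul, one]
    rw [e2.mul_comb]
    simp only [map_add, map_sub, map_mul]

lemma IsAlgHom.isGen (hη : IsAlgHom f η) (h : IsPullback f η) {V : Y.Opens} {x : Γ(A.mod, V)}
    (hx : A.IsGen x) : S.IsGen (pullSection η x) := by
  obtain ⟨T, η', h', hη', hg⟩ := A.exists_pull_gen f
  obtain ⟨φ, hφ⟩ := h'.exists_iso h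
  rw [← hφ]
  exact (hg V x hx).map_iso φ (by rw [← hη.one, ← hη'.one, hφ])

theorem exists_pull (A : QuadraticAlgebra Y) : ∃ S : QuadraticAlgebra X, A.IsPull f S := by
  obtain ⟨S, η, h, hη, -⟩ := A.exists_pull_gen f
  exact ⟨S, isPull_iff.mpr ⟨η, h, hη⟩⟩

lemma pull_congr (h : A.IsPull f S) (hS : S ≈ T) : A.IsPull f T := by
  obtain ⟨η, h, hη⟩ := isPull_iff.mp h
  obtain ⟨φ, hφ⟩ := hS
  refine isPull_iff.mpr ⟨_, h.comp_iso φ, fun V => ?_, fun V x y => ?_⟩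
  · rw [pullSection_comp_map, hη.one, (hφ _).1]
  · rw [pullSection_comp_map, pullSection_comp_map, pullSection_comp_map, hη.mul, (hφ _).2]

theorem pull_unique (hA : A ≈ B) (h : A.IsPull f S) (h' : B.IsPull f T) : S ≈ T := by
  obtain ⟨φ, hφ⟩ := hA
  obtain ⟨η, h, hη⟩ := isPull_iff.mp h
  obtain ⟨η', h', hη'⟩ := isPull_iff.mp h'
  obtain ⟨D, x, hD, hx⟩ := A.exists_gens
  choose t n ht using fun i => (hx i).exists_equation
  refine equiv_of_frames (preimage_cover fun y => ⟨y, hD y⟩) (fun y => pullSection η (x y))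
    (fun y => pullSection η' (φ.hom.app _ (x y))) (fun y => hη.isGen h (hx y))
    (fun y => hη'.isGen h' ((hx y).map_iso φ (hφ _).1)) (fun i j => ?_)
    fun y => ⟨_, _, hη.equation (ht y),
      hη'.equation ((ht y).map φ.hom (hφ _).1 ((hφ _).2 _ _))⟩
  obtain ⟨v, r, e⟩ := (hx j).exists_transition (x := x i)
  exact ⟨_, _, hη.transition e, hη'.transition (map_transition e _ fun U => (hφ U).1)⟩

lemma pull_one (hA : A.IsOne) (h : A.IsPull f S) : S.IsOne := by
  obtain ⟨e, he, h1⟩ := isOne_iff.mp hA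
  obtain ⟨η, h, hη⟩ := isPull_iff.mp h
  refine isOne_iff.mpr ⟨pullSection η e, hη.isGen h he, ?_⟩
  have := hη.equation h1
  rw [map_one, map_zero] at this
  exact this

theorem pull_mul (h : A.IsMul B C) (hA : A.IsPull f S) (hB : B.IsPull f T) (hC : C.IsPull f P)
    (h' : S.IsMul T P') : P ≈ P' := by
  obtain ⟨w, hw⟩ := isMul_iff.mp h
  obtain ⟨w', hw'⟩ := isMul_iff.mp h'
  obtain ⟨η₁, p₁, a₁⟩ := isPull_iff.mp hA
  obtain ⟨η₂, p₂, a₂⟩ := isPull_iff.mp hB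
  obtain ⟨η₃, p₃, a₃⟩ := isPull_iff.mp hC
  obtain ⟨D, x, y, hD, hx, hy⟩ := A.exists_gens₂ B
  choose t n ht using fun i => (hx i).exists_equation
  choose s m hs using fun i => (hy i).exists_equation
  refine equiv_of_frames (preimage_cover fun y => ⟨y, hD y⟩)
    (fun i => pullSection η₃ (w _ (x i) (y i)))
    (fun i => w' _ (pullSection η₁ (x i)) (pullSection η₂ (y i)))
    (fun i => a₃.isGen p₃ (hw.gen (hx i) (hy i)))
    (fun i => hw'.gen (a₁.isGen p₁ (hx i)) (a₂.isGen p₂ (hy i))) (fun i j => ?_)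
    fun i => ⟨_, _, a₃.equation (hw.equation (hx i) (hy i) (ht i) (hs i)), ?_⟩
  · obtain ⟨u, r, e1⟩ := (hx j).exists_transition (x := x i)
    obtain ⟨v, q, e2⟩ := (hy j).exists_transition (x := y i)
    refine ⟨_, _, a₃.transition (hw.transition (hx i) (hx j) (hy i) (hy j) (ht i) (hs i) e1 e2),
      ?_⟩
    have := hw'.transition (a₁.isGen p₁ (hx i)) (a₁.isGen p₁ (hx j)) (a₂.isGen p₂ (hy i))
      (a₂.isGen p₂ (hy j)) (a₁.equation (ht i)) (a₂.equation (hs i)) (a₁.transition e1)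
      (a₂.transition e2)
    simp only [map_add, map_sub, map_mul, app_resO, map_ofNat]
    exact this
  · have := hw'.equation (a₁.isGen p₁ (hx i)) (a₂.isGen p₂ (hy i)) (a₁.equation (ht i))
      (a₂.equation (hs i))
    simpa only [map_add, map_sub, map_mul, map_pow, map_ofNat] using this

lemma pull_id (S : QuadraticAlgebra X) : S.IsPull (𝟙 X) S := by
  obtain ⟨D, x, hD, hx⟩ := S.exists_gens
  exact isPull_iff.mpr ⟨pullId S.mod, isPullback_of_frames (fun z => ⟨z, hD z⟩) hx hx,
    fun V => rfl, fun V x y => rfl⟩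

lemma pull_comp {g : Y ⟶ Z} {E : QuadraticAlgebra Z} (h : E.IsPull g A) (h' : A.IsPull f S) :
    E.IsPull (f ≫ g) S := by
  obtain ⟨η, p, a⟩ := isPull_iff.mp h
  obtain ⟨η', p', a'⟩ := isPull_iff.mp h'
  obtain ⟨D, x, hD, hx⟩ := E.exists_gens
  have hone : ∀ V, pullSection (pullComp η η') (E.one V) = S.one _ := fun V => by
    rw [pullSection_pullComp, a.one, a'.one]
    rfl
  refine isPull_iff.mpr ⟨pullComp η η', isPullback_of_frames (fun z => ⟨z, hD z⟩) hx fun i => ?_,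
    hone, fun V x y => ?_⟩
  · have := a'.isGen p' (a.isGen p (hx i))
    have e : (fun b => pullSection (pullComp η η') (![E.one (D i), x i] b)) =
        ![S.one ((f ≫ g) ⁻¹ᵁ D i), pullSection η' (pullSection η (x i))] := by
      ext b
      fin_cases b
      · exact hone _
      · rfl
    rw [e]
    exact this
  · rw [pullSection_pullComp, a.mul, a'.mul]
    rfl

end Pull

end QuadraticAlgebra

end

section

variable {X Y Z : Scheme.{u}} {M N K : X.Modules} {U V W : X.Opens}

namespace QuadraticAlgebra

variable {S T P S' T' P' : QuadraticAlgebra X}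

/-! ### The exterior square of a quadratic algebra -/

/-- Since `1 ∧ 1 = 0`, the constant term `r` disappears. -/
lemma _root_.QuadDisc.Pairing.IsAlternating.transition {w : Pairing S.mod S.mod K}
    (hw : w.IsAlternating) {x : Γ(S.mod, U)} {y : Γ(S.mod, V)} {v r : Γ(X, U ⊓ V)}
    (H : res inf_le_left x = v • res inf_le_right y + r • S.one _) :
    res inf_le_left (w.app U (S.one U) x) = v • res inf_le_right (w.app V (S.one V) y) := by
  rw [w.map_res, w.map_res, S.one_res, S.one_res, H, map_add, map_smul, map_smul, hw, smul_zero,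
    add_zero]

/-- The linear coefficients `v` form a multiplicative cocycle, so they glue to an invertible module
with generators `e i`, onto which `1 ∧ x i` is mapped. -/
lemma exists_wedge (S : QuadraticAlgebra X) :
    ∃ (L : InvertibleSheaf X) (w : Pairing S.mod S.mod L.mod), w.IsExteriorSquare ∧
      ∀ (U : X.Opens) (x : Γ(S.mod, U)), S.IsGen x → IsBasisOn U ![w.app U (S.one U) x] := by
  obtain ⟨L, e, he, htr⟩ := exists_invertibleSheaf (fun i : S.GenFrame => i.1) S.cover
    (fun i j => i.v j) (fun i => GenFrame.self.1) fun i j k => (GenFrame.mul _ _ _).1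
  obtain ⟨w, hw⟩ := exists_pairing (K := L.mod) S.cover (fun i => i.2.2) (fun i => i.2.2)
    (fun i => ![![0, e i], ![-e i, 0]]) fun i j => by
      refine ⟨![![1, 0], ![i.r j, i.v j]], ![![1, 0], ![i.r j, i.v j]], fun a => ?_, fun a => ?_,
        fun a a' => ?_⟩
      · fin_cases a
        · simp [S.one_res]
        · simpa [S.one_res, add_comm] using i.spec j
      · fin_cases a
        · simp [S.one_res]
        · simpa [S.one_res, add_comm] using i.spec j
      · fin_cases a <;> fin_cases a' <;> simp [htr, Fin.sum_univ_two, res_neg, res_zero, smul_smul]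
        module
  have hbas : ∀ (U : X.Opens) (x : Γ(S.mod, U)), S.IsGen x →
      IsBasisOn U ![w.app U (S.one U) x] := fun U x hx => by
    have : w.app U (S.one U) x = e ⟨U, x, hx⟩ := hw ⟨U, x, hx⟩ 0 1
    rw [this]
    exact he ⟨U, x, hx⟩
  -- Antisymmetry alone would not suffice where `2` is a zero divisor; the vanishing of `w` on both
  -- basis vectors is used as well.
  have halt : w.IsAlternating := fun U x => by
    refine section_ext fun z hz => ?_
    obtain ⟨V, hV, g, hzV, hg⟩ := S.exists_gen_le hz
    refine ⟨V, hV, hzV, ?_⟩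
    obtain ⟨a, b, hx⟩ := hg.coord (res hV x)
    have e1 : w.app V (S.one V) (S.one V) = 0 := hw ⟨V, g, hg⟩ 0 0
    have e2 : w.app V g g = 0 := hw ⟨V, g, hg⟩ 1 1
    have e3 : w.app V (S.one V) g = e ⟨V, g, hg⟩ := hw ⟨V, g, hg⟩ 0 1
    have e4 : w.app V g (S.one V) = - e ⟨V, g, hg⟩ := hw ⟨V, g, hg⟩ 1 0
    rw [w.map_res, hx, res_zero]
    simp only [map_add, map_smul, LinearMap.add_apply, LinearMap.smul_apply, e1, e2, e3, e4]
    module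
  exact ⟨L, w, isExteriorSquare_of_frames S.cover (fun i => i.2.2) halt
    fun i => hbas _ _ i.2.2, hbas⟩

lemma _root_.QuadDisc.Pairing.IsExteriorSquare.isBasisOn {w : Pairing S.mod S.mod K}
    (hw : w.IsExteriorSquare) {x : Γ(S.mod, U)} (hx : S.IsGen x) :
    IsBasisOn U ![w.app U (S.one U) x] := by
  obtain ⟨L, w', hw', hb⟩ := S.exists_wedge
  obtain ⟨φ, hφ⟩ := hw'.exists_iso hw
  rw [← hφ]
  exact (hb U x hx).map_iso_one φ

/-! ### The standard involution -/

/-- `1` is part of a local basis. Hence scalars such as norms and discriminants may be compared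
inside the algebra. -/
lemma smul_one_injective (S : QuadraticAlgebra X) {a b : Γ(X, V)}
    (h : a • S.one V = b • S.one V) : a = b := by
  refine sectionO_ext fun z hz => ?_
  obtain ⟨i, hi⟩ := S.cover z
  refine ⟨V ⊓ i.1, inf_le_left, ⟨hz, hi⟩, ?_⟩
  refine ((i.2.2.restrict (inf_le_right : V ⊓ i.1 ≤ i.1)).cancel (b := 0) (d := 0) ?_).1
  simpa [res_smul, S.one_res] using congrArg (res (inf_le_left : V ⊓ i.1 ≤ V)) h

/-- Uniqueness of the standard involution. Write `σ(x) = a + b x`. The norms of `x` and `1 + x` are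
scalars, so their `x`-coefficients vanish: `a + b t = 0` and `1 + a + b + b t = 0`. Thus `b = -1`
and `a = t`. -/
lemma IsStandardInvolution.app_gen {σ : S.mod ⟶ S.mod} (hσ : S.IsStandardInvolution σ)
    {x : Γ(S.mod, U)} (hx : S.IsGen x) {t n : Γ(X, U)} (ht : S.HasEquation x t n) :
    σ.app U x = t • S.one U - x := by
  obtain ⟨a, b, hσx⟩ := hx.coord (σ.app U x)
  obtain ⟨p, hp⟩ := hσ.norm_mem U x
  obtain ⟨q, hq⟩ := hσ.norm_mem U (S.one U + x)
  have h1 := ht.mul_comb 0 1 a b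
  have h2 := ht.mul_comb 1 1 (1 + a) b
  rw [zero_smul, zero_add, one_smul, ← hσx, hp] at h1
  rw [one_smul, one_smul, show (1 + a) • S.one U + b • x = S.one U + σ.app U x by
    rw [hσx]; module] at h2
  rw [map_add (σ.app U).hom] at hq
  rw [show (σ.app U).hom (S.one U) = S.one U from hσ.map_one U] at hq
  replace hq := h2.symm.trans hq
  have hz : ∀ p : Γ(X, U), p • S.one U + (0 : Γ(X, U)) • x = p • S.one U := fun p => by
    rw [zero_smul, add_zero]
  have e1 := (hx.cancel ((hz p).trans h1)).2
  have e2 := (hx.cancel (hq.trans (hz q).symm)).2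
  have eb : b = -1 := by linear_combination e1 + e2
  have ea : a = t := by linear_combination -e1 - t * eb
  rw [hσx, ea, eb]
  module

/-- The expression is alternating in its two arguments, and on `1, x` it equals `σ(x) - x = t - 2
x`; the determinant accounts for the rest. -/
lemma HasEquation.skew {σ : S.mod ⟶ S.mod} {x : Γ(S.mod, U)} {t n : Γ(X, U)}
    (ht : S.HasEquation x t n) (h1 : σ.app U (S.one U) = S.one U)
    (hx : σ.app U x = t • S.one U - x) (a b c d : Γ(X, U)) :
    S.skew σ (a • S.one U + b • x) (c • S.one U + d • x) =
      (a * d - b * c) • (t • S.one U - (2 : Γ(X, U)) • x) := by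
  have hσ : ∀ a b : Γ(X, U), σ.app U (a • S.one U + b • x) =
      (a + b * t) • S.one U + (-b) • x := fun a b => by
    rw [map_add, Scheme.Modules.Hom.app_smul, Scheme.Modules.Hom.app_smul, h1, hx]
    module
  rw [QuadraticAlgebra.skew, hσ, hσ, ht.mul_comb, ht.mul_comb]
  match_scalars <;> ring

/-- `(t - 2 x)² = t² - 4 n`, which is where the discriminant of the polynomial appears. -/
lemma HasEquation.skew_sq {x : Γ(S.mod, U)} {t n : Γ(X, U)} (ht : S.HasEquation x t n)
    (a b : Γ(X, U)) :
    S.mul.app U (a • (t • S.one U - (2 : Γ(X, U)) • x)) (b • (t • S.one U - (2 : Γ(X, U)) • x)) =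
      (a * b * (t ^ 2 - 4 * n)) • S.one U := by
  have h : ∀ a : Γ(X, U), a • (t • S.one U - (2 : Γ(X, U)) • x) =
      (a * t) • S.one U + (-(2 * a)) • x := fun a => by module
  rw [h, h, ht.mul_comb]
  match_scalars <;> ring

/-- The local formula `x i ↦ t i - x i` glues, because `t i = v t j + 2 r` gives `t i - x i = v (t j
- x j) + r`. -/
theorem exists_isStandardInvolution (S : QuadraticAlgebra X) :
    ∃ σ : S.mod ⟶ S.mod, S.IsStandardInvolution σ := by
  obtain ⟨σ, hσ⟩ := exists_hom (N := S.mod) S.cover (fun i => i.2.2)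
    (fun i => ![S.one i.1, i.t • S.one i.1 - i.2.1]) fun i j => by
      refine ⟨![![1, 0], ![i.r j, i.v j]], fun a => ?_, fun a => ?_⟩
      · fin_cases a
        · simp [S.one_res]
        · simpa [S.one_res, add_comm] using i.spec j
      · fin_cases a
        · simp [S.one_res]
        · simp only [Fin.mk_one, Fin.sum_univ_two, Matrix.cons_val_zero, Matrix.cons_val_one,
            res_sub, res_smul, S.one_res, i.spec j, i.t_eq j]
          module
  have hcomb : ∀ (i : S.GenFrame) (V : X.Opens) (hV : V ≤ i.1) (a b : Γ(X, V)),
      σ.app V (a • S.one V + b • res hV i.2.1) =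
        (a + b * resO hV i.t) • S.one V + (-b) • res hV i.2.1 := by
    intro i V hV a b
    have h1 : σ.app i.1 (S.one i.1) = S.one i.1 := hσ i 0
    have h2 : σ.app i.1 i.2.1 = i.t • S.one i.1 - i.2.1 := hσ i 1
    rw [map_add, Scheme.Modules.Hom.app_smul, Scheme.Modules.Hom.app_smul, ← S.one_res hV,
      Hom.app_res, Hom.app_res, h1, h2, res_sub, res_smul]
    module
  have hone : ∀ V, σ.app V (S.one V) = S.one V := fun V => by
    refine section_ext fun z hz => ?_
    obtain ⟨i, hi⟩ := S.cover z
    refine ⟨V ⊓ i.1, inf_le_left, ⟨hz, hi⟩, ?_⟩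
    have := hcomb i (V ⊓ i.1) inf_le_right 1 0
    simp only [one_smul, zero_smul, zero_mul, add_zero, neg_zero] at this
    rw [← Hom.app_res, S.one_res, this]
  have hnorm : ∀ (i : S.GenFrame) (V : X.Opens) (_ : V ≤ i.1) (x : Γ(S.mod, V)),
      ∃ n : Γ(X, V), S.mul.app V x (σ.app V x) = n • S.one V := by
    intro i V hV x
    obtain ⟨a, b, rfl⟩ := (i.2.2.restrict hV).coord x
    rw [hcomb, (i.equation.restrict hV).mul_comb]
    exact ⟨a * (a + b * resO hV i.t) + b * b * resO hV i.n, by match_scalars <;> ring⟩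
  refine ⟨σ, hone, fun U x y => ?_, fun U x => ?_, fun U x => ?_⟩
  · refine section_ext fun z hz => ?_
    obtain ⟨i, hi⟩ := S.cover z
    refine ⟨U ⊓ i.1, inf_le_left, ⟨hz, hi⟩, ?_⟩
    have hr : U ⊓ i.1 ≤ i.1 := inf_le_right
    have hl : U ⊓ i.1 ≤ U := inf_le_left
    obtain ⟨a, b, hx⟩ := (i.2.2.restrict hr).coord (res hl x)
    obtain ⟨c, d, hy⟩ := (i.2.2.restrict hr).coord (res hl y)
    rw [← Hom.app_res, S.mul.map_res, S.mul.map_res, ← Hom.app_res, ← Hom.app_res, hx, hy,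
      hcomb, hcomb, (i.equation.restrict hr).mul_comb, (i.equation.restrict hr).mul_comb, hcomb]
    match_scalars <;> ring
  · refine section_ext fun z hz => ?_
    obtain ⟨i, hi⟩ := S.cover z
    refine ⟨U ⊓ i.1, inf_le_left, ⟨hz, hi⟩, ?_⟩
    have hr : U ⊓ i.1 ≤ i.1 := inf_le_right
    have hl : U ⊓ i.1 ≤ U := inf_le_left
    obtain ⟨a, b, hx⟩ := (i.2.2.restrict hr).coord (res hl x)
    rw [← Hom.app_res, ← Hom.app_res, hx, hcomb, hcomb]
    match_scalars <;> ring
  -- Norms exist locally, and they glue to a function because a scalar multiple of `1` determines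
  -- its scalar.
  · refine Exists.imp (fun n hn => ?_) (existsO_section (U := U) (fun V h n => S.mul.app V (res h x)
        (σ.app V (res h x)) = n • S.one V) (fun z hz => ?_) (fun V W h h' n e => ?_)
        fun V h n m e e' => S.smul_one_injective (e.symm.trans e'))
    · refine section_ext fun z hz => ?_
      obtain ⟨i, hi⟩ := S.cover z
      obtain ⟨m, hm⟩ := hnorm i (U ⊓ i.1) inf_le_right (res inf_le_left x)
      refine ⟨U ⊓ i.1, inf_le_left, ⟨hz, hi⟩, ?_⟩
      rw [S.mul.map_res, ← Hom.app_res, hm, res_smul, S.one_res, hn _ _ m hm]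
    · obtain ⟨i, hi⟩ := S.cover z
      obtain ⟨m, hm⟩ := hnorm i (U ⊓ i.1) inf_le_right (res inf_le_left x)
      exact ⟨U ⊓ i.1, inf_le_left, m, ⟨hz, hi⟩, hm⟩
    · have := congrArg (res h') e
      rw [S.mul.map_res, ← Hom.app_res, res_res, res_smul, S.one_res] at this
      exact this

/-! ### The discriminant -/

variable {D D' E F G : Discriminant X}

/-- Removes the involution from the definition: by `skew` and `skew_sq` the form is determined by
its value on `1 ∧ x`. All later work with discriminants uses this description. -/
theorem hasDisc_iff : S.HasDisc D ↔ ∃ w : Pairing S.mod S.mod D.mod, w.IsExteriorSquare ∧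
    ∀ (U : X.Opens) (x : Γ(S.mod, U)) (t n : Γ(X, U)), S.IsGen x → S.HasEquation x t n →
      D.form.app U (w.app U (S.one U) x) (w.app U (S.one U) x) = t ^ 2 - 4 * n := by
  constructor
  · rintro ⟨σ, w, hσ, hw, h⟩
    refine ⟨w, hw, fun U x t n hx ht => S.smul_one_injective ?_⟩
    have e := ht.skew (hσ.map_one U) (hσ.app_gen hx ht) 1 0 0 1
    have e' := ht.skew_sq 1 1
    simp only [one_smul, zero_smul, add_zero, zero_add, mul_one, mul_zero, sub_zero, one_mul]
      at e e'
    rw [h, e, e']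
  · rintro ⟨w, hw, h⟩
    obtain ⟨σ, hσ⟩ := S.exists_isStandardInvolution
    refine ⟨σ, w, hσ, hw, fun U x y z v => section_ext fun q hq => ?_⟩
    obtain ⟨V, hV, g, hqV, hg⟩ := S.exists_gen_le hq
    refine ⟨V, hV, hqV, ?_⟩
    obtain ⟨t, n, ht⟩ := hg.exists_equation
    obtain ⟨a, b, hx⟩ := hg.coord (res hV x)
    obtain ⟨c, d, hy⟩ := hg.coord (res hV y)
    obtain ⟨a', b', hz⟩ := hg.coord (res hV z)
    obtain ⟨c', d', hv⟩ := hg.coord (res hV v)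
    have hskew : ∀ x y : Γ(S.mod, U), res hV (S.skew σ x y) = S.skew σ (res hV x) (res hV y) :=
      fun x y => by
        rw [skew, skew, res_sub, S.mul.map_res, S.mul.map_res, ← Hom.app_res, ← Hom.app_res]
    rw [res_smul, D.form.map_res, w.map_res, w.map_res, S.one_res, S.mul.map_res, hskew, hskew,
      hx, hy, hz, hv, hw.1.app_comb, hw.1.app_comb, D.form.app_smul_smul, h V g t n hg ht,
      ht.skew (hσ.map_one V) (hσ.app_gen hg ht), ht.skew (hσ.map_one V) (hσ.app_gen hg ht),
      ht.skew_sq]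

/-- The square root modulo `4` is the trace: `(t² - 4 n) - t² = -4 n`, and `t i - v t j = 2 r` gives
agreement modulo `2`. -/
theorem exists_disc (S : QuadraticAlgebra X) : ∃ D : Discriminant X, S.HasDisc D := by
  obtain ⟨L, w, hw, hb⟩ := S.exists_wedge
  have hb' := fun i : S.GenFrame => hb _ _ i.2.2
  obtain ⟨B, hB⟩ := BilinearForm.exists_of_frames S.cover hb' (fun i => i.t ^ 2 - 4 * i.n)
    fun i j => ⟨i.v j, hw.1.transition (i.spec j), by
      simp only [resO_sub, resO_mul, resO_pow, resO_ofNat, i.t_eq j, i.n_eq j]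
      ring⟩
  have h4 : B.IsSquareModFour := isSquareModFour_of_frames S.cover hb' (fun i => i.t)
    (fun i => .of_dvd ⟨-i.n, by rw [hB]; push_cast; ring⟩)
    fun i j => ⟨i.v j, hw.1.transition (i.spec j), .of_dvd ⟨i.r j, by
      rw [i.t_eq j]; push_cast; ring⟩⟩
  refine ⟨⟨L, B, h4⟩, hasDisc_iff.mpr ⟨w, hw, fun U x t n hx ht => ?_⟩⟩
  obtain ⟨rfl, rfl⟩ := hx.equation_unique ht (GenFrame.equation ⟨U, x, hx⟩)
  exact hB ⟨U, x, hx⟩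

lemma hasDisc_congr (h : S.HasDisc D) (hD : D ≈ D') : S.HasDisc D' := by
  obtain ⟨w, hw, h⟩ := hasDisc_iff.mp h
  obtain ⟨φ, hφ⟩ := hD
  refine hasDisc_iff.mpr ⟨w.comp φ.hom, hw.comp_iso φ, fun U x t n hx ht => ?_⟩
  rw [Pairing.comp_app, hφ, h U x t n hx ht]

theorem disc_unique (hS : S ≈ T) (h : S.HasDisc D) (h' : T.HasDisc D') : D ≈ D' := by
  obtain ⟨w, hw, h⟩ := hasDisc_iff.mp h
  obtain ⟨w', hw', h'⟩ := hasDisc_iff.mp h'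
  obtain ⟨φ, hφ⟩ := hS
  have hg := fun i : S.GenFrame => i.2.2.map_iso φ (hφ _).1
  refine Discriminant.equiv_of_frames S.cover _ _ (fun i => hw.isBasisOn i.2.2)
    (fun i => hw'.isBasisOn (hg i)) (fun i j => ⟨_, hw.1.transition (i.spec j),
      hw'.1.transition (map_transition (i.spec j) φ.hom fun U => (hφ U).1)⟩) fun i => ?_
  rw [h _ _ _ _ i.2.2 i.equation,
    h' _ _ _ _ (hg i) (i.equation.map φ.hom (hφ _).1 ((hφ _).2 _ _))]

lemma disc_one (hS : S.IsOne) (h : S.HasDisc D) : D.IsOne := by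
  obtain ⟨w, hw, h⟩ := hasDisc_iff.mp h
  obtain ⟨e, he, h1⟩ := isOne_iff.mp hS
  refine ⟨_, hw.isBasisOn he, ?_⟩
  rw [h _ _ _ _ he h1]
  ring

/-- Both sides have transition function `u v` on the generators, and their values agree by `(s t)² -
4 (m t² + n s² - 4 n m) = (t² - 4 n) (s² - 4 m)`. -/
theorem disc_mul (h : S.IsMul T P) (hS : S.HasDisc D) (hT : T.HasDisc E) (hP : P.HasDisc F)
    (h' : D.IsMul E G) : F ≈ G := by
  obtain ⟨w, hw⟩ := isMul_iff.mp h
  obtain ⟨w₁, p₁, d₁⟩ := hasDisc_iff.mp hS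
  obtain ⟨w₂, p₂, d₂⟩ := hasDisc_iff.mp hT
  obtain ⟨w₃, p₃, d₃⟩ := hasDisc_iff.mp hP
  obtain ⟨β, hβ, hd⟩ := h'
  obtain ⟨D', x, y, hz, hx, hy⟩ := S.exists_gens₂ T
  choose t n ht using fun i => (hx i).exists_equation
  choose s m hs using fun i => (hy i).exists_equation
  have hg := fun i => hw.gen (hx i) (hy i)
  refine Discriminant.equiv_of_frames (fun z => ⟨z, hz z⟩) _
    (fun i => β.app _ (w₁.app _ (S.one _) (x i)) (w₂.app _ (T.one _) (y i)))
    (fun i => p₃.isBasisOn (hg i))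
    (fun i => hβ.isBasisOn (L := D.toInvertibleSheaf) (M := E.toInvertibleSheaf)
      (p₁.isBasisOn (hx i)) (p₂.isBasisOn (hy i))) (fun i j => ?_) fun i => ?_
  · obtain ⟨u, r, e1⟩ := (hx j).exists_transition (x := x i)
    obtain ⟨v, q, e2⟩ := (hy j).exists_transition (x := y i)
    exact ⟨u * v,
      p₃.1.transition (hw.transition (hx i) (hx j) (hy i) (hy j) (ht i) (hs i) e1 e2),
      β.res_app_of_transition (p₁.1.transition e1) (p₂.1.transition e2)⟩
  · rw [d₃ _ _ _ _ (hg i) (hw.equation (hx i) (hy i) (ht i) (hs i)), hd,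
      d₁ _ _ _ _ (hx i) (ht i), d₂ _ _ _ _ (hy i) (hs i)]
    ring

theorem disc_pull {f : X ⟶ Y} {A : QuadraticAlgebra Y} {H : Discriminant Y} (h : A.IsPull f S)
    (hA : A.HasDisc H) (hS : S.HasDisc D) (h' : H.IsPull f E) : D ≈ E := by
  obtain ⟨η, hη, aη⟩ := isPull_iff.mp h
  obtain ⟨w₁, p₁, d₁⟩ := hasDisc_iff.mp hA
  obtain ⟨w₂, p₂, d₂⟩ := hasDisc_iff.mp hS
  obtain ⟨θ, hθ, dθ⟩ := h'
  refine Discriminant.equiv_of_frames (preimage_cover A.cover) _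
    (fun i => pullSection θ (w₁.app _ (A.one _) i.2.1))
    (fun i => p₂.isBasisOn (aη.isGen hη i.2.2))
    (fun i => hθ.isBasisOn (L := H.toInvertibleSheaf) (p₁.isBasisOn i.2.2)) (fun i j => ?_)
    fun i => ?_
  · exact ⟨_, p₂.1.transition (aη.transition (i.spec j)),
      pullSection_transition θ (p₁.1.transition (i.spec j))⟩
  · rw [d₂ _ _ _ _ (aη.isGen hη i.2.2) (aη.equation i.equation), dθ,
      d₁ _ _ _ _ i.2.2 i.equation]
    simp only [map_sub, map_mul, map_pow, map_ofNat]

lemma hasWedge_iff (h : S.HasDisc D) : S.HasWedge K ↔ Nonempty (D.mod ≅ K) := by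
  obtain ⟨w, hw, -⟩ := hasDisc_iff.mp h
  constructor
  · rintro ⟨w', hw'⟩
    obtain ⟨φ, -⟩ := hw.exists_iso hw'
    exact ⟨φ⟩
  · rintro ⟨φ⟩
    exact ⟨w.comp φ.hom, hw.comp_iso φ⟩

/-! ### Quadratic algebras given by a linear and a bilinear form -/

/-- With `r = 0` the gluing rules say exactly that `t` is a linear form and `n` a quadratic form on
`L`. The result is `O_X ⊕ L` with `x² = t(x) x - n(x)`, whose exterior square is `L`. -/
theorem exists_quadraticAlgebra_of_forms (D : Discriminant X) (t n : ∀ i : Frame D.mod, Γ(X, i.1))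
    (ht : ∀ i j, resO inf_le_left (t i) = i.tr j * resO inf_le_right (t j))
    (hn : ∀ i j, resO inf_le_left (n i) = i.tr j ^ 2 * resO inf_le_right (n j))
    (hd : ∀ i, D.form.app i.1 i.2.1 i.2.1 = t i ^ 2 - 4 * n i) :
    ∃ (S : QuadraticAlgebra X) (x : ∀ i : Frame D.mod, Γ(S.mod, i.1)), (∀ i, S.IsGen (x i)) ∧
      (∀ i, S.HasEquation (x i) (t i) (n i)) ∧ S.HasDisc D := by
  have hD := D.toInvertibleSheaf.cover
  obtain ⟨S, x, hx, htr, hS⟩ := exists_quadraticAlgebra (fun i : Frame D.mod => i.1) hD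
    (fun i j => i.tr j) (fun _ _ => 0) t n (fun i => i.tr_self) (fun i => rfl)
    (fun i j k => Frame.tr_mul _ _ _) (fun i j k => by simp) (fun i j => by simp [ht i j])
    (fun i j => by simp [hn i j])
  obtain ⟨E, hE⟩ := S.exists_disc
  refine ⟨S, x, hx, hS, hasDisc_congr hE ?_⟩
  obtain ⟨w, hw, h⟩ := hasDisc_iff.mp hE
  exact Discriminant.equiv_of_frames hD _ (fun i => i.2.1) (fun i => hw.isBasisOn (hx i))
    (fun i => i.2.2) (fun i j => ⟨_, hw.1.transition (htr i j), i.tr_spec j⟩)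
    fun i => by rw [h _ _ _ _ (hx i) (hS i), hd]

end QuadraticAlgebra

/-! ### Absorbing elements -/

/-- The discriminant `(0, L)`. -/
def InvertibleSheaf.zeroDiscriminant (L : InvertibleSheaf X) : Discriminant X where
  toInvertibleSheaf := L
  form := ⟨fun _ => 0, fun h _ _ => resO_zero h⟩
  isSquareModFour := isSquareModFour_of_frames L.cover (fun i => i.2.2) (fun _ => 0)
    (fun i => .of_dvd (by simp)) fun i j => ⟨_, i.tr_spec j, by simpa using .zero⟩

/-- The invertible module `O_X`. -/
def InvertibleSheaf.structureSheaf (X : Scheme.{u}) : InvertibleSheaf X :=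
  ⟨structureModule X, fun _ => ⟨⊤, trivial, _, isBasisOn_structureModule⟩⟩

lemma IsBasisOn.exists_unit {a b : Γ(M, U)} (ha : IsBasisOn U ![a]) (hb : IsBasisOn U ![b]) :
    ∃ c d : Γ(X, U), a = c • b ∧ c * d = 1 := by
  obtain ⟨c, hc⟩ := hb.coord_one le_rfl a
  obtain ⟨d, hd⟩ := ha.coord_one le_rfl b
  rw [res_self] at hc hd
  refine ⟨c, d, hc, hb.cancel_one le_rfl ?_⟩
  rw [res_self, mul_comm, mul_smul, ← hc, ← hd, one_smul]

lemma QuadraticAlgebra.IsGen.smul_unit {S : QuadraticAlgebra X} {x : Γ(S.mod, U)} (hx : S.IsGen x)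
    {c d : Γ(X, U)} (h : c * d = 1) : S.IsGen (c • x) := by
  refine isBasisOn_two_of (fun V hV s => ?_) fun V hV a b H => ?_
  · obtain ⟨a, b, rfl⟩ := IsBasisOn.coord_two hx hV s
    refine ⟨a, b * resO hV d, ?_⟩
    rw [res_smul, smul_smul, mul_assoc, _root_.mul_comm (resO hV d), ← resO_mul, h, resO_one, mul_one]
  · obtain ⟨h1, h2⟩ := IsBasisOn.cancel_two hx hV (a := a) (b := b * resO hV c) (c := 0) (d := 0)
      (by rw [zero_smul, zero_smul, zero_add, mul_smul, ← res_smul]; exact H)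
    refine ⟨h1, ?_⟩
    rw [← mul_one b, ← resO_one hV, ← h, resO_mul, ← mul_assoc, h2, zero_mul]

/-- The discriminant `(0, O_X)` absorbs the form of a discriminant. -/
theorem Discriminant.exists_absorbing (X : Scheme.{u}) : ∃ Z : Discriminant X,
    Nonempty (Z.mod ≅ structureModule X) ∧ ∀ D D' E E' : Discriminant X,
      Nonempty (D.mod ≅ D'.mod) → Z.IsMul D E → Z.IsMul D' E' → E ≈ E' := by
  let Z := (InvertibleSheaf.structureSheaf X).zeroDiscriminant
  have h0 : ∀ U x y, Z.form.app U x y = 0 := fun _ _ _ => rfl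
  refine ⟨Z, ⟨Iso.refl _⟩, ?_⟩
  rintro D D' E E' ⟨φ⟩ ⟨β, hβ, h⟩ ⟨β', hβ', h'⟩
  obtain ⟨U, e, f, hz, he, hf⟩ := Z.exists_frames₂ D.toInvertibleSheaf
  have hf' := fun z => (hf z).map_iso_one φ
  refine equiv_of_frames (fun z => ⟨z, hz z⟩) (fun z => β.app _ (e z) (f z))
    (fun z => β'.app _ (e z) (φ.hom.app _ (f z)))
    (fun z => hβ.isBasisOn (L := Z.toInvertibleSheaf) (M := D.toInvertibleSheaf) (he z) (hf z))
    (fun z => hβ'.isBasisOn (L := Z.toInvertibleSheaf) (M := D'.toInvertibleSheaf) (he z) (hf' z))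
    (fun i j => ?_) fun z => by rw [h, h', h0, zero_mul, zero_mul]
  obtain ⟨v, hv⟩ := exists_transition_one (e i) (he j)
  obtain ⟨w, hw⟩ := exists_transition_one (f i) (hf j)
  refine ⟨_, β.res_app_of_transition hv hw, β'.res_app_of_transition hv ?_⟩
  rw [← Hom.app_res, ← Hom.app_res, hw, Scheme.Modules.Hom.app_smul]

/-- The quadratic algebra `O_X[e]` with `e² = 0` absorbs everything of a quadratic algebra but its
exterior square. -/
theorem QuadraticAlgebra.exists_absorbing (X : Scheme.{u}) : ∃ Z : QuadraticAlgebra X,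
    Z.HasWedge (structureModule X) ∧ ∀ (S S' P P' : QuadraticAlgebra X) (D D' : Discriminant X),
      S.HasDisc D → S'.HasDisc D' → Nonempty (D.mod ≅ D'.mod) → Z.IsMul S P → Z.IsMul S' P' →
      P ≈ P' := by
  let Z₀ := (InvertibleSheaf.structureSheaf X).zeroDiscriminant
  have h0 : ∀ U x y, Z₀.form.app U x y = 0 := fun _ _ _ => rfl
  obtain ⟨Z, g, hg, heq, hZ⟩ := exists_quadraticAlgebra_of_forms Z₀ (fun _ => 0) (fun _ => 0)
    (by simp) (by simp) (by simp [h0])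
  refine ⟨Z, (hasWedge_iff hZ).mpr ⟨Iso.refl _⟩, ?_⟩
  rintro S S' P P' D D' hS hS' ⟨φ⟩ h h'
  obtain ⟨e, he⟩ : ∃ e : Γ(Z₀.mod, ⊤), IsBasisOn ⊤ ![e] := ⟨_, isBasisOn_structureModule⟩
  obtain ⟨w, hw⟩ := isMul_iff.mp h
  obtain ⟨w', hw'⟩ := isMul_iff.mp h'
  obtain ⟨a, ha, -⟩ := hasDisc_iff.mp hS
  obtain ⟨a', ha', -⟩ := hasDisc_iff.mp hS'
  obtain ⟨U, x, y, hz, hx, hy⟩ := S.exists_gens₂ S'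
  -- The given isomorphism of exterior squares sends `1 ∧ x` to `c (1 ∧ y)` with `c` a unit.
  -- Replacing `y` by `c y` makes the generators of the two exterior squares correspond.
  choose c d hc hcd using fun z =>
    ((ha.isBasisOn (hx z)).map_iso_one φ).exists_unit (ha'.isBasisOn (hy z))
  have hy' := fun z => (hy z).smul_unit (hcd z)
  choose t n ht using fun z => (hx z).exists_equation
  choose s m hs using fun z => (hy' z).exists_equation
  have hg' := fun z => (hg ⟨⊤, e, he⟩).restrict (le_top : U z ≤ ⊤)
  have heq' := fun z => (heq ⟨⊤, e, he⟩).restrict (le_top : U z ≤ ⊤)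
  simp only [resO_zero] at heq'
  refine equiv_of_frames (fun z => ⟨z, hz z⟩) _ _ (fun z => hw.gen (hg' z) (hx z))
    (fun z => hw'.gen (hg' z) (hy' z)) (fun i j => ?_)
    fun z => ⟨_, _, hw.equation (hg' z) (hx z) (heq' z) (ht z), ?_⟩
  · obtain ⟨u, r, e1⟩ := (hx j).exists_transition (x := x i)
    obtain ⟨v, q, e2⟩ := (hy' j).exists_transition (x := c i • y i)
    -- Linear coefficients are transition functions of the exterior squares, which now correspond.
    have huv : u = v := by
      have h1 := congrArg (φ.hom.app _) (ha.1.transition e1)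
      have h2 := ha'.1.transition e2
      rw [map_smul, map_smul, ← hc, ← hc] at h2
      rw [Scheme.Modules.Hom.app_smul, Hom.app_res, Hom.app_res, h2] at h1
      exact (((ha.isBasisOn (hx j)).map_iso_one φ).cancel_one inf_le_right h1).symm
    subst huv
    -- The generator of `Z` is global with trace and norm `0`. So the constant coefficients and the
    -- equations of the products vanish, and `u` is all that remains of either factor.
    have e0 : res inf_le_left (res (le_top : U i ≤ ⊤) (g ⟨⊤, e, he⟩)) =
        (1 : Γ(X, U i ⊓ U j)) • res inf_le_right (res (le_top : U j ≤ ⊤) (g ⟨⊤, e, he⟩)) +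
          (0 : Γ(X, U i ⊓ U j)) • Z.one _ := by simp
    refine ⟨1 * u, 0, ?_, ?_⟩
    · convert hw.transition (hg' i) (hg' j) (hx i) (hx j) (heq' i) (ht i) e0 e1 using 3
      simp
    · convert hw'.transition (hg' i) (hg' j) (hy' i) (hy' j) (heq' i) (hs i) e0 e2 using 3
      simp
  · convert hw'.equation (hg' z) (hy' z) (heq' z) (hs z) using 1 <;> simp

end

/-! ### Commutative monoids of isomorphism classes -/

section

variable {X Y Z : Scheme.{u}} {M N K : X.Modules} {U V W : X.Opens}

/-- The properties of the relations `IsOne`, `IsMul` and `IsPull` on a family of setoids that make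
the quotients into commutative monoids with pullback homomorphisms. -/
structure ClassLaws {Obj : Scheme.{u} → Type (u + 1)} (s : ∀ X, Setoid (Obj X))
    (IsOne : ∀ {X}, Obj X → Prop) (IsMul : ∀ {X}, Obj X → Obj X → Obj X → Prop)
    (IsPull : ∀ {X Y} (_ : X ⟶ Y), Obj Y → Obj X → Prop) : Prop where
  exists_one : ∀ X, ∃ a : Obj X, IsOne a
  one_unique : ∀ {X} {a b : Obj X}, IsOne a → IsOne b → a ≈ b
  one_congr : ∀ {X} {a b : Obj X}, IsOne a → a ≈ b → IsOne b
  exists_mul : ∀ {X} (a b : Obj X), ∃ c, IsMul a b c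
  mul_unique : ∀ {X} {a b c a' b' c' : Obj X}, IsMul a b c → IsMul a' b' c' → a ≈ a' → b ≈ b' →
    c ≈ c'
  mul_congr : ∀ {X} {a b c c' : Obj X}, IsMul a b c → c ≈ c' → IsMul a b c'
  mul_comm : ∀ {X} {a b c : Obj X}, IsMul a b c → IsMul b a c
  mul_assoc : ∀ {X} {a b c ab bc d d' : Obj X}, IsMul a b ab → IsMul ab c d → IsMul b c bc →
    IsMul a bc d' → d ≈ d'
  one_mul : ∀ {X} {a b c : Obj X}, IsOne a → IsMul a b c → c ≈ b
  exists_pull : ∀ {X Y} (f : X ⟶ Y) (a : Obj Y), ∃ b, IsPull f a b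
  pull_congr : ∀ {X Y} {f : X ⟶ Y} {a : Obj Y} {b b' : Obj X}, IsPull f a b → b ≈ b' →
    IsPull f a b'
  pull_unique : ∀ {X Y} {f : X ⟶ Y} {a a' : Obj Y} {b b' : Obj X}, a ≈ a' → IsPull f a b →
    IsPull f a' b' → b ≈ b'
  pull_one : ∀ {X Y} {f : X ⟶ Y} {a : Obj Y} {b : Obj X}, IsOne a → IsPull f a b → IsOne b
  pull_mul : ∀ {X Y} {f : X ⟶ Y} {a b c : Obj Y} {a' b' c' d : Obj X}, IsMul a b c →
    IsPull f a a' → IsPull f b b' → IsPull f c c' → IsMul a' b' d → c' ≈ d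
  pull_id : ∀ {X} (a : Obj X), IsPull (𝟙 X) a a
  pull_comp : ∀ {X Y Z} {f : X ⟶ Y} {g : Y ⟶ Z} {a : Obj Z} {b : Obj Y} {c : Obj X},
    IsPull g a b → IsPull f b c → IsPull (f ≫ g) a c

namespace ClassLaws

variable {Obj : Scheme.{u} → Type (u + 1)} {s : ∀ X, Setoid (Obj X)}
  {IsOne : ∀ {X}, Obj X → Prop} {IsMul : ∀ {X}, Obj X → Obj X → Obj X → Prop}
  {IsPull : ∀ {X Y} (_ : X ⟶ Y), Obj Y → Obj X → Prop} (A : ClassLaws s IsOne IsMul IsPull)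

/-- The commutative monoid of classes. -/
abbrev commMonoid (X : Scheme.{u}) : CommMonoid (Quotient (s X)) where
  one := Quotient.mk _ (A.exists_one X).choose
  mul := Quotient.map₂ (fun a b => (A.exists_mul a b).choose) fun _ _ h _ _ h' =>
    A.mul_unique (A.exists_mul _ _).choose_spec (A.exists_mul _ _).choose_spec h h'
  mul_assoc := by
    rintro ⟨a⟩ ⟨b⟩ ⟨c⟩
    exact Quotient.sound (A.mul_assoc (A.exists_mul _ _).choose_spec (A.exists_mul _ _).choose_spec
      (A.exists_mul _ _).choose_spec (A.exists_mul _ _).choose_spec)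
  one_mul := by
    rintro ⟨a⟩
    exact Quotient.sound (A.one_mul (A.exists_one X).choose_spec (A.exists_mul _ _).choose_spec)
  mul_one := by
    rintro ⟨a⟩
    exact Quotient.sound (A.one_mul (A.exists_one X).choose_spec
      (A.mul_comm (A.exists_mul _ _).choose_spec))
  mul_comm := by
    rintro ⟨a⟩ ⟨b⟩
    exact Quotient.sound (A.mul_unique (A.exists_mul _ _).choose_spec
      (A.mul_comm (A.exists_mul _ _).choose_spec) (Setoid.refl _) (Setoid.refl _))

lemma mk_eq_one (a : Obj X) :
    letI := A.commMonoid X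
    (Quotient.mk (s X) a = 1) ↔ IsOne a :=
  ⟨fun h => A.one_congr (A.exists_one X).choose_spec (Quotient.exact h.symm),
    fun h => Quotient.sound (A.one_unique h (A.exists_one X).choose_spec)⟩

lemma mk_mul_mk (a b c : Obj X) :
    letI := A.commMonoid X
    (Quotient.mk (s X) a * Quotient.mk (s X) b = Quotient.mk (s X) c) ↔ IsMul a b c :=
  ⟨fun h => A.mul_congr (A.exists_mul a b).choose_spec (Quotient.exact h),
    fun h => Quotient.sound (A.mul_unique (A.exists_mul a b).choose_spec h (Setoid.refl _)
      (Setoid.refl _))⟩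

/-- The pullback of classes. -/
def pull (f : X ⟶ Y) : Quotient (s Y) → Quotient (s X) :=
  Quotient.map (fun a => (A.exists_pull f a).choose) fun _ _ h =>
    A.pull_unique h (A.exists_pull f _).choose_spec (A.exists_pull f _).choose_spec

lemma pull_mk (f : X ⟶ Y) (a : Obj Y) (b : Obj X) :
    A.pull f (Quotient.mk _ a) = Quotient.mk _ b ↔ IsPull f a b :=
  ⟨fun h => A.pull_congr (A.exists_pull f a).choose_spec (Quotient.exact h),
    fun h => Quotient.sound (A.pull_unique (Setoid.refl _) (A.exists_pull f a).choose_spec h)⟩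

/-- The commutative monoids of classes with their pullback maps. -/
def monoids : MonoidsOfClasses (C := fun X => Quotient (s X)) (fun {X} => Quotient.mk (s X))
    IsOne IsMul IsPull :=
  letI := A.commMonoid
  { monoid := A.commMonoid
    pull := fun {X Y} f =>
      { toFun := A.pull f
        map_one' := (A.mk_eq_one _).mpr
          (A.pull_one (A.exists_one Y).choose_spec (A.exists_pull f _).choose_spec)
        map_mul' := by
          rintro ⟨a⟩ ⟨b⟩
          exact Quotient.sound (A.pull_mul (A.exists_mul a b).choose_spec
            (A.exists_pull f _).choose_spec (A.exists_pull f _).choose_spec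
            (A.exists_pull f _).choose_spec (A.exists_mul _ _).choose_spec) }
    one_iff := A.mk_eq_one
    mul_iff := A.mk_mul_mk
    pull_iff := A.pull_mk
    pull_id := fun X => by
      ext a
      induction a using Quotient.inductionOn with | _ a =>
      exact (A.pull_mk _ _ _).mpr (A.pull_id a)
    pull_comp := fun f g => by
      ext a
      induction a using Quotient.inductionOn with | _ a =>
      exact (A.pull_mk _ _ _).mpr (A.pull_comp (A.exists_pull g a).choose_spec
        (A.exists_pull f _).choose_spec) }

end ClassLaws

lemma Discriminant.classLaws : ClassLaws Discriminant.setoid.{u} Discriminant.IsOne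
    Discriminant.IsMul Discriminant.IsPull where
  exists_one _ := exists_one
  one_unique := one_unique
  one_congr := one_congr
  exists_mul := exists_mul
  mul_unique := mul_unique
  mul_congr := mul_congr
  mul_comm := mul_comm
  mul_assoc := mul_assoc
  one_mul := one_mul
  exists_pull _ := exists_pull
  pull_congr := pull_congr
  pull_unique := pull_unique
  pull_one := pull_one
  pull_mul := pull_mul
  pull_id := pull_id
  pull_comp := pull_comp

lemma QuadraticAlgebra.classLaws : ClassLaws QuadraticAlgebra.setoid.{u} QuadraticAlgebra.IsOne
    QuadraticAlgebra.IsMul QuadraticAlgebra.IsPull where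
  exists_one _ := exists_one
  one_unique := one_unique
  one_congr := one_congr
  exists_mul := exists_mul
  mul_unique := mul_unique
  mul_congr := mul_congr
  mul_comm := mul_comm
  mul_assoc := mul_assoc_equiv
  one_mul := one_mul_equiv
  exists_pull _ := exists_pull
  pull_congr := pull_congr
  pull_unique := pull_unique
  pull_one := pull_one
  pull_mul := pull_mul
  pull_id := pull_id
  pull_comp := pull_comp

namespace InvertibleSheaf

variable {L L' L'' : InvertibleSheaf X}

/-- `L ↦ (0, L)` identifies invertible modules with the discriminants having zero form. Most laws
for `Pic` are thereby read off from those for `Disc`. -/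
lemma zeroDiscriminant_equiv :
    L.zeroDiscriminant ≈ L'.zeroDiscriminant ↔ L ≈ L' :=
  ⟨fun ⟨e, _⟩ => ⟨e⟩, fun ⟨e⟩ => ⟨e, fun _ _ _ => rfl⟩⟩

lemma zeroDiscriminant_isMul :
    L.zeroDiscriminant.IsMul L'.zeroDiscriminant L''.zeroDiscriminant ↔ L.IsMul L' L'' :=
  ⟨fun ⟨β, h, _⟩ => ⟨β, h⟩, fun ⟨β, h⟩ => ⟨β, h, fun _ _ _ _ _ => (mul_zero _).symm⟩⟩

lemma zeroDiscriminant_isPull {f : X ⟶ Y} {H : InvertibleSheaf Y} :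
    H.zeroDiscriminant.IsPull f L.zeroDiscriminant ↔ H.IsPull f L :=
  ⟨fun ⟨η, h, _⟩ => ⟨η, h⟩, fun ⟨η, h⟩ => ⟨η, h, fun _ _ _ => (map_zero _).symm⟩⟩

lemma isOne_iff : L.IsOne ↔ ∃ e : Γ(L.mod, ⊤), IsBasisOn ⊤ ![e] := by
  constructor
  · rintro ⟨φ⟩
    exact ⟨_, isBasisOn_structureModule.map_iso_one φ.symm⟩
  · rintro ⟨e, he⟩
    obtain ⟨φ, -⟩ := exists_iso_one (D := fun _ : Unit => ⊤) (fun x => ⟨⟨⟩, trivial⟩)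
      (fun _ => he) (fun _ => isBasisOn_structureModule)
      fun _ _ => ⟨1, by rw [one_smul], by rw [one_smul]⟩
    exact ⟨φ⟩

lemma classLaws : ClassLaws InvertibleSheaf.setoid.{u} InvertibleSheaf.IsOne
    InvertibleSheaf.IsMul InvertibleSheaf.IsPull where
  exists_one X := ⟨structureSheaf X, ⟨Iso.refl _⟩⟩
  one_unique := fun ⟨e⟩ ⟨e'⟩ => ⟨e ≪≫ e'.symm⟩
  one_congr := fun ⟨e⟩ ⟨e'⟩ => ⟨e'.symm ≪≫ e⟩
  exists_mul L L' := by
    obtain ⟨N, β, hβ, -⟩ := L.exists_tensor L'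
    exact ⟨N, β, hβ⟩
  mul_unique h h' hE hF := zeroDiscriminant_equiv.mp (Discriminant.mul_unique
    (zeroDiscriminant_isMul.mpr h) (zeroDiscriminant_isMul.mpr h')
    (zeroDiscriminant_equiv.mpr hE) (zeroDiscriminant_equiv.mpr hF))
  mul_congr h h' := zeroDiscriminant_isMul.mp (Discriminant.mul_congr
    (zeroDiscriminant_isMul.mpr h) (zeroDiscriminant_equiv.mpr h'))
  mul_comm h := zeroDiscriminant_isMul.mp (Discriminant.mul_comm (zeroDiscriminant_isMul.mpr h))
  mul_assoc h₁ h₂ h₃ h₄ := zeroDiscriminant_equiv.mp (Discriminant.mul_assoc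
    (zeroDiscriminant_isMul.mpr h₁) (zeroDiscriminant_isMul.mpr h₂)
    (zeroDiscriminant_isMul.mpr h₃) (zeroDiscriminant_isMul.mpr h₄))
  -- The unit laws cannot be transferred, since `(0, O_X)` is in general not the unit of `Disc(X)`.
  one_mul {X L L' N} hL := fun ⟨β, hβ⟩ => by
    obtain ⟨e, he⟩ := isOne_iff.mp hL
    obtain ⟨D, f, hD, hf⟩ := L'.exists_frames
    obtain ⟨φ, -⟩ := exists_iso_one (fun x => ⟨x, hD x⟩)
      (fun x => hβ.isBasisOn (he.restrict_one (le_top : D x ≤ ⊤)) (hf x)) hf fun i j => by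
        obtain ⟨v, hv⟩ := exists_transition_one (f i) (hf j)
        refine ⟨1 * v, β.res_app_of_transition ?_ hv, by rwa [_root_.one_mul]⟩
        rw [res_res, res_res, one_smul]
    exact ⟨φ⟩
  exists_pull f L := by
    obtain ⟨L', η, hη, -⟩ := L.exists_pull (f := f)
    exact ⟨L', η, hη⟩
  pull_congr h h' := zeroDiscriminant_isPull.mp (Discriminant.pull_congr
    (zeroDiscriminant_isPull.mpr h) (zeroDiscriminant_equiv.mpr h'))
  pull_unique h h₁ h₂ := zeroDiscriminant_equiv.mp (Discriminant.pull_unique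
    (zeroDiscriminant_equiv.mpr h) (zeroDiscriminant_isPull.mpr h₁)
    (zeroDiscriminant_isPull.mpr h₂))
  pull_one h := fun ⟨η, hη⟩ => by
    obtain ⟨e, he⟩ := isOne_iff.mp h
    exact isOne_iff.mpr ⟨_, hη.isBasisOn he⟩
  pull_mul h h₁ h₂ h₃ h' := zeroDiscriminant_equiv.mp (Discriminant.pull_mul
    (zeroDiscriminant_isMul.mpr h) (zeroDiscriminant_isPull.mpr h₁)
    (zeroDiscriminant_isPull.mpr h₂) (zeroDiscriminant_isPull.mpr h₃)
    (zeroDiscriminant_isMul.mpr h'))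
  pull_id L := zeroDiscriminant_isPull.mp (Discriminant.pull_id _)
  pull_comp h h' := zeroDiscriminant_isPull.mp (Discriminant.pull_comp
    (zeroDiscriminant_isPull.mpr h) (zeroDiscriminant_isPull.mpr h'))

end InvertibleSheaf

/-- The commutative monoids `Pic(X)`. -/
def picMonoids : PicMonoids.{u} := InvertibleSheaf.classLaws.monoids

/-- The commutative monoids `Disc(X)`. -/
def discMonoids : DiscMonoids.{u} := Discriminant.classLaws.monoids

/-- The commutative monoids `Quad(X)`. -/
def quadMonoids : QuadMonoids.{u} := QuadraticAlgebra.classLaws.monoids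

end

/-! ### The homomorphisms of the diagram and the exactness of its rows -/

section

variable {X Y Z : Scheme.{u}} {M N K : X.Modules} {U V W : X.Opens}

/-- The properties of a relation between the objects of two families of monoids of classes that
make it into a homomorphism, natural with respect to pullback. -/
structure ClassHom {Obj Obj' : Scheme.{u} → Type (u + 1)} {s : ∀ X, Setoid (Obj X)}
    {IsOne : ∀ {X}, Obj X → Prop} {IsMul : ∀ {X}, Obj X → Obj X → Obj X → Prop}
    {IsPull : ∀ {X Y} (_ : X ⟶ Y), Obj Y → Obj X → Prop} {s' : ∀ X, Setoid (Obj' X)}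
    {IsOne' : ∀ {X}, Obj' X → Prop} {IsMul' : ∀ {X}, Obj' X → Obj' X → Obj' X → Prop}
    {IsPull' : ∀ {X Y} (_ : X ⟶ Y), Obj' Y → Obj' X → Prop}
    (A : ClassLaws s IsOne IsMul IsPull) (B : ClassLaws s' IsOne' IsMul' IsPull')
    (R : ∀ {X}, Obj X → Obj' X → Prop) : Prop where
  exists_rel : ∀ {X} (a : Obj X), ∃ b, R a b
  congr : ∀ {X} {a : Obj X} {b b' : Obj' X}, R a b → b ≈ b' → R a b'
  unique : ∀ {X} {a a' : Obj X} {b b' : Obj' X}, a ≈ a' → R a b → R a' b' → b ≈ b'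
  one : ∀ {X} {a : Obj X} {b : Obj' X}, IsOne a → R a b → IsOne' b
  mul : ∀ {X} {a b c : Obj X} {a' b' c' d : Obj' X}, IsMul a b c → R a a' → R b b' → R c c' →
    IsMul' a' b' d → c' ≈ d
  pull : ∀ {X Y} {f : X ⟶ Y} {a : Obj Y} {b : Obj X} {a' : Obj' Y} {b' d : Obj' X},
    IsPull f a b → R a a' → R b b' → IsPull' f a' d → b' ≈ d

namespace ClassHom

variable {Obj Obj' : Scheme.{u} → Type (u + 1)} {s : ∀ X, Setoid (Obj X)}
  {IsOne : ∀ {X}, Obj X → Prop} {IsMul : ∀ {X}, Obj X → Obj X → Obj X → Prop}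
  {IsPull : ∀ {X Y} (_ : X ⟶ Y), Obj Y → Obj X → Prop} {s' : ∀ X, Setoid (Obj' X)}
  {IsOne' : ∀ {X}, Obj' X → Prop} {IsMul' : ∀ {X}, Obj' X → Obj' X → Obj' X → Prop}
  {IsPull' : ∀ {X Y} (_ : X ⟶ Y), Obj' Y → Obj' X → Prop}
  {A : ClassLaws s IsOne IsMul IsPull} {B : ClassLaws s' IsOne' IsMul' IsPull'}
  {R : ∀ {X}, Obj X → Obj' X → Prop} (h : ClassHom A B R)

/-- The map of classes. -/
def map (X : Scheme.{u}) : Quotient (s X) → Quotient (s' X) :=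
  Quotient.map (fun a => (h.exists_rel a).choose) fun _ _ e =>
    h.unique e (h.exists_rel _).choose_spec (h.exists_rel _).choose_spec

lemma map_mk (a : Obj X) (b : Obj' X) :
    h.map X (Quotient.mk _ a) = Quotient.mk _ b ↔ R a b :=
  ⟨fun e => h.congr (h.exists_rel a).choose_spec (Quotient.exact e),
    fun e => Quotient.sound (h.unique (Setoid.refl _) (h.exists_rel a).choose_spec e)⟩

/-- The homomorphism of monoids of classes. -/
def monoidHom (X : Scheme.{u}) :
    letI := A.commMonoid X
    letI := B.commMonoid X
    Quotient (s X) →* Quotient (s' X) :=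
  letI := A.commMonoid X
  letI := B.commMonoid X
  { toFun := h.map X
    map_one' := (B.mk_eq_one _).mpr
      (h.one (A.exists_one X).choose_spec (h.exists_rel _).choose_spec)
    map_mul' := by
      rintro ⟨a⟩ ⟨b⟩
      exact Quotient.sound (h.mul (A.exists_mul a b).choose_spec (h.exists_rel _).choose_spec
        (h.exists_rel _).choose_spec (h.exists_rel _).choose_spec (B.exists_mul _ _).choose_spec) }

/-- The natural homomorphism of monoids of classes. -/
def natTrans : A.monoids.functor ⟶ B.monoids.functor where
  app X :=
    letI := A.commMonoid X.unop
    letI := B.commMonoid X.unop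
    CommMonCat.ofHom (h.monoidHom X.unop)
  naturality X Y f := by
    ext a
    induction a using Quotient.inductionOn with | _ a =>
    exact Quotient.sound (h.pull (A.exists_pull f.unop a).choose_spec
      (h.exists_rel _).choose_spec (h.exists_rel _).choose_spec (B.exists_pull _ _).choose_spec)

lemma natTrans_app_mk (a : Obj X) (b : Obj' X) :
    h.natTrans.app (op X) (Quotient.mk (s X) a) = Quotient.mk (s' X) b ↔ R a b :=
  h.map_mk a b

end ClassHom

lemma QuadraticAlgebra.classHom_hasDisc :
    ClassHom QuadraticAlgebra.classLaws.{u} Discriminant.classLaws QuadraticAlgebra.HasDisc where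
  exists_rel := exists_disc
  congr := hasDisc_congr
  unique := disc_unique
  one := disc_one
  mul := disc_mul
  pull := disc_pull

lemma Discriminant.classHom_toInvertibleSheaf :
    ClassHom Discriminant.classLaws.{u} InvertibleSheaf.classLaws
      fun D L => D.toInvertibleSheaf ≈ L where
  exists_rel _ := ⟨_, Setoid.refl _⟩
  congr := Setoid.trans
  unique := fun ⟨e, _⟩ h h' => Setoid.trans (Setoid.symm h) (Setoid.trans ⟨e⟩ h')
  one := fun ⟨e, he, _⟩ h => InvertibleSheaf.classLaws.one_congr
    (InvertibleSheaf.isOne_iff.mpr ⟨e, he⟩) h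
  mul := fun ⟨β, hβ, _⟩ h₁ h₂ h₃ h => Setoid.trans (Setoid.symm h₃)
    (InvertibleSheaf.classLaws.mul_unique ⟨β, hβ⟩ h h₁ h₂)
  pull := fun ⟨η, hη, _⟩ h₁ h₂ h => Setoid.trans (Setoid.symm h₂)
    (InvertibleSheaf.classLaws.pull_unique h₁ ⟨η, hη⟩ h)

/-- The discriminant, as a homomorphism `Quad(X) ⟶ Disc(X)`. -/
def discHom : quadMonoids.{u}.functor ⟶ discMonoids.functor :=
  QuadraticAlgebra.classHom_hasDisc.natTrans

/-- The homomorphism `Disc(X) ⟶ Pic(X)`, `(d, L) ↦ L`. -/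
def picHom : discMonoids.{u}.functor ⟶ picMonoids.functor :=
  Discriminant.classHom_toInvertibleSheaf.natTrans

lemma discHom_app (S : QuadraticAlgebra X) (D : Discriminant X) :
    discHom.app (op X) (Quad.mk S) = Disc.mk D ↔ S.HasDisc D :=
  QuadraticAlgebra.classHom_hasDisc.natTrans_app_mk S D

lemma picHom_app (D : Discriminant X) :
    picHom.app (op X) (Disc.mk D) = Pic.mk D.toInvertibleSheaf :=
  (Discriminant.classHom_toInvertibleSheaf.natTrans_app_mk D _).mpr (Setoid.refl _)

/-- The map to `Pic` is taken to be the discriminant followed by the forgetful map, so the right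
square commutes by construction; it remains to recognize this composite as the exterior square. -/
lemma wedgeHom_app (S : QuadraticAlgebra X) (L : InvertibleSheaf X) :
    (discHom ≫ picHom).app (op X) (Quad.mk S) = Pic.mk L ↔ S.HasWedge L.mod := by
  obtain ⟨D, hD⟩ := S.exists_disc
  rw [QuadraticAlgebra.hasWedge_iff hD]
  have : (discHom ≫ picHom).app (op X) (Quad.mk S) = Pic.mk D.toInvertibleSheaf :=
    (congrArg (picHom.app (op X)) ((discHom_app S D).mpr hD)).trans (picHom_app D)
  rw [this]
  exact ⟨fun h => Quotient.exact h, fun h => Quotient.sound h⟩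

section Kernel

variable {F G H : Scheme.{u}ᵒᵖ ⥤ CommMonCat.{u + 1}}

/-- The kernel of a natural homomorphism. -/
def kernelFunctor (α : F ⟶ G) : Scheme.{u}ᵒᵖ ⥤ CommMonCat.{u + 1} where
  obj X := CommMonCat.of (MonoidHom.mker (α.app X).hom)
  map {X Y} f := CommMonCat.ofHom (((F.map f).hom.comp (Submonoid.subtype _)).codRestrict _
    fun c => by
      have := ConcreteCategory.congr_hom (α.naturality f) c.1
      refine MonoidHom.mem_mker.mpr (this.trans ?_)
      exact (congrArg (G.map f) (MonoidHom.mem_mker.mp c.2)).trans (map_one (G.map f).hom)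
    : MonoidHom.mker (α.app X).hom →* MonoidHom.mker (α.app Y).hom)
  map_id X := by
    ext c
    exact ConcreteCategory.congr_hom (F.map_id X) c.1
  map_comp f g := by
    ext c
    exact ConcreteCategory.congr_hom (F.map_comp f g) c.1

/-- The inclusion of the kernel. -/
def kernelInclusion (α : F ⟶ G) : kernelFunctor α ⟶ F where
  app X := CommMonCat.ofHom (Submonoid.subtype _)

lemma kernelInclusion_injective (α : F ⟶ G) (X) :
    Function.Injective ((kernelInclusion α).app X) := Subtype.val_injective

lemma range_kernelInclusion (α : F ⟶ G) (X) :
    Set.range ((kernelInclusion α).app X) = {c | α.app X c = 1} := by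
  ext c
  exact ⟨by rintro ⟨a, rfl⟩; exact a.2, fun h => ⟨⟨c, h⟩, rfl⟩⟩

/-- The map from the kernel of `α ≫ β` to the kernel of `β`. -/
def kernelMap (α : F ⟶ G) (β : G ⟶ H) : kernelFunctor (α ≫ β) ⟶ kernelFunctor β where
  app X := CommMonCat.ofHom (((α.app X).hom.comp (Submonoid.subtype _)).codRestrict _
    (fun c => MonoidHom.mem_mker.mpr (MonoidHom.mem_mker.mp c.2)) :
      MonoidHom.mker ((α ≫ β).app X).hom →* MonoidHom.mker (β.app X).hom)
  naturality X Y f := by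
    ext c
    exact Subtype.ext (ConcreteCategory.congr_hom (α.naturality f) c.1)

lemma kernelMap_surjective (α : F ⟶ G) (β : G ⟶ H) (X) (h : Function.Surjective (α.app X)) :
    Function.Surjective ((kernelMap α β).app X) := by
  rintro ⟨d, hd⟩
  obtain ⟨c, rfl⟩ := h d
  exact ⟨⟨c, hd⟩, rfl⟩

lemma kernelInclusion_comp (α : F ⟶ G) (β : G ⟶ H) :
    kernelInclusion (α ≫ β) ≫ α = kernelMap α β ≫ kernelInclusion β := rfl

/-- Exactness in the presence of an element of the kernel that absorbs the fibres. -/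
lemma monExact_kernelInclusion (α : F ⟶ G) (X) (hs : Function.Surjective (α.app X)) (z : F.obj X)
    (hz : α.app X z = 1) (h : ∀ a b, α.app X a = α.app X b → z * a = z * b) :
    MonExact ((kernelInclusion α).app X) (α.app X) := by
  -- The absorbing element serves as both witnesses `x` and `y`.
  refine ⟨kernelInclusion_injective α X, hs, fun a b => ⟨fun e => ⟨⟨z, hz⟩, ⟨z, hz⟩, h a b e⟩, ?_⟩⟩
  rintro ⟨x, y, e⟩
  have := congrArg (α.app X).hom e
  rw [map_mul, map_mul] at this
  have hx : (α.app X).hom ((kernelInclusion α).app X x) = 1 := x.2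
  have hy : (α.app X).hom ((kernelInclusion α).app X y) = 1 := y.2
  rw [hx, hy, one_mul, one_mul] at this
  exact this

end Kernel

lemma mk_structureSheaf :
    Pic.mk (InvertibleSheaf.structureSheaf X) = (1 : picMonoids.functor.obj (op X)) :=
  (InvertibleSheaf.classLaws.mk_eq_one _).mpr ⟨Iso.refl _⟩

lemma range_kernelInclusion_quad : Set.range ((kernelInclusion (discHom ≫ picHom)).app (op X)) =
    QuadWith X (structureModule X) := by
  rw [range_kernelInclusion]
  ext c
  induction c using Quotient.inductionOn with | _ S =>
  have key : ∀ S, (discHom ≫ picHom).app (op X) (Quad.mk S) = 1 ↔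
      S.HasWedge (structureModule X) := fun S => by
    rw [← mk_structureSheaf]
    exact wedgeHom_app S _
  refine ⟨fun h => ⟨S, rfl, (key S).mp h⟩, ?_⟩
  rintro ⟨T, hT, h⟩
  exact ((congrArg _ hT).symm.trans ((key T).mpr h) :)

lemma range_kernelInclusion_disc : Set.range ((kernelInclusion picHom).app (op X)) =
    DiscWith X (structureModule X) := by
  rw [range_kernelInclusion]
  ext c
  induction c using Quotient.inductionOn with | _ D =>
  have key : ∀ D, picHom.app (op X) (Disc.mk D) = 1 ↔
      Nonempty (D.mod ≅ structureModule X) := fun D => by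
    rw [← mk_structureSheaf, picHom_app]
    exact ⟨fun h => Quotient.exact h, fun h => Quotient.sound h⟩
  refine ⟨fun h => ⟨D, rfl, (key D).mp h⟩, ?_⟩
  rintro ⟨T, hT, h⟩
  exact ((congrArg _ hT).symm.trans ((key T).mpr h) :)

lemma picHom_surjective (X : Scheme.{u}) : Function.Surjective (picHom.app (op X)) := by
  intro c
  induction c using Quotient.inductionOn with | _ L =>
  exact ⟨Disc.mk L.zeroDiscriminant, picHom_app _⟩

/-- The algebra `O_X ⊕ L` with `L² = 0` has exterior square `L`; it is the case `t = n = 0`. -/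
lemma wedgeHom_surjective (X : Scheme.{u}) :
    Function.Surjective ((discHom ≫ picHom).app (op X)) := by
  intro c
  induction c using Quotient.inductionOn with | _ L =>
  obtain ⟨S, -, -, -, hS⟩ := QuadraticAlgebra.exists_quadraticAlgebra_of_forms L.zeroDiscriminant
    (fun _ => 0) (fun _ => 0) (by simp) (by simp)
    (fun _ => by
      rw [mul_zero, sub_zero, zero_pow two_ne_zero]
      rfl)
  exact ⟨Quad.mk S, (wedgeHom_app S L).mpr ((QuadraticAlgebra.hasWedge_iff hS).mpr ⟨Iso.refl _⟩)⟩

theorem monExact_disc (X : Scheme.{u}) :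
    MonExact ((kernelInclusion picHom).app (op X)) (picHom.app (op X)) := by
  obtain ⟨Z, hZ, h⟩ := Discriminant.exists_absorbing X
  refine monExact_kernelInclusion _ _ (picHom_surjective X) (Disc.mk Z) ?_ fun a b => ?_
  · rw [← mk_structureSheaf, picHom_app]
    exact Quotient.sound hZ
  · induction a using Quotient.inductionOn with | _ D =>
    induction b using Quotient.inductionOn with | _ E =>
    intro e
    have e' : D.toInvertibleSheaf ≈ E.toInvertibleSheaf :=
      Quotient.exact ((picHom_app D).symm.trans (e.trans (picHom_app E)))
    exact Quotient.sound (h _ _ _ _ e' (Discriminant.exists_mul Z D).choose_spec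
      (Discriminant.exists_mul Z E).choose_spec)

theorem monExact_quad (X : Scheme.{u}) :
    MonExact ((kernelInclusion (discHom ≫ picHom)).app (op X))
      ((discHom ≫ picHom).app (op X)) := by
  obtain ⟨Z, hZ, h⟩ := QuadraticAlgebra.exists_absorbing X
  refine monExact_kernelInclusion _ _ (wedgeHom_surjective X) (Quad.mk Z) ?_ fun a b => ?_
  · rw [← mk_structureSheaf]
    exact (wedgeHom_app Z _).mpr hZ
  · induction a using Quotient.inductionOn with | _ S =>
    induction b using Quotient.inductionOn with | _ T =>
    intro e
    obtain ⟨D, hD⟩ := S.exists_disc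
    obtain ⟨E, hE⟩ := T.exists_disc
    have e' := e.trans ((wedgeHom_app T E.toInvertibleSheaf).mpr
      ((QuadraticAlgebra.hasWedge_iff hE).mpr ⟨Iso.refl _⟩))
    exact Quotient.sound (h _ _ _ _ _ _ hD hE
      ((QuadraticAlgebra.hasWedge_iff hD).mp ((wedgeHom_app S _).mp e'))
      (QuadraticAlgebra.exists_mul Z S).choose_spec (QuadraticAlgebra.exists_mul Z T).choose_spec)

end

section

variable {X Y Z : Scheme.{u}} {M N K : X.Modules} {U V W : X.Opens}

/-! ### Sections over affine opens -/

/-- `W` is only required to equal a basic open set, so that `V ⊓ X.basicOpen g` with `g` global may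
be used. -/
lemma exists_pow_mul_eq_resO (hV : IsAffineOpen V) (g : Γ(X, V)) (hW : W = X.basicOpen g)
    (h : W ≤ V) (s : Γ(X, W)) : ∃ (n : ℕ) (y : Γ(X, V)), resO h y = resO h g ^ n * s := by
  subst hW
  exact exists_eq_pow_mul_of_isAffineOpen X V hV g s

lemma exists_pow_mul_eq_zero (hV : IsCompact (V : Set X)) (g : Γ(X, V)) (hW : W = X.basicOpen g)
    (h : W ≤ V) {a : Γ(X, V)} (ha : resO h a = 0) : ∃ n : ℕ, g ^ n * a = 0 := by
  subst hW
  exact exists_pow_mul_eq_zero_of_res_basicOpen_eq_zero_of_isCompact X hV a g ha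

/-- One power of `g` clears the denominator of the quotient, another kills the error, which vanishes
on `W`. -/
lemma exists_dvd_pow_mul (hV : IsAffineOpen V) (g : Γ(X, V)) (hW : W = X.basicOpen g)
    (h : W ≤ V) {k : ℕ} {a : Γ(X, V)} (ha : (k : Γ(X, W)) ∣ resO h a) :
    ∃ n : ℕ, (k : Γ(X, V)) ∣ g ^ n * a := by
  obtain ⟨b, hb⟩ := ha
  obtain ⟨n, y, hy⟩ := exists_pow_mul_eq_resO hV g hW h b
  obtain ⟨m, hm⟩ := exists_pow_mul_eq_zero hV.isCompact g hW h (a := g ^ n * a - k * y) (by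
    rw [resO_sub, resO_mul, resO_mul, resO_pow, hy, hb, resO_natCast]
    ring)
  exact ⟨m + n, g ^ m * y, by linear_combination hm⟩

lemma basicOpen_resO_top {g : Γ(X, ⊤)} :
    V ⊓ X.basicOpen g = X.basicOpen (resO (le_top : V ≤ ⊤) g) :=
  (X.basicOpen_res g (homOfLE le_top).op).symm

/-- An ideal of functions on an affine open that contains a denominator near each point contains
all functions. -/
lemma ideal_eq_top_of_basicOpen (hV : IsAffineOpen V) (J : Ideal Γ(X, V))
    (h : ∀ x ∈ V, ∃ f ∈ J, x ∈ X.basicOpen f) : J = ⊤ := by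
  rw [← Ideal.span_eq J, ← hV.self_le_iSup_basicOpen_iff]
  intro x hx
  obtain ⟨f, hf, hxf⟩ := h x hx
  exact Opens.mem_iSup.mpr ⟨⟨f, hf⟩, hxf⟩

/-- The multipliers `f` with `k ∣ f * a` form an ideal, and near every point it contains a power of
a suitable `g`. On an affine open set such an ideal contains `1`. -/
lemma LocallyDvd.dvd {k : ℕ} {a : Γ(X, V)} (ha : LocallyDvd k a) (hV : IsAffineOpen V) :
    (k : Γ(X, V)) ∣ a := by
  let J : Ideal Γ(X, V) :=
    Submodule.comap (LinearMap.mulRight Γ(X, V) a) (Ideal.span {(k : Γ(X, V))})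
  have hJ : ∀ f, f ∈ J ↔ (k : Γ(X, V)) ∣ f * a := fun f => Ideal.mem_span_singleton
  have : (1 : Γ(X, V)) ∈ J := by
    rw [ideal_eq_top_of_basicOpen hV J fun x hx => ?_]
    · trivial
    obtain ⟨W, hW, hxW, hd⟩ := ha x hx
    obtain ⟨g, hg, hxg⟩ := hV.exists_basicOpen_le ⟨x, hxW⟩ hx
    obtain ⟨n, hn⟩ := exists_dvd_pow_mul hV g rfl (X.basicOpen_le g) (k := k) (a := a) (by
      have := map_dvd (resHom hg) hd
      simpa [resHom_apply] using this)
    -- The exponent must be positive for `g` and its power to have the same basic open set.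
    refine ⟨g ^ (n + 1), (hJ _).mpr ?_, ?_⟩
    · rw [pow_succ', mul_assoc]
      exact hn.mul_left _
    · rwa [X.basicOpen_pow g n.succ_pos]
  simpa using (hJ 1).mp this


/-- On a finite cover one exponent works for all indices: the sum of the individual ones, which
dominates each. -/
lemma exists_uniform_exponent {ι : Type*} [Finite ι] {P : ι → ℕ → Prop} (h : ∀ i, ∃ n, P i n)
    (hP : ∀ i m n, P i m → P i (n + m)) : ∃ n, ∀ i, P i n := by
  cases nonempty_fintype ι
  choose n hn using h
  refine ⟨∑ i, n i, fun i => ?_⟩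
  rw [← Nat.sub_add_cancel (Finset.single_le_sum (f := n) (fun _ _ => Nat.zero_le _)
    (Finset.mem_univ i))]
  exact hP _ _ _ (hn i)

/-- Over an affine scheme, a global section of the quotient of an invertible module by a
quasi-coherent submodule lifts; the invertible module is given by a cocycle `v`, and the submodule
by ideals `A V`. -/
theorem exists_lift_of_isAffine [IsAffine X] {ι : Type*} [Finite ι] {D : ι → X.Opens}
    (hD : ∀ x, ∃ i, x ∈ D i) (hDa : ∀ i, IsAffineOpen (D i)) (v : ∀ i j, Γ(X, D i ⊓ D j))
    (v_mul : ∀ (i j k : ι) (W : X.Opens) (hij : W ≤ D i ⊓ D j) (hjk : W ≤ D j ⊓ D k)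
      (hik : W ≤ D i ⊓ D k), resO hij (v i j) * resO hjk (v j k) = resO hik (v i k))
    (A : ∀ V : X.Opens, Ideal Γ(X, V))
    (A_res : ∀ (V W : X.Opens) (h : W ≤ V) (a : Γ(X, V)), a ∈ A V → resO h a ∈ A W)
    (A_pow : ∀ (V W : X.Opens) (h : W ≤ V) (g a : Γ(X, V)), IsAffineOpen V → W = X.basicOpen g →
      resO h a ∈ A W → ∃ n : ℕ, g ^ n * a ∈ A V)
    (τ : ∀ i, Γ(X, D i))
    (hτ : ∀ i j, resO inf_le_left (τ i) - v i j * resO inf_le_right (τ j) ∈ A (D i ⊓ D j)) :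
    ∃ c : ∀ i, Γ(X, D i), (∀ i j, resO inf_le_left (c i) = v i j * resO inf_le_right (c j)) ∧
      ∀ i, c i - τ i ∈ A (D i) := by
  -- `J` consists of the functions `f` for which `f • τ` lifts. As an ideal it can be shown to be
  -- everything by working near one point at a time.
  let J : Ideal Γ(X, ⊤) :=
    { carrier := {f | ∃ c : ∀ i, Γ(X, D i),
        (∀ i j, resO inf_le_left (c i) = v i j * resO inf_le_right (c j)) ∧
        ∀ i, c i - resO le_top f * τ i ∈ A (D i)}
      zero_mem' := ⟨fun _ => 0, by simp, by simp⟩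
      add_mem' := by
        rintro f f' ⟨c, h, h'⟩ ⟨d, k, k'⟩
        refine ⟨fun i => c i + d i, fun i j => ?_, fun i => ?_⟩
        · rw [resO_add, resO_add, h, k]
          ring
        · convert (A (D i)).add_mem (h' i) (k' i) using 1
          rw [resO_add]
          ring
      smul_mem' := by
        rintro a f ⟨c, h, h'⟩
        refine ⟨fun i => resO le_top a * c i, fun i j => ?_, fun i => ?_⟩
        · rw [resO_mul, resO_mul, h, resO_resO, resO_resO]
          ring
        · convert (A (D i)).mul_mem_left (resO le_top a) (h' i) using 1
          rw [smul_eq_mul, resO_mul]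
          ring }
  have h1 : (1 : Γ(X, ⊤)) ∈ J := by
    rw [ideal_eq_top_of_basicOpen (isAffineOpen_top X) J fun x _ => ?_]
    · trivial
    obtain ⟨k, hk⟩ := hD x
    -- On `X.basicOpen g`, which lies in `D k`, the module is trivialized by the generator `k`, and
    -- there the family `v i k * τ k` is a lift of `τ`. The three exponents below extend it, after
    -- multiplication by powers of `g`, to all the `D i`.
    obtain ⟨g, hg, hxg⟩ := (isAffineOpen_top X).exists_basicOpen_le ⟨x, hk⟩ trivial
    have hle : ∀ i, D i ⊓ X.basicOpen g ≤ D i ⊓ D k := fun i => inf_le_inf_left _ hg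
    obtain ⟨N, hN⟩ := exists_uniform_exponent (P := fun i n => ∃ y : Γ(X, D i),
      resO (inf_le_left : D i ⊓ X.basicOpen g ≤ D i) y =
        resO le_top g ^ n * (resO (hle i) (v i k) * resO ((hle i).trans inf_le_right) (τ k)))
      (fun i => by
        simpa using exists_pow_mul_eq_resO (hDa i) (resO le_top g) basicOpen_resO_top inf_le_left _)
      (fun i m n ⟨y, hy⟩ => ⟨resO le_top g ^ n * y, by
        rw [resO_mul, resO_pow, resO_resO, hy]
        ring⟩)
    choose y hy using hN
    -- The extensions satisfy the cocycle relation on `X.basicOpen g`, hence everywhere after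
    -- multiplication by `g ^ m`.
    obtain ⟨m, hm⟩ := exists_uniform_exponent (ι := ι × ι) (P := fun i m =>
      resO le_top g ^ m *
        (resO inf_le_left (y i.1) - v i.1 i.2 * resO inf_le_right (y i.2)) = 0)
      (fun i => by
        refine exists_pow_mul_eq_zero (QuasiSeparatedSpace.inter_isCompact _ _ (D i.1).2
          (hDa i.1).isCompact (D i.2).2 (hDa i.2).isCompact) _ basicOpen_resO_top inf_le_left ?_
        have e1 := congrArg (resO (inf_le_inf_right _ inf_le_left :
          D i.1 ⊓ D i.2 ⊓ X.basicOpen g ≤ D i.1 ⊓ X.basicOpen g)) (hy i.1)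
        have e2 := congrArg (resO (inf_le_inf_right _ inf_le_right :
          D i.1 ⊓ D i.2 ⊓ X.basicOpen g ≤ D i.2 ⊓ X.basicOpen g)) (hy i.2)
        simp only [resO_mul, resO_pow, resO_resO] at e1 e2
        rw [resO_sub, resO_mul, resO_resO, resO_resO, e1, e2,
          ← v_mul i.1 i.2 k _ inf_le_left ((inf_le_inf_right _ inf_le_right).trans (hle i.2))]
        ring)
      (fun i m n h => by rw [pow_add, mul_assoc, h, mul_zero])
    -- On `X.basicOpen g` the extensions are congruent to `g ^ N * τ i` modulo `A` by `hτ`;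
    -- quasi-coherence in the form of `A_pow` spreads this out.
    obtain ⟨p, hp⟩ := exists_uniform_exponent (P := fun i p =>
      resO le_top g ^ p * (resO le_top g ^ m * (y i - resO le_top g ^ N * τ i)) ∈ A (D i))
      (fun i => by
        refine A_pow _ _ inf_le_left _ _ (hDa i) basicOpen_resO_top ?_
        have := (A _).mul_mem_left (-resO le_top g ^ (m + N)) (A_res _ _ (hle i) _ (hτ i k))
        convert this using 1
        simp only [resO_mul, resO_sub, resO_pow, resO_resO, hy]
        ring)
      (fun i m n h => by
        rw [pow_add, mul_assoc]
        exact (A _).mul_mem_left _ h)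
    -- The additional factor `g` makes the exponent positive.
    refine ⟨g ^ (p + m + N + 1), ⟨fun i => resO le_top g ^ (p + m + 1) * y i, fun i j => ?_,
      fun i => ?_⟩, by rwa [X.basicOpen_pow g (Nat.succ_pos _)]⟩
    · simp only [resO_mul, resO_pow, resO_resO]
      linear_combination resO le_top g ^ (p + 1) * hm (i, j)
    · convert (A (D i)).mul_mem_left (resO le_top g) (hp i) using 1
      rw [resO_pow]
      ring
  obtain ⟨c, h, h'⟩ := h1
  exact ⟨c, h, fun i => by simpa using h' i⟩

/-- The sections that are locally multiples of `k`. -/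
def multiples (k : ℕ) (V : X.Opens) : Ideal Γ(X, V) where
  carrier := {a | LocallyDvd k a}
  zero_mem' := .zero
  add_mem' := .add
  smul_mem' c _ h := h.mul_left c

/-- The sections that are killed by `k`. -/
def torsion (k : ℕ) (V : X.Opens) : Ideal Γ(X, V) where
  carrier := {a | (k : Γ(X, V)) * a = 0}
  zero_mem' := mul_zero _
  add_mem' {a b} ha hb := by
    rw [Set.mem_ofPred_eq] at *
    rw [mul_add, ha, hb, add_zero]
  smul_mem' c a h := by
    rw [Set.mem_ofPred_eq] at *
    rw [smul_eq_mul, mul_left_comm, h, mul_zero]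

/-- The domains of the local roots are shrunk to basic open sets, which are affine, and compactness
leaves finitely many. -/
lemma Discriminant.exists_finite_roots [IsAffine X] (E : Discriminant X) :
    ∃ (ι : Type u) (_ : Finite ι) (F : ι → Frame E.mod) (τ : ∀ i, Γ(X, (F i).1)),
      (∀ x, ∃ i, x ∈ (F i).1) ∧ (∀ i, IsAffineOpen (F i).1) ∧
      (∀ i, LocallyDvd 4 (E.form.app _ (F i).2.1 (F i).2.1 - τ i ^ 2)) ∧
      ∀ i j, LocallyDvd 2 (resO inf_le_left (τ i) - (F i).tr (F j) * resO inf_le_right (τ j)) := by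
  obtain ⟨U, e, τ, hU, he, h4, h2⟩ := E.exists_roots
  choose g hg hgx using fun x => (isAffineOpen_top X).exists_basicOpen_le ⟨x, hU x⟩ trivial
  obtain ⟨T, hT⟩ := isCompact_univ.elim_nhds_subcover (fun x : X => (X.basicOpen (g x) : Set X))
    fun x _ => (X.basicOpen (g x)).2.mem_nhds (hgx x)
  refine ⟨T, inferInstance, fun i => ⟨X.basicOpen (g i), _, (he i).restrict_one (hg i)⟩,
    fun i => resO (hg i) (τ i), fun x => ?_, fun i => (isAffineOpen_top X).basicOpen _,
    fun i => ?_, fun i j => ?_⟩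
  · obtain ⟨i, hi, hx⟩ := Set.mem_iUnion₂.mp (hT.2 (Set.mem_univ x))
    exact ⟨⟨i, hi⟩, hx⟩
  · rw [← E.form.map_res, ← resO_pow, ← resO_sub]
    exact (h4 i).restrict _
  · obtain ⟨v, hv⟩ := exists_transition_one (e i) (he j)
    have hle := inf_le_inf (hg i) (hg j)
    have e1 := Frame.tr_spec
      (i := (⟨X.basicOpen (g i), _, (he i).restrict_one (hg i)⟩ : Frame E.mod))
      ⟨X.basicOpen (g j), _, (he j).restrict_one (hg j)⟩
    have e2 := congrArg (res hle) hv
    rw [res_smul, res_res, res_res] at e2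
    rw [res_res, res_res, e2] at e1
    rw [← (he j).cancel_one _ e1, resO_resO, resO_resO]
    have := (h2 i j v hv).restrict hle
    rwa [resO_sub, resO_mul, resO_resO, resO_resO] at this

/-- Over an affine scheme, every discriminant is the discriminant of a quadratic algebra. -/
theorem exists_hasDisc_of_isAffine [IsAffine X] (E : Discriminant X) :
    ∃ S : QuadraticAlgebra X, S.HasDisc E := by
  obtain ⟨ι, _, F, τ, hD, hDa, h4, h2⟩ := E.exists_finite_roots
  -- First lifting, modulo multiples of `2`: the square root becomes a global linear form with
  -- values `c i`.
  obtain ⟨c, hc, hcτ⟩ := exists_lift_of_isAffine hD hDa (fun i j => (F i).tr (F j))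
    (fun i j k W _ _ _ => Frame.tr_mul _ _ _) (multiples 2) (fun V W h a ha => ha.restrict h)
    (fun V W h g a hV hW ha => by
      obtain ⟨n, hn⟩ := exists_dvd_pow_mul hV g hW h
        (LocallyDvd.dvd ha (hW ▸ hV.basicOpen g))
      exact ⟨n, .of_dvd hn⟩) τ h2
  -- From `d = τ² + 4 a` and `c = τ + 2 b` one gets `c² - d = 4 (b c - b² - a)`.
  have hdvd : ∀ i, ∃ n, c i ^ 2 - 4 * n = E.form.app _ (F i).2.1 (F i).2.1 := fun i => by
    obtain ⟨a, ha⟩ := (h4 i).dvd (hDa i)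
    obtain ⟨b, hb⟩ := LocallyDvd.dvd (hcτ i) (hDa i)
    push_cast at ha hb
    exact ⟨b * c i - b ^ 2 - a, by linear_combination -ha + (c i + τ i - 2 * b) * hb⟩
  choose n hn using hdvd
  have hform : ∀ i j, resO inf_le_left (E.form.app _ (F i).2.1 (F i).2.1) =
      (F i).tr (F j) ^ 2 * resO inf_le_right (E.form.app _ (F j).2.1 (F j).2.1) := fun i j => by
    rw [E.form.map_res, E.form.map_res, (F i).tr_spec (F j), E.form.app_smul_smul, sq]
  -- Second lifting: the quotients `n i` are defined only up to `4`-torsion, and modulo it they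
  -- transform by the square of the cocycle. The lift changes `n i` by `4`-torsion, so `4 n i` is
  -- unaffected.
  obtain ⟨b, hb, hbn⟩ := exists_lift_of_isAffine hD hDa (fun i j => (F i).tr (F j) ^ 2)
    (fun i j k W hij hjk hik => by
      rw [resO_pow, resO_pow, resO_pow, ← mul_pow, Frame.tr_mul]) (torsion 4)
    (fun V W h a ha => by
      have := congrArg (resO h) (show ((4 : ℕ) : Γ(X, V)) * a = 0 from ha)
      rwa [resO_mul, resO_natCast, resO_zero] at this)
    (fun V W h g a hV hW ha => by
      obtain ⟨n, hn⟩ := exists_pow_mul_eq_zero hV.isCompact g hW h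
        (a := ((4 : ℕ) : Γ(X, V)) * a) (by
          rw [resO_mul, resO_natCast]
          exact ha)
      exact ⟨n, (mul_left_comm _ _ _).trans hn⟩) n fun i j => by
        show ((4 : ℕ) : Γ(X, _)) * _ = 0
        have h := hform i j
        rw [← hn, ← hn] at h
        simp only [resO_sub, resO_mul, resO_pow, resO_ofNat, hc i j] at h
        push_cast
        linear_combination -h
  have hd : ∀ i, E.form.app _ (F i).2.1 (F i).2.1 = c i ^ 2 - 4 * b i := fun i => by
    have : ((4 : ℕ) : Γ(X, _)) * (b i - n i) = 0 := hbn i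
    push_cast at this
    linear_combination -hn i + this
  -- The values on the finite cover are turned into forms on the whole of `L`, because the
  -- construction of the algebra needs their values on every generator.
  obtain ⟨φ, hφ⟩ := exists_hom_one (N := structureModule X) hD (fun i => (F i).2.2) c
    fun i j => ⟨_, (F i).tr_spec (F j), hc i j⟩
  obtain ⟨B, hB⟩ := BilinearForm.exists_of_frames hD (fun i => (F i).2.2) b
    fun i j => ⟨_, (F i).tr_spec (F j), hb i j⟩
  let t : ∀ {V : X.Opens}, Γ(E.mod, V) → Γ(X, V) := fun {V} s => φ.app V s
  have ht : ∀ i, t (F i).2.1 = c i := hφ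
  have t_res : ∀ {V W : X.Opens} (h : W ≤ V) (s : Γ(E.mod, V)), resO h (t s) = t (res h s) :=
    fun h s => (Hom.app_res φ h s).symm
  have t_smul : ∀ {V : X.Opens} (a : Γ(X, V)) (s : Γ(E.mod, V)), t (a • s) = a * t s :=
    fun a s => Scheme.Modules.Hom.app_smul φ a s
  obtain ⟨S, -, -, -, hS⟩ := QuadraticAlgebra.exists_quadraticAlgebra_of_forms E
    (fun i => t i.2.1) (fun i => B.app _ i.2.1 i.2.1)
    (fun i j => by rw [t_res, t_res, i.tr_spec j, t_smul])
    (fun i j => by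
      rw [B.map_res, B.map_res, i.tr_spec j, B.app_smul_smul, sq])
    (fun i => by
      refine sectionO_ext fun x hx => ?_
      obtain ⟨k, hk⟩ := hD x
      refine ⟨i.1 ⊓ (F k).1, inf_le_left, ⟨hx, hk⟩, ?_⟩
      have h := congrArg (resO (inf_le_right : i.1 ⊓ (F k).1 ≤ _)) (hd k)
      rw [E.form.map_res, ← ht, ← hB, resO_sub, resO_pow, resO_mul, resO_ofNat, t_res,
        B.map_res] at h
      rw [E.form.map_res, resO_sub, resO_pow, resO_mul, resO_ofNat, t_res, B.map_res,
        i.tr_spec (F k), E.form.app_smul_smul, B.app_smul_smul, t_smul, h]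
      ring)
  exact ⟨S, hS⟩

lemma discHom_surjective_of_isAffine [IsAffine X] :
    Function.Surjective (discHom.app (op X)) := by
  intro c
  induction c using Quotient.inductionOn with | _ D =>
  obtain ⟨S, hS⟩ := exists_hasDisc_of_isAffine D
  exact ⟨Quad.mk S, (discHom_app S D).mpr hS⟩

end

section

variable {X Y Z : Scheme.{u}}

section Plus

open GrothendieckTopology.Plus

universe t w' w v

variable {C : Type u} [Category.{v} C] {J : GrothendieckTopology C}
variable {D : Type w} [Category.{w'} D]
variable {FD : D → D → Type*} {CD : D → Type t} [∀ X Y, FunLike (FD X Y) (CD X) (CD Y)]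
variable [ConcreteCategory.{t} D FD]
variable [∀ {X : C} (S : J.Cover X),
  PreservesLimitsOfShape (WalkingMulticospan S.shape) (forget D)]
variable [∀ X : C, HasColimitsOfShape (J.Cover X)ᵒᵖ D]
variable [∀ (P : Cᵒᵖ ⥤ D) (X : C) (S : J.Cover X), HasMultiequalizer (S.index P)]
variable [∀ X : C, PreservesColimitsOfShape (J.Cover X)ᵒᵖ (forget D)]

/-! ### The plus construction in an arbitrary universe -/

/-- A section of the plus construction is represented by a compatible family on a cover, whose
members are the required local preimages. -/
lemma isLocallySurjective_toPlus (P : Cᵒᵖ ⥤ D) :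
    Presheaf.IsLocallySurjective J (J.toPlus P) where
  imageSieve_mem x := by
    obtain ⟨S, x, rfl⟩ := exists_rep x
    exact J.superset_covering (fun Y f hf => ⟨x.1 ⟨Y, f, hf⟩, toPlus_apply S x ⟨Y, f, hf⟩⟩) S.2

lemma isLocallyInjective_toPlus (P : Cᵒᵖ ⥤ D) :
    Presheaf.IsLocallyInjective J (J.toPlus P) where
  equalizerSieve_mem {X} x y h := by
    rw [toPlus_eq_mk, toPlus_eq_mk, eq_mk_iff_exists] at h
    obtain ⟨W, h₁, h₂, eq⟩ := h
    exact J.superset_covering (fun Y f hf => congr_fun (congr_arg Subtype.val eq) ⟨Y, f, hf⟩) W.2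

lemma isLocallySurjective_toSheafify_plus (P : Cᵒᵖ ⥤ D) :
    Presheaf.IsLocallySurjective J (J.toSheafify P) := by
  have h₁ := isLocallySurjective_toPlus (J := J) P
  have h₂ := isLocallySurjective_toPlus (J := J) (J.plusObj P)
  dsimp [GrothendieckTopology.toSheafify]
  rw [GrothendieckTopology.plusMap_toPlus]
  exact @Presheaf.isLocallySurjective_comp _ _ J _ _ _ _ _ _ _ _ _ _ _ h₁ h₂

lemma isLocallyInjective_toSheafify_plus (P : Cᵒᵖ ⥤ D) :
    Presheaf.IsLocallyInjective J (J.toSheafify P) := by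
  have h₁ := isLocallyInjective_toPlus (J := J) P
  have h₂ := isLocallyInjective_toPlus (J := J) (J.plusObj P)
  dsimp [GrothendieckTopology.toSheafify]
  rw [GrothendieckTopology.plusMap_toPlus]
  exact @Presheaf.isLocallyInjective_comp _ _ _ _ _ _ _ _ J _ _ _ _ _ h₁ h₂

end Plus

section Sheaves

variable {F G H : Scheme.{u}ᵒᵖ ⥤ CommMonCat.{u + 1}}

/-! ### The associated sheaves -/

lemma isLocallySurjective_toSheafify (X : TopCat.{u}) (P : (Opens X)ᵒᵖ ⥤ CommMonCat.{u + 1}) :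
    Presheaf.IsLocallySurjective (Opens.grothendieckTopology X)
      (toSheafify (Opens.grothendieckTopology X) P) := by
  have := isLocallySurjective_toSheafify_plus (J := Opens.grothendieckTopology X) P
  rw [← toSheafify_plusPlusIsoSheafify_hom]
  infer_instance

lemma isLocallyInjective_toSheafify (X : TopCat.{u}) (P : (Opens X)ᵒᵖ ⥤ CommMonCat.{u + 1}) :
    Presheaf.IsLocallyInjective (Opens.grothendieckTopology X)
      (toSheafify (Opens.grothendieckTopology X) P) := by
  have := isLocallyInjective_toSheafify_plus (J := Opens.grothendieckTopology X) P
  rw [← toSheafify_plusPlusIsoSheafify_hom]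
  infer_instance

lemma sheafMap_comp (α : F ⟶ G) (β : G ⟶ H) (X : Scheme.{u}) :
    sheafMap (α ≫ β) X = sheafMap α X ≫ sheafMap β X :=
  (presheafToSheaf _ _).map_comp (Functor.whiskerLeft _ α) (Functor.whiskerLeft _ β)

lemma toSheafify_sheafMap (α : F ⟶ G) (X : Scheme.{u}) :
    toSheafify (Opens.grothendieckTopology X) (presheafOf F X) ≫ (sheafMap α X).hom =
      Functor.whiskerLeft _ α ≫ toSheafify (Opens.grothendieckTopology X) (presheafOf G X) :=
  (toSheafify_naturality _ _).symm

lemma presheafPull_naturality (α : F ⟶ G) (f : X ⟶ Y) :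
    Functor.whiskerLeft _ α ≫ presheafPull G f =
      presheafPull F f ≫ Functor.whiskerLeft (Opens.map f.base).op
        (Functor.whiskerLeft ((X.restrictFunctor ⋙ Over.forget X).op) α) := by
  ext V : 2
  exact (α.naturality _).symm

lemma toSheafify_sheafPull (F : Scheme.{u}ᵒᵖ ⥤ CommMonCat.{u + 1}) (f : X ⟶ Y) :
    toSheafify (Opens.grothendieckTopology Y) (presheafOf F Y) ≫ (sheafPull F f).hom =
      presheafPull F f ≫ Functor.whiskerLeft (Opens.map f.base).op
      (toSheafify (Opens.grothendieckTopology X) (presheafOf F X)) :=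
  toSheafify_sheafifyLift _ _ _

/-- Both composites start at an associated sheaf and end in a sheaf, so it suffices to compare them
on the presheaf, where the claim is the naturality of `α`. -/
theorem sheafFunctorial (α : F ⟶ G) : SheafFunctorial α := by
  intro X Y f
  refine Sheaf.hom_ext (sheafify_hom_ext _ _ _
    ((TopCat.Sheaf.pushforward CommMonCat.{u + 1} f.base).obj (sheafOf G X)).2 ?_)
  change toSheafify (Opens.grothendieckTopology Y) (presheafOf F Y) ≫ (sheafMap α Y).hom ≫
      (sheafPull G f).hom =
    toSheafify (Opens.grothendieckTopology Y) (presheafOf F Y) ≫ (sheafPull F f).hom ≫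
      Functor.whiskerLeft (Opens.map f.base).op (sheafMap α X).hom
  have h₁ := congrArg (· ≫ (sheafPull G f).hom) (toSheafify_sheafMap α Y)
  have h₂ := congrArg (Functor.whiskerLeft ((Y.restrictFunctor ⋙ Over.forget Y).op) α ≫ ·)
    (toSheafify_sheafPull G f)
  have h₃ := congrArg (· ≫ Functor.whiskerLeft (Opens.map f.base).op
      (toSheafify (Opens.grothendieckTopology X) (presheafOf G X))) (presheafPull_naturality α f)
  have h₄ := congrArg (fun t => presheafPull F f ≫ Functor.whiskerLeft (Opens.map f.base).op t)
    (toSheafify_sheafMap α X)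
  have h₅ := congrArg (· ≫ Functor.whiskerLeft (Opens.map f.base).op (sheafMap α X).hom)
    (toSheafify_sheafPull F f)
  exact h₁.trans (h₂.trans (h₃.trans (h₄.symm.trans h₅.symm)))

/-! ### Stalks -/

/-- The germ at `x` of a section over an open neighbourhood of `x`. -/
def germAt (x : X) (P : X.Opensᵒᵖ ⥤ CommMonCat.{u + 1}) (U : X.Opens) (hx : x ∈ U) :
    P.obj (op U) ⟶ (stalkAt x).obj P :=
  colimit.ι ((OpenNhds.inclusion (X := X.toTopCat) x).op ⋙ P) (op ⟨U, hx⟩)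

variable (x : X) {P P' : X.Opensᵒᵖ ⥤ CommMonCat.{u + 1}}

lemma germAt_res {U V : X.Opens} (hx : x ∈ V) (i : V ⟶ U) (s : P.obj (op U)) :
    germAt x P V hx (P.map i.op s) = germAt x P U (i.le hx) s :=
  let j : (⟨V, hx⟩ : OpenNhds (X := X.toTopCat) x) ⟶ ⟨U, i.le hx⟩ := homOfLE i.le
  ConcreteCategory.congr_hom
    (colimit.w ((OpenNhds.inclusion (X := X.toTopCat) x).op ⋙ P) j.op) s

lemma map_germAt (φ : P ⟶ P') {U : X.Opens} (hx : x ∈ U) (s : P.obj (op U)) :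
    (stalkAt x).map φ (germAt x P U hx s) = germAt x P' U hx (φ.app (op U) s) :=
  ConcreteCategory.congr_hom (ι_colimMap (Functor.whiskerLeft
    (OpenNhds.inclusion (X := X.toTopCat) x).op φ) (op ⟨U, hx⟩)) s

lemma exists_germAt (z : (stalkAt x).obj P) :
    ∃ (U : X.Opens) (hx : x ∈ U) (s : P.obj (op U)), germAt x P U hx s = z := by
  obtain ⟨U, s, h⟩ := Concrete.colimit_exists_rep
    ((OpenNhds.inclusion (X := X.toTopCat) x).op ⋙ P) z
  exact ⟨U.unop.1, U.unop.2, s, h⟩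

lemma germAt_eq {U V : X.Opens} (hU : x ∈ U) (hV : x ∈ V) (s : P.obj (op U)) (t : P.obj (op V))
    (h : germAt x P U hU s = germAt x P V hV t) :
    ∃ (W : X.Opens) (_ : x ∈ W) (i : W ⟶ U) (j : W ⟶ V), P.map i.op s = P.map j.op t := by
  obtain ⟨W, i, j, h⟩ := Concrete.colimit_exists_of_rep_eq
    ((OpenNhds.inclusion (X := X.toTopCat) x).op ⋙ P) (i := op ⟨U, hU⟩) (j := op ⟨V, hV⟩) s t h
  exact ⟨W.unop.1, W.unop.2, homOfLE (leOfHom i.unop), homOfLE (leOfHom j.unop), h⟩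

/-- Two germs have representatives over the same open set. -/
lemma exists_germAt₂ (z w : (stalkAt x).obj P) :
    ∃ (U : X.Opens) (hx : x ∈ U) (s t : P.obj (op U)),
      germAt x P U hx s = z ∧ germAt x P U hx t = w := by
  obtain ⟨U, hU, s, rfl⟩ := exists_germAt x z
  obtain ⟨V, hV, t, rfl⟩ := exists_germAt x w
  exact ⟨U ⊓ V, ⟨hU, hV⟩, P.map (homOfLE inf_le_left).op s, P.map (homOfLE inf_le_right).op t,
    germAt_res x _ _ _, germAt_res x _ _ _⟩

/-- The exactness criterion for the pair `1`, `f a`, with witnesses `a` and `1`: `f a * 1 = f 1 * f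
a`. -/
lemma map_eq_map {A B C : CommMonCat.{u + 1}} {f : A ⟶ B} {g : B ⟶ C} (h : MonExact f g) (a : A) :
    g (f a) = 1 := by
  have := (h.2.2 1 (f a)).2 ⟨a, 1, by simp⟩
  rw [← this, map_one]

/-- A sequence of presheaves that is exact over all open sets is exact on stalks. -/
theorem monExact_stalkAt {P₁ P₂ P₃ : X.Opensᵒᵖ ⥤ CommMonCat.{u + 1}} (φ : P₁ ⟶ P₂) (ψ : P₂ ⟶ P₃)
    (h : ∀ U : X.Opens, MonExact (φ.app (op U)) (ψ.app (op U))) :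
    MonExact ((stalkAt x).map φ) ((stalkAt x).map ψ) := by
  have h₁ : ∀ a, (stalkAt x).map ψ ((stalkAt x).map φ a) = 1 := fun a => by
    obtain ⟨U, hU, s, rfl⟩ := exists_germAt x a
    rw [map_germAt, map_germAt, map_eq_map (h U), map_one]
  refine ⟨fun a b hab => ?_, fun c => ?_, fun z w => ⟨fun hzw => ?_, ?_⟩⟩
  · obtain ⟨U, hU, s, t, rfl, rfl⟩ := exists_germAt₂ x a b
    rw [map_germAt, map_germAt] at hab
    obtain ⟨W, hW, i, j, e⟩ := germAt_eq x _ _ _ _ hab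
    have : P₁.map i.op s = P₁.map j.op t := (h W).1 ((NatTrans.naturality_apply φ i.op s).trans
      (e.trans (NatTrans.naturality_apply φ j.op t).symm))
    rw [← germAt_res x hW i s, this, germAt_res]
  · obtain ⟨U, hU, s, rfl⟩ := exists_germAt x c
    obtain ⟨r, rfl⟩ := (h U).2.1 s
    exact ⟨germAt x P₂ U hU r, map_germAt x _ _ _⟩
  · obtain ⟨U, hU, s, t, rfl, rfl⟩ := exists_germAt₂ x z w
    rw [map_germAt, map_germAt] at hzw
    obtain ⟨W, hW, i, j, e⟩ := germAt_eq x _ _ _ _ hzw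
    have e' : ψ.app (op W) (P₂.map i.op s) = ψ.app (op W) (P₂.map j.op t) :=
      (NatTrans.naturality_apply ψ i.op s).trans
        (e.trans (NatTrans.naturality_apply ψ j.op t).symm)
    obtain ⟨a, b, hab⟩ := ((h W).2.2 _ _).1 e'
    refine ⟨germAt x P₁ W hW a, germAt x P₁ W hW b, ?_⟩
    rw [map_germAt, map_germAt, ← germAt_res x hW i s, ← germAt_res x hW j t, ← map_mul,
      ← map_mul, hab]
  · rintro ⟨a, b, hab⟩
    simpa [h₁] using congrArg ((stalkAt x).map ψ) hab

/-- A locally bijective map of presheaves is bijective on stalks. -/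
theorem bijective_stalkAt_map (φ : P ⟶ P')
    (h₁ : Presheaf.IsLocallyInjective (Opens.grothendieckTopology X) φ)
    (h₂ : Presheaf.IsLocallySurjective (Opens.grothendieckTopology X) φ) :
    Function.Bijective ((stalkAt x).map φ) := by
  refine ⟨fun a b hab => ?_, fun c => ?_⟩
  · obtain ⟨U, hU, s, t, rfl, rfl⟩ := exists_germAt₂ x a b
    rw [map_germAt, map_germAt] at hab
    obtain ⟨W, hW, i, j, e⟩ := germAt_eq x _ _ _ _ hab
    obtain ⟨V, k, hk, hV⟩ := h₁.1 (X := op W) (P.map i.op s) (P.map j.op t)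
      ((NatTrans.naturality_apply φ i.op s).trans
      (e.trans (NatTrans.naturality_apply φ j.op t).symm)) x hW
    rw [← germAt_res x hW i s, ← germAt_res x hW j t, ← germAt_res x hV k, ← germAt_res x hV k]
    exact congrArg _ hk
  · obtain ⟨U, hU, s, rfl⟩ := exists_germAt x c
    obtain ⟨V, k, ⟨t, ht⟩, hV⟩ := h₂.1 s x hU
    refine ⟨germAt x P V hV t, ?_⟩
    rw [map_germAt, ← germAt_res x hV k]
    exact congrArg _ ht

lemma MonExact.of_bijective {A B C A' B' C' : CommMonCat.{u + 1}} {f : A ⟶ B} {g : B ⟶ C}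
    (h : MonExact f g) {f' : A' ⟶ B'} {g' : B' ⟶ C'} (a : A ⟶ A') (b : B ⟶ B') (c : C ⟶ C')
    (ha : Function.Bijective a) (hb : Function.Bijective b) (hc : Function.Bijective c)
    (hf : a ≫ f' = f ≫ b) (hg : b ≫ g' = g ≫ c) : MonExact f' g' := by
  have hf' : ∀ z, f' (a z) = b (f z) := fun z => ConcreteCategory.congr_hom hf z
  have hg' : ∀ z, g' (b z) = c (g z) := fun z => ConcreteCategory.congr_hom hg z
  refine ⟨fun z w hzw => ?_, fun z => ?_, fun z w => ?_⟩
  · obtain ⟨z, rfl⟩ := ha.2 z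
    obtain ⟨w, rfl⟩ := ha.2 w
    rw [hf', hf'] at hzw
    rw [h.1 (hb.1 hzw)]
  · obtain ⟨z, rfl⟩ := hc.2 z
    obtain ⟨z, rfl⟩ := h.2.1 z
    exact ⟨b z, hg' z⟩
  · obtain ⟨z, rfl⟩ := hb.2 z
    obtain ⟨w, rfl⟩ := hb.2 w
    rw [hg', hg', hc.1.eq_iff, h.2.2, ha.2.exists₂]
    simp only [hf', ← map_mul, hb.1.eq_iff]

/-- The map from a presheaf to its associated sheaf is locally bijective, hence bijective on stalks,
and exactness is carried across these bijections. -/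
theorem sheafExact (α : F ⟶ G) (β : G ⟶ H)
    (h : ∀ X : Scheme.{u}, MonExact (α.app (op X)) (β.app (op X))) (X : Scheme.{u}) :
    SheafExact (sheafMap α X) (sheafMap β X) := fun x =>
  have hb (F : Scheme.{u}ᵒᵖ ⥤ CommMonCat.{u + 1}) := bijective_stalkAt_map x
    (toSheafify (Opens.grothendieckTopology X) (presheafOf F X))
    (isLocallyInjective_toSheafify _ _) (isLocallySurjective_toSheafify _ _)
  have hm {F G : Scheme.{u}ᵒᵖ ⥤ CommMonCat.{u + 1}} (α : F ⟶ G) :=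
    ((stalkAt x).map_comp _ _).symm.trans
      ((congrArg (stalkAt x).map (toSheafify_sheafMap α X)).trans ((stalkAt x).map_comp _ _))
  (monExact_stalkAt x (Functor.whiskerLeft ((X.restrictFunctor ⋙ Over.forget X).op) α)
    (Functor.whiskerLeft ((X.restrictFunctor ⋙ Over.forget X).op) β) fun U => h U).of_bijective _ _ _ (hb F) (hb G) (hb H) (hm α) (hm β)

/-- A section of the associated sheaf comes locally from the presheaf; on a smaller affine open set
that presheaf section has a preimage under `α`. -/
theorem sheafSurjective (α : F ⟶ G)
    (h : ∀ X : Scheme.{u}, IsAffine X → Function.Surjective (α.app (op X))) (X : Scheme.{u}) :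
    SheafSurjective (sheafMap α X) := by
  refine ⟨fun {U} s x hx => ?_⟩
  obtain ⟨V, i, ⟨t, ht⟩, hV⟩ := (isLocallySurjective_toSheafify X.toTopCat (presheafOf G X)).1
    (U := U) s x hx
  obtain ⟨_, ⟨W, hW, rfl⟩, hxW, hWV⟩ := X.isBasis_affineOpens.exists_subset_of_mem_open hV V.2
  let j : W ⟶ (V : X.Opens) := homOfLE hWV
  obtain ⟨r, hr⟩ := h W hW ((presheafOf G X).map j.op t)
  refine ⟨W, j ≫ i, ⟨(toSheafify (Opens.grothendieckTopology X) (presheafOf F X)).app (op W) r,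
    ?_⟩, hxW⟩
  have h₁ : (sheafMap α X).hom.app (op W)
      ((toSheafify (Opens.grothendieckTopology X) (presheafOf F X)).app (op W) r) =
      (toSheafify (Opens.grothendieckTopology X) (presheafOf G X)).app (op W)
        (α.app (op (W : Scheme.{u})) r) :=
    ConcreteCategory.congr_hom (NatTrans.congr_app (toSheafify_sheafMap α X) (op W)) r
  have h₂ := congrArg ((sheafOf G X).obj.map j.op) ht
  have h₃ := NatTrans.naturality_apply
    (toSheafify (Opens.grothendieckTopology X) (presheafOf G X)) j.op t
  have h₄ := ConcreteCategory.congr_hom ((sheafOf G X).obj.map_comp i.op j.op) s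
  exact h₁.trans ((congrArg _ hr).trans (h₃.trans (h₂.trans h₄.symm)))

end Sheaves

end

end QuadDisc

end

/-! ### The main theorem -/

theorem theoremB :
    ∃ (Q : QuadDisc.QuadMonoids.{u}) (D : QuadDisc.DiscMonoids.{u}) (P : QuadDisc.PicMonoids.{u})
      (Q₁ D₁ : Scheme.{u}ᵒᵖ ⥤ CommMonCat.{u + 1})
      (i : Q₁ ⟶ Q.functor) (w : Q.functor ⟶ P.functor)
      (j : D₁ ⟶ D.functor) (p : D.functor ⟶ P.functor)
      (δ₁ : Q₁ ⟶ D₁) (δ : Q.functor ⟶ D.functor),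
      -- the monoids `Quad(X; O_X)` and `Disc(X; O_X)` with their inclusions
      (∀ X : Scheme.{u},
        Function.Injective (i.app (op X)) ∧
        Set.range (i.app (op X)) = QuadDisc.QuadWith X (QuadDisc.structureModule X)) ∧
      (∀ X : Scheme.{u},
        Function.Injective (j.app (op X)) ∧
        Set.range (j.app (op X)) = QuadDisc.DiscWith X (QuadDisc.structureModule X)) ∧
      -- the maps `⋀²`, the forgetful map and the discriminant
      (∀ (X : Scheme.{u}) (S : QuadDisc.QuadraticAlgebra X) (L : QuadDisc.InvertibleSheaf X),
        w.app (op X) (QuadDisc.Quad.mk S) = QuadDisc.Pic.mk L ↔ S.HasWedge L.mod) ∧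
      (∀ (X : Scheme.{u}) (d : QuadDisc.Discriminant X),
        p.app (op X) (QuadDisc.Disc.mk d) = QuadDisc.Pic.mk d.toInvertibleSheaf) ∧
      (∀ (X : Scheme.{u}) (S : QuadDisc.QuadraticAlgebra X) (d : QuadDisc.Discriminant X),
        δ.app (op X) (QuadDisc.Quad.mk S) = QuadDisc.Disc.mk d ↔ S.HasDisc d) ∧
      -- the diagram of commutative monoids commutes, with the identity of `Pic` as third column
      i ≫ δ = δ₁ ≫ j ∧
      w = δ ≫ p ∧
      -- its rows are exact
      (∀ X : Scheme.{u},
        QuadDisc.MonExact (i.app (op X)) (w.app (op X)) ∧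
        QuadDisc.MonExact (j.app (op X)) (p.app (op X))) ∧
      -- its columns are surjective over the members of an affine open cover
      (∀ X : Scheme.{u}, ∃ (ι : Type u) (U : ι → X.Opens),
        (⨆ k, U k) = ⊤ ∧ ∀ k, IsAffineOpen (U k) ∧
          Function.Surjective (δ₁.app (op (U k : Scheme.{u}))) ∧
          Function.Surjective (δ.app (op (U k : Scheme.{u})))) ∧
      -- the diagram of associated sheaves on `X` commutes, its rows are exact and its columns are
      -- surjective
      (∀ X : Scheme.{u},
        QuadDisc.sheafMap i X ≫ QuadDisc.sheafMap δ X =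
          QuadDisc.sheafMap δ₁ X ≫ QuadDisc.sheafMap j X ∧
        QuadDisc.sheafMap w X = QuadDisc.sheafMap δ X ≫ QuadDisc.sheafMap p X ∧
        QuadDisc.SheafExact (QuadDisc.sheafMap i X) (QuadDisc.sheafMap w X) ∧
        QuadDisc.SheafExact (QuadDisc.sheafMap j X) (QuadDisc.sheafMap p X) ∧
        QuadDisc.SheafSurjective (QuadDisc.sheafMap δ₁ X) ∧
        QuadDisc.SheafSurjective (QuadDisc.sheafMap δ X)) ∧
      -- and it is functorial in `X`
      QuadDisc.SheafFunctorial i ∧ QuadDisc.SheafFunctorial w ∧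
      QuadDisc.SheafFunctorial j ∧ QuadDisc.SheafFunctorial p ∧
      QuadDisc.SheafFunctorial δ₁ ∧ QuadDisc.SheafFunctorial δ := by
  refine ⟨QuadDisc.quadMonoids, QuadDisc.discMonoids, QuadDisc.picMonoids,
    QuadDisc.kernelFunctor (QuadDisc.discHom ≫ QuadDisc.picHom),
    QuadDisc.kernelFunctor QuadDisc.picHom,
    QuadDisc.kernelInclusion (QuadDisc.discHom ≫ QuadDisc.picHom),
    QuadDisc.discHom ≫ QuadDisc.picHom, QuadDisc.kernelInclusion QuadDisc.picHom,
    QuadDisc.picHom, QuadDisc.kernelMap QuadDisc.discHom QuadDisc.picHom, QuadDisc.discHom,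
    fun X => ⟨QuadDisc.kernelInclusion_injective _ (op X), QuadDisc.range_kernelInclusion_quad⟩,
    fun X => ⟨QuadDisc.kernelInclusion_injective _ (op X), QuadDisc.range_kernelInclusion_disc⟩,
    fun X S L => QuadDisc.wedgeHom_app S L, fun X d => QuadDisc.picHom_app d,
    fun X S d => QuadDisc.discHom_app S d, QuadDisc.kernelInclusion_comp _ _, rfl,
    fun X => ⟨QuadDisc.monExact_quad X, QuadDisc.monExact_disc X⟩,
    -- The cover by all affine open sets works, because surjectivity holds over each of them.
    fun X => ⟨X.affineOpens, fun k => k.1, iSup_affineOpens_eq_top X, fun k => ?_⟩,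
    fun X => ⟨?_, QuadDisc.sheafMap_comp _ _ X,
      QuadDisc.sheafExact _ _ QuadDisc.monExact_quad X,
      QuadDisc.sheafExact _ _ QuadDisc.monExact_disc X,
      QuadDisc.sheafSurjective _ (fun Y hY => QuadDisc.kernelMap_surjective _ _ (op Y)
        QuadDisc.discHom_surjective_of_isAffine) X,
      QuadDisc.sheafSurjective _ (fun Y hY => QuadDisc.discHom_surjective_of_isAffine) X⟩,
    QuadDisc.sheafFunctorial _, QuadDisc.sheafFunctorial _, QuadDisc.sheafFunctorial _,
    QuadDisc.sheafFunctorial _, QuadDisc.sheafFunctorial _, QuadDisc.sheafFunctorial _⟩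
  · have : IsAffine (k.1 : Scheme.{u}) := k.2
    exact ⟨k.2, QuadDisc.kernelMap_surjective _ _ _ QuadDisc.discHom_surjective_of_isAffine,
      QuadDisc.discHom_surjective_of_isAffine⟩
  · rw [← QuadDisc.sheafMap_comp, ← QuadDisc.sheafMap_comp, QuadDisc.kernelInclusion_comp]
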